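/- Let $\Omega\subset\mathbb R^d$ be open, connected and bounded, $Y=L^2(\Omega)$, $V=H^1_0(\Omega)$ (real-valued functions, $V$ with the $H^1$ norm), with the Gelfand triple $V\subset Y\subset V^*$; let $\mathcal U$ be a real Hilbert space, $I=(0,\infty)$, $U=L^2(I;\mathcal U)$. For $0<T\le\infty$ let $$W(0,T)=\{y\in L^2(0,T;V):\ \tfrac{dy}{dt}\in L^2(0,T;V^*)\},\qquad \|y\|^2_{W(0,T)}=\|y\|^2_{L^2(0,T;V)}+\|\tfrac{dy}{dt}\|^2_{L^2(0,T;V^*)},$$ and $W_\infty=W(0,\infty)$; elements of $W_\infty$ are identified with their representatives in $C([0,\infty);Y)$. Let $\alpha,\eta>0$ and $U_{ad}=\{u\in U:\ \|u(t)\|_{\mathcal U}\le\eta\text{ for a.e. }t>0\}$. Assume: (A1) $\mathcal A:\mathcal D(\mathcal A)\subset Y\to Y$ generates a strongly continuous analytic semigroup on $Y$, $\mathcal D(\mathcal A)\subset V$, and $\mathcal A$ extends to an operator $\mathcal A\in\mathcal L(V,V^*)$ satisfying, for some $\rho\ge0$ and $\theta>0$, Gårding's inequality $\langle(\rho I-\mathcal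 A)v,v\rangle_{V^*,V}\ge\theta\|v\|_V^2$ for all $v\in V$. (A2) $B\in\mathcal L(\mathcal U,Y)$, and there is $K\in\mathcal L(Y,\mathcal U)$ such that the semigroup generated by $\mathcal A-BK$ is exponentially stable on $Y$. (A3) $\mathcal F:W_\infty\to L^2(I;V^*)$ is the substitution operator $(\mathcal Fy)(t)=\mathfrak f(y(t))$ of a function $\mathfrak f:\mathbb R\to\mathbb R$ (that is, for a.e. $t$ the function $\mathfrak f\circ y(t)$ is locally integrable on $\Omega$ and coincides, as a distribution, with an element $(\mathcal Fy)(t)$ of $V^*$). It is twice continuously Fréchet differentiable, $\mathcal F''$ is bounded on bounded subsets of $W_\infty$, $\mathcal F(0)=0$ and $\mathcal F'(0)=0$. (A4) There is a Hilbert space $\mathcal H$, continuously and densely embedded in $V$, such that for every $T>0$ the substitution operator of $\mathfrak f$ maps $W(0,T)$ into $L^1(0,T;\mathcal H^*)$ and is weak-to-weak sequentially continuous. For $y_0\in Y$ consider the problem $$(\mathcal P)\qquad \min_{(y,u)\in W_\infty\times U_{ad}} J(y,u)=\frac12\int_0^\infty\|y(t)\|_Y^2\,dt+\frac\alpha2\int_0^\infty\|u(t)\|_{\mathcal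 U}^2\,dt$$ subject to $y_t=\mathcal Ay+\mathcal F(y)+Bu$ in $L^2(I;V^*)$ and $y(0)=y_0$ in $Y$. Then there exist $\delta_1>0$ and $M>0$ such that for every $y_0\in Y$ with $\|y_0\|_Y<\delta_1$ problem $(\mathcal P)$ possesses a (global) solution $(\bar y,\bar u)\in W_\infty\times U_{ad}$, and every such solution satisfies $$\max\{\|\bar y\|_{W_\infty},\|\bar u\|_U\}\le M\|y_0\|_Y.$$ -/

import Mathlib

open MeasureTheory Set Filter Topology
open scoped ContDiff

noncomputable section

namespace ParabolicControl

/-- `φ ∈ C_c^∞(O)`. -/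
def IsTest {E : Type*} [NormedAddCommGroup E] [NormedSpace ℝ E] (O : Set E) (φ : E → ℝ) : Prop :=
  ContDiff ℝ ∞ φ ∧ HasCompactSupport φ ∧ tsupport φ ⊆ O

/-! ### The Gelfand triple `V = H¹₀(Ω) ⊂ Y = L²(Ω) ⊂ V*` -/

/-- `Y = L²(Ω)`, real valued. -/
abbrev Y {d : ℕ} (Ω : Set (EuclideanSpace ℝ (Fin d))) : Type :=
  Lp ℝ 2 (volume.restrict Ω)

/-- `L²(Ω; ℂ)`, the complexification of `L²(Ω)`. -/
abbrev YC {d : ℕ} (Ω : Set (EuclideanSpace ℝ (Fin d))) : Type :=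
  Lp ℂ 2 (volume.restrict Ω)

/-- The canonical inclusion `L²(Ω) → L²(Ω; ℂ)`. -/
def complexify {d : ℕ} (Ω : Set (EuclideanSpace ℝ (Fin d))) : Y Ω →L[ℝ] YC Ω :=
  Complex.ofRealCLM.compLpL 2 (volume.restrict Ω)

/-- The space of pairs `(v, G)` with `v ∈ L²(Ω)`, `G ∈ L²(Ω; ℝ^d)`, with the Hilbert norm
`(‖v‖² + ‖G‖²)^(1/2)`. -/
abbrev GraphSpace {d : ℕ} (Ω : Set (EuclideanSpace ℝ (Fin d))) : Type :=
  WithLp 2 (Lp ℝ 2 (volume.restrict Ω) × Lp (EuclideanSpace ℝ (Fin d)) 2 (volume.restrict Ω))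

/-- `H¹₀(Ω)`: the closure of `C_c^∞(Ω)` in the `H¹` norm. A function `v` is stored together with
its weak gradient, as the pair `(v, ∇v)`. -/
def H10 {d : ℕ} (Ω : Set (EuclideanSpace ℝ (Fin d))) : Submodule ℝ (GraphSpace Ω) :=
  (Submodule.span ℝ {w : GraphSpace Ω | ∃ φ : EuclideanSpace ℝ (Fin d) → ℝ, IsTest Ω φ ∧
    (w.fst =ᵐ[volume.restrict Ω] φ) ∧
    (w.snd =ᵐ[volume.restrict Ω] gradient φ)}).topologicalClosure

/-- `V = H¹₀(Ω)` with the `H¹` norm. -/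
def V {d : ℕ} (Ω : Set (EuclideanSpace ℝ (Fin d))) : Type := ↥(H10 Ω)

instance {d : ℕ} (Ω : Set (EuclideanSpace ℝ (Fin d))) : NormedAddCommGroup (V Ω) :=
  inferInstanceAs (NormedAddCommGroup ↥(H10 Ω))

instance {d : ℕ} (Ω : Set (EuclideanSpace ℝ (Fin d))) : InnerProductSpace ℝ (V Ω) :=
  inferInstanceAs (InnerProductSpace ℝ ↥(H10 Ω))

instance {d : ℕ} (Ω : Set (EuclideanSpace ℝ (Fin d))) : CompleteSpace (V Ω) :=
  (Submodule.isClosed_topologicalClosure _).completeSpace_coe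

/-- The topological dual `V*` with the dual norm. -/
abbrev VDual {d : ℕ} (Ω : Set (EuclideanSpace ℝ (Fin d))) : Type := StrongDual ℝ (V Ω)

/-- The embedding `V → Y`. -/
def incl {d : ℕ} (Ω : Set (EuclideanSpace ℝ (Fin d))) : V Ω →L[ℝ] Y Ω :=
  (WithLp.fstL 2 ℝ (Lp ℝ 2 (volume.restrict Ω))
    (Lp (EuclideanSpace ℝ (Fin d)) 2 (volume.restrict Ω))).comp (H10 Ω).subtypeL

/-- The embedding `Y → V*` of the Gelfand triple, `y ↦ (v ↦ (y, v)_Y)`. -/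
def pivot {d : ℕ} (Ω : Set (EuclideanSpace ℝ (Fin d))) : Y Ω →L[ℝ] VDual Ω :=
  ((ContinuousLinearMap.compL ℝ (V Ω) (Y Ω) ℝ).flip (incl Ω)).comp
    (innerSL ℝ : Y Ω →L[ℝ] Y Ω →L[ℝ] ℝ)

/-- The embedding `V → V*` of the Gelfand triple. -/
def gelfand {d : ℕ} (Ω : Set (EuclideanSpace ℝ (Fin d))) : V Ω →L[ℝ] VDual Ω :=
  (pivot Ω).comp (incl Ω)

/-! ### Bochner spaces and the spaces `W(0,T)`, `W_∞` -/

/-- `L²(J; X) × L²(J; Z)` with the norm `(‖y‖² + ‖g‖²)^(1/2)`. -/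
abbrev PairSpace (X Z : Type*) [NormedAddCommGroup X] [NormedAddCommGroup Z] (J : Set ℝ) :
    Type _ :=
  WithLp 2 (Lp X 2 (volume.restrict J) × Lp Z 2 (volume.restrict J))

/-- `g = dy/dt` on the open set `J` in the sense of `Z`-valued distributions, where `X` is regarded
as a subspace of `Z` through the embedding `e`. -/
def IsWeakTimeDeriv {X Z : Type*} [NormedAddCommGroup X] [NormedSpace ℝ X]
    [NormedAddCommGroup Z] [NormedSpace ℝ Z] (e : X →L[ℝ] Z) (J : Set ℝ)
    (y : Lp X 2 (volume.restrict J)) (g : Lp Z 2 (volume.restrict J)) : Prop :=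
  ∀ φ : ℝ → ℝ, IsTest J φ → ∫ t in J, deriv φ t • e (y t) = -∫ t in J, φ t • g t

theorem integrable_smul_of_compact {E : Type*} [NormedAddCommGroup E] [NormedSpace ℝ E]
    (J : Set ℝ) (ψ : ℝ → ℝ) (hψ : Continuous ψ) (hc : HasCompactSupport ψ)
    (g : ℝ → E) (hg : MemLp g 2 (volume.restrict J)) :
    Integrable (fun t => ψ t • g t) (volume.restrict J) := by
  have h1 : MemLp ψ 2 (volume.restrict J) := (hψ.memLp_of_hasCompactSupport hc)
  exact memLp_one_iff_integrable.1 (hg.smul h1)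

theorem IsTest.integrable_deriv {X Z : Type*} [NormedAddCommGroup X] [NormedSpace ℝ X]
    [NormedAddCommGroup Z] [NormedSpace ℝ Z] (e : X →L[ℝ] Z) {J : Set ℝ}
    {φ : ℝ → ℝ} (hφ : IsTest J φ) (y : Lp X 2 (volume.restrict J)) :
    Integrable (fun t => deriv φ t • e (y t)) (volume.restrict J) :=
  integrable_smul_of_compact J _ (hφ.1.continuous_deriv (by simp)) hφ.2.1.deriv _
    (e.comp_memLp' (Lp.memLp y))

theorem IsTest.integrable_smul {Z : Type*} [NormedAddCommGroup Z] [NormedSpace ℝ Z] {J : Set ℝ}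
    {φ : ℝ → ℝ} (hφ : IsTest J φ) (g : Lp Z 2 (volume.restrict J)) :
    Integrable (fun t => φ t • g t) (volume.restrict J) :=
  integrable_smul_of_compact J _ hφ.1.continuous hφ.2.1 _ (Lp.memLp g)

/-- `{y ∈ L²(J; X) : dy/dt ∈ L²(J; Z)}`, with norm
`(‖y‖²_{L²(J;X)} + ‖dy/dt‖²_{L²(J;Z)})^(1/2)`. An element `y` is stored together with its
(unique) weak derivative, as the pair `(y, dy/dt)`. -/
def timeSobolev {X Z : Type*} [NormedAddCommGroup X] [NormedSpace ℝ X]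
    [NormedAddCommGroup Z] [NormedSpace ℝ Z] (e : X →L[ℝ] Z) (J : Set ℝ) :
    Submodule ℝ (PairSpace X Z J) where
  carrier := {w | IsWeakTimeDeriv e J w.fst w.snd}
  zero_mem' := by
    intro φ hφ
    have h1 : ∀ᵐ t ∂volume.restrict J, deriv φ t • e ((0 : PairSpace X Z J).fst t) = 0 := by
      filter_upwards [Lp.coeFn_zero X 2 (volume.restrict J)] with t ht
      rw [WithLp.zero_fst, ht]; simp
    have h2 : ∀ᵐ t ∂volume.restrict J, φ t • (0 : PairSpace X Z J).snd t = 0 := by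
      filter_upwards [Lp.coeFn_zero Z 2 (volume.restrict J)] with t ht
      rw [WithLp.zero_snd, ht]; simp
    rw [integral_congr_ae h1, integral_congr_ae h2]; simp
  add_mem' := by
    intro a b ha hb φ hφ
    have h1 : ∀ᵐ t ∂volume.restrict J, deriv φ t • e ((a + b).fst t) =
        deriv φ t • e (a.fst t) + deriv φ t • e (b.fst t) := by
      filter_upwards [Lp.coeFn_add a.fst b.fst] with t ht
      rw [WithLp.add_fst, ht]; simp
    have h2 : ∀ᵐ t ∂volume.restrict J, φ t • (a + b).snd t = φ t • a.snd t + φ t • b.snd t := by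
      filter_upwards [Lp.coeFn_add a.snd b.snd] with t ht
      rw [WithLp.add_snd, ht]; simp
    rw [integral_congr_ae h1, integral_congr_ae h2,
      integral_add (hφ.integrable_deriv e _) (hφ.integrable_deriv e _),
      integral_add (hφ.integrable_smul _) (hφ.integrable_smul _), ha φ hφ, hb φ hφ]
    abel
  smul_mem' := by
    intro c a ha φ hφ
    have h1 : ∀ᵐ t ∂volume.restrict J, deriv φ t • e ((c • a).fst t) =
        c • (deriv φ t • e (a.fst t)) := by
      filter_upwards [Lp.coeFn_smul c a.fst] with t ht
      rw [WithLp.smul_fst, ht]; simp [smul_comm c]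
    have h2 : ∀ᵐ t ∂volume.restrict J, φ t • (c • a).snd t = c • (φ t • a.snd t) := by
      filter_upwards [Lp.coeFn_smul c a.snd] with t ht
      rw [WithLp.smul_snd, ht]; simp [smul_comm c]
    rw [integral_congr_ae h1, integral_congr_ae h2, integral_smul, integral_smul, ha φ hφ,
      smul_neg]

/-- `W(J) = {y ∈ L²(J; V) : dy/dt ∈ L²(J; V*)}`. -/
abbrev W {d : ℕ} (Ω : Set (EuclideanSpace ℝ (Fin d))) (J : Set ℝ) : Type :=
  ↥(timeSobolev (gelfand Ω) J)

/-- The function `y` underlying an element of `W(J)`. -/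
def W.state {d : ℕ} {Ω : Set (EuclideanSpace ℝ (Fin d))} {J : Set ℝ} (y : W Ω J) :
    Lp (V Ω) 2 (volume.restrict J) := (y : PairSpace (V Ω) (VDual Ω) J).fst

/-- The time derivative `dy/dt` of an element of `W(J)`. -/
def W.timeDeriv {d : ℕ} {Ω : Set (EuclideanSpace ℝ (Fin d))} {J : Set ℝ} (y : W Ω J) :
    Lp (VDual Ω) 2 (volume.restrict J) := (y : PairSpace (V Ω) (VDual Ω) J).snd

/-- `W_∞ = W(0,∞)`. -/
abbrev WInf {d : ℕ} (Ω : Set (EuclideanSpace ℝ (Fin d))) : Type := W Ω (Ioi 0)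

/-- `L²(I; V*)`, `I = (0,∞)`. -/
abbrev L2VDual {d : ℕ} (Ω : Set (EuclideanSpace ℝ (Fin d))) : Type :=
  Lp (VDual Ω) 2 (volume.restrict (Ioi (0 : ℝ)))

/-- `U = L²(0,∞; 𝒰)`. -/
abbrev Ctrl (𝒰 : Type*) [NormedAddCommGroup 𝒰] : Type _ :=
  Lp 𝒰 2 (volume.restrict (Ioi (0 : ℝ)))

/-- `y(0) = y₀` in `Y`: the representative of `y ∈ W_∞` in `C([0,∞); Y)` has the value `y₀`
at `0`. -/
def HasInitialValue {d : ℕ} {Ω : Set (EuclideanSpace ℝ (Fin d))} (y : WInf Ω) (y₀ : Y Ω) : Prop :=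
  ∃ c : ℝ → Y Ω, ContinuousOn c (Ici 0) ∧
    (∀ᵐ t ∂volume.restrict (Ioi (0 : ℝ)), incl Ω (W.state y t) = c t) ∧ c 0 = y₀

/-! ### Semigroups on `Y` -/

/-- `(S t)_{t ≥ 0}` is a strongly continuous semigroup. -/
structure IsC0Semigroup {X : Type*} [NormedAddCommGroup X] [NormedSpace ℝ X]
    (S : ℝ → X →L[ℝ] X) : Prop where
  zero : S 0 = ContinuousLinearMap.id ℝ X
  add : ∀ s t, 0 ≤ s → 0 ≤ t → S (s + t) = (S s).comp (S t)
  tendsto : ∀ x, Tendsto (fun t => S t x) (𝓝[>] 0) (𝓝 x)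

/-- `A` is the infinitesimal generator of `S`: `x ∈ D(A)` and `A x = z` iff
`(S t x - x) / t → z` as `t ↓ 0`. -/
def IsGenerator {X : Type*} [NormedAddCommGroup X] [NormedSpace ℝ X]
    (A : X →ₗ.[ℝ] X) (S : ℝ → X →L[ℝ] X) : Prop :=
  ∀ x z : X, Tendsto (fun t : ℝ => t⁻¹ • (S t x - x)) (𝓝[>] 0) (𝓝 z) ↔ (x, z) ∈ A.graph

def IsExpStable {X : Type*} [NormedAddCommGroup X] [NormedSpace ℝ X]
    (S : ℝ → X →L[ℝ] X) : Prop :=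
  ∃ C μ : ℝ, 0 < μ ∧ ∀ t, 0 ≤ t → ‖S t‖ ≤ C * Real.exp (-μ * t)

/-- The open sector `{z ≠ 0 : |arg z| < θ}`. -/
def sector (θ : ℝ) : Set ℂ := {z | z ≠ 0 ∧ |Complex.arg z| < θ}

/-- The semigroup `S` on `L²(Ω)` is analytic: (its complexification) extends to a holomorphic,
strongly continuous semigroup on a sector around the positive half-axis. -/
def IsAnalyticSemigroup {d : ℕ} {Ω : Set (EuclideanSpace ℝ (Fin d))}
    (S : ℝ → Y Ω →L[ℝ] Y Ω) : Prop :=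
  ∃ θ : ℝ, 0 < θ ∧ θ < Real.pi / 2 ∧ ∃ T : ℂ → YC Ω →L[ℂ] YC Ω,
    (∀ t : ℝ, 0 ≤ t → ∀ x : Y Ω, T t (complexify Ω x) = complexify Ω (S t x)) ∧
    DifferentiableOn ℂ T (sector θ) ∧
    (∀ z ∈ sector θ, ∀ w ∈ sector θ, T (z + w) = (T z).comp (T w)) ∧
    ∀ x, Tendsto (fun z => T z x) (𝓝[sector θ] 0) (𝓝 x)

/-- `A` generates a strongly continuous analytic semigroup on `Y`. -/
def GeneratesAnalyticSemigroup {d : ℕ} {Ω : Set (EuclideanSpace ℝ (Fin d))}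
    (A : Y Ω →ₗ.[ℝ] Y Ω) : Prop :=
  ∃ S : ℝ → Y Ω →L[ℝ] Y Ω, IsC0Semigroup S ∧ IsGenerator A S ∧ IsAnalyticSemigroup S

/-- `D(A) ⊂ V` and `𝒜 : V → V*` extends `A`. -/
def IsExtension {d : ℕ} {Ω : Set (EuclideanSpace ℝ (Fin d))}
    (A : Y Ω →ₗ.[ℝ] Y Ω) (𝒜 : V Ω →L[ℝ] VDual Ω) : Prop :=
  ∀ x : A.domain, ∃ v : V Ω, incl Ω v = x ∧ 𝒜 v = pivot Ω (A x)

/-- Gårding's inequality `⟨(ρ I - 𝒜) v, v⟩ ≥ θ ‖v‖²_V`. -/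
def Garding {d : ℕ} {Ω : Set (EuclideanSpace ℝ (Fin d))} (𝒜 : V Ω →L[ℝ] VDual Ω) : Prop :=
  ∃ ρ θ : ℝ, 0 ≤ ρ ∧ 0 < θ ∧ ∀ v : V Ω, θ * ‖v‖ ^ 2 ≤ ρ * ‖incl Ω v‖ ^ 2 - 𝒜 v v

/-- Stabilizability of `(A, B)`: for some `K ∈ ℒ(Y, 𝒰)` the operator `A - BK` (with domain
`D(A)`) generates an exponentially stable semigroup on `Y`. -/
def Stabilizable {d : ℕ} {Ω : Set (EuclideanSpace ℝ (Fin d))}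
    {𝒰 : Type*} [NormedAddCommGroup 𝒰] [NormedSpace ℝ 𝒰]
    (A : Y Ω →ₗ.[ℝ] Y Ω) (B : 𝒰 →L[ℝ] Y Ω) : Prop :=
  ∃ (K : Y Ω →L[ℝ] 𝒰) (S : ℝ → Y Ω →L[ℝ] Y Ω), IsC0Semigroup S ∧
    IsGenerator ((-(B.comp K) : Y Ω →L[ℝ] Y Ω).toLinearMap +ᵥ A) S ∧ IsExpStable S

/-! ### The nonlinearity -/

/-- The function `f ∘ w` on `Ω` belongs to `V*` and equals `g` there: it is locally integrable
and `⟨g, φ⟩ = ∫_Ω f(w) φ` for all `φ ∈ C_c^∞(Ω)`. -/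
def Represents {d : ℕ} {Ω : Set (EuclideanSpace ℝ (Fin d))} (f : ℝ → ℝ) (w : Y Ω)
    (g : VDual Ω) : Prop :=
  LocallyIntegrableOn (fun x => f (w x)) Ω ∧
    ∀ (v : V Ω) (φ : EuclideanSpace ℝ (Fin d) → ℝ), IsTest Ω φ →
      (incl Ω v =ᵐ[volume.restrict Ω] φ) → g v = ∫ x in Ω, f (w x) * φ x

/-- `F : W_∞ → L²(I; V*)` is the substitution operator `(F y)(t) = f(y(t))`. -/
def IsSubstitution {d : ℕ} {Ω : Set (EuclideanSpace ℝ (Fin d))} (f : ℝ → ℝ)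
    (F : WInf Ω → L2VDual Ω) : Prop :=
  ∀ y : WInf Ω, ∀ᵐ t ∂volume.restrict (Ioi (0 : ℝ)), Represents f (incl Ω (W.state y t)) (F y t)

/-- `G : W(0,T) → L¹(0,T; H*)` is the substitution operator `(G y)(t) = f(y(t))`, where an element
of `V*` is regarded as an element of `H*` through the embedding `j : H → V`. -/
def IsSubstitutionOn {d : ℕ} {Ω : Set (EuclideanSpace ℝ (Fin d))}
    {H : Type*} [NormedAddCommGroup H] [InnerProductSpace ℝ H] (f : ℝ → ℝ) (j : H →L[ℝ] V Ω)
    (T : ℝ) (G : W Ω (Ioo 0 T) → Lp (StrongDual ℝ H) 1 (volume.restrict (Ioo 0 T))) : Prop :=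
  ∀ y : W Ω (Ioo 0 T), ∀ᵐ t ∂volume.restrict (Ioo 0 T),
    ∃ g : VDual Ω, Represents f (incl Ω (W.state y t)) g ∧ G y t = g.comp j

/-- Weak convergence of a sequence. -/
def WeakLim {X : Type*} [NormedAddCommGroup X] [NormedSpace ℝ X] (x : ℕ → X) (x₀ : X) : Prop :=
  ∀ ℓ : StrongDual ℝ X, Tendsto (fun n => ℓ (x n)) atTop (𝓝 (ℓ x₀))

/-- Weak-to-weak (sequential) continuity. -/
def WeakToWeakContinuous {X Z : Type*} [NormedAddCommGroup X] [NormedSpace ℝ X]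
    [NormedAddCommGroup Z] [NormedSpace ℝ Z] (G : X → Z) : Prop :=
  ∀ (x : ℕ → X) (x₀ : X), WeakLim x x₀ → WeakLim (fun n => G (x n)) (G x₀)

/-- `F` is twice continuously Fréchet differentiable, and `F''` is bounded on bounded sets. -/
def IsC2BoundedHess {X Z : Type*} [NormedAddCommGroup X] [NormedSpace ℝ X]
    [NormedAddCommGroup Z] [NormedSpace ℝ Z] (F : X → Z) : Prop :=
  ContDiff ℝ 2 F ∧ ∀ R : ℝ, ∃ C : ℝ, ∀ y, ‖y‖ ≤ R → ‖fderiv ℝ (fderiv ℝ F) y‖ ≤ C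

/-! ### The optimal control problem -/

/-- `U_ad = {u ∈ U : ‖u(t)‖ ≤ η for a.e. t > 0}`. -/
def Uad (𝒰 : Type*) [NormedAddCommGroup 𝒰] (η : ℝ) : Set (Ctrl 𝒰) :=
  {u | ∀ᵐ t ∂volume.restrict (Ioi (0 : ℝ)), ‖u t‖ ≤ η}

/-- `J(y,u) = ½ ∫₀^∞ ‖y(t)‖²_Y dt + (α/2) ∫₀^∞ ‖u(t)‖²_𝒰 dt`. -/
def cost {d : ℕ} {Ω : Set (EuclideanSpace ℝ (Fin d))} {𝒰 : Type*} [NormedAddCommGroup 𝒰]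
    (α : ℝ) (y : WInf Ω) (u : Ctrl 𝒰) : ℝ :=
  1 / 2 * (∫ t in Ioi (0 : ℝ), ‖incl Ω (W.state y t)‖ ^ 2) +
    α / 2 * ∫ t in Ioi (0 : ℝ), ‖u t‖ ^ 2

/-- `(y,u) ∈ W_∞ × U_ad`, `y_t = 𝒜 y + F(y) + B u` in `L²(I; V*)`, and `y(0) = y₀` in `Y`. -/
structure IsFeasible {d : ℕ} {Ω : Set (EuclideanSpace ℝ (Fin d))}
    {𝒰 : Type*} [NormedAddCommGroup 𝒰] [NormedSpace ℝ 𝒰] (η : ℝ)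
    (𝒜 : V Ω →L[ℝ] VDual Ω) (F : WInf Ω → L2VDual Ω) (B : 𝒰 →L[ℝ] Y Ω)
    (y₀ : Y Ω) (y : WInf Ω) (u : Ctrl 𝒰) : Prop where
  admissible : u ∈ Uad 𝒰 η
  equation : ∀ᵐ t ∂volume.restrict (Ioi (0 : ℝ)),
    W.timeDeriv y t = 𝒜 (W.state y t) + F y t + pivot Ω (B (u t))
  initial : HasInitialValue y y₀

/-- `(y,u)` is a (global) solution of the optimal control problem with initial datum `y₀`. -/
def IsOptimal {d : ℕ} {Ω : Set (EuclideanSpace ℝ (Fin d))}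
    {𝒰 : Type*} [NormedAddCommGroup 𝒰] [NormedSpace ℝ 𝒰] (α η : ℝ)
    (𝒜 : V Ω →L[ℝ] VDual Ω) (F : WInf Ω → L2VDual Ω) (B : 𝒰 →L[ℝ] Y Ω)
    (y₀ : Y Ω) (y : WInf Ω) (u : Ctrl 𝒰) : Prop :=
  IsFeasible η 𝒜 F B y₀ y u ∧
    ∀ (z : WInf Ω) (w : Ctrl 𝒰), IsFeasible η 𝒜 F B y₀ z w → cost α y u ≤ cost α z w

end ParabolicControl

end

noncomputable section

namespace ParabolicControl

open scoped ENNReal Convolution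

section

/-! ### Jensen and Young inequalities, mollification in `L²` -/


/-! The proof is the direct method of the calculus of variations. Smallness of the initial value
serves twice: it makes the feasible set nonempty, and it turns a bound on the cost into a bound in
`W_∞`.

Feasibility. Under the feedback `u = -K y` the linearized problem is `y_t = (𝒜 - BK) y + g`, `y(0) =
x`, solvable in `W_∞` for all `g ∈ L²(I; V*)` and `x ∈ Y` (`exists_evolution_eq_of_stabilizable`).
The semigroup generated by `A - BK` acts on `Y` only, so the solution is a sum. One summand solves
the problem for the coercive operator `ρ - 𝒜` with data `g, x` (energy estimate and duality). The
other corrects a source that now lies in `L²(I; Y)`, and there mild solutions apply. Since `F(0) =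
0` and `F'(0) = 0`, a quantitative open mapping argument (`exists_small_solution`) yields a solution
of the nonlinear closed-loop problem with `‖y‖ ≤ C ‖y₀‖`. As `W_∞` embeds into bounded continuous
`Y`-valued functions, the pointwise control constraint holds for small `y₀`, and the cost is
`O(‖y₀‖²)`.

A priori bound (`exists_apriori_bound`). The cost controls only the `L²(I; Y)` norm of the state and
the `L²` norm of the control. The rest comes from Gårding's inequality, provided `F(y)` is small
compared with `y`; this is known only for `y` small in `W_∞`. Therefore `y` is cut at a time `T` and
continued by a lifting of `y(T)` to an element `e` of `W_∞`. As a substitution operator `F` is local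
in time, so `F(e) = F(y)` on `(0, T)`. As long as `e` is small, the energy estimate bounds it by a
strictly smaller quantity, and continuity in `T` propagates this to all times.

Existence and estimate. A minimizing sequence is thus bounded in `W_∞ × U` and has a weak limit.
(A4) identifies the weak limit of `F(y_n)`, the other constraints are weakly closed, and the cost is
weakly lower semicontinuous (`exists_optimal`). An optimal pair costs no more than the feedback
pair, and the a priori bound turns this into the stated inequality. -/

theorem eLpNorm_two_sq {α E : Type*} {m : MeasurableSpace α} [NormedAddCommGroup E] (μ : Measure α)
    (f : α → E) : eLpNorm f 2 μ ^ 2 = ∫⁻ x, ‖f x‖ₑ ^ 2 ∂μ := by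
  rw [eLpNorm_eq_lintegral_rpow_enorm_toReal (by simp) (by simp)]
  simp only [ENNReal.toReal_ofNat, ENNReal.rpow_ofNat]
  rw [← ENNReal.rpow_natCast, ← ENNReal.rpow_mul]
  simp

/-- Cauchy–Schwarz for the splitting `k F = √k · (√k F)`. -/
theorem lintegral_mul_sq_le {α : Type*} {m : MeasurableSpace α} (μ : Measure α) {k F : α → ℝ≥0∞}
    (hk : AEMeasurable k μ) (hF : AEMeasurable F μ) :
    (∫⁻ x, k x * F x ∂μ) ^ 2 ≤ (∫⁻ x, k x ∂μ) * ∫⁻ x, k x * F x ^ 2 ∂μ := by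
  have h2 : (2 : ℝ).HolderConjugate 2 := ⟨by norm_num, by norm_num, by norm_num⟩
  have h := ENNReal.lintegral_mul_le_Lp_mul_Lq μ h2 (f := fun x => k x ^ (1 / 2 : ℝ))
    (g := fun x => k x ^ (1 / 2 : ℝ) * F x) (hk.pow_const _) ((hk.pow_const _).mul hF)
  have e : ∀ a : ℝ≥0∞, a ^ (1 / 2 : ℝ) * a ^ (1 / 2 : ℝ) = a := fun a => by
    rw [← ENNReal.rpow_add_of_nonneg _ _ (by norm_num) (by norm_num)]; norm_num
  have e' : ∀ a : ℝ≥0∞, (a ^ (1 / 2 : ℝ)) ^ 2 = a := fun a => by rw [sq, e]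
  simp only [Pi.mul_apply, ENNReal.rpow_ofNat, mul_pow, e', ← mul_assoc, e] at h
  calc _ ≤ _ := pow_le_pow_left' h 2
    _ = _ := by rw [mul_pow, e', e']

/-- Young's inequality `‖k * f‖₂ ≤ ‖k‖₁ ‖f‖₂` in a flexible form: weighted Cauchy–Schwarz inside,
then Tonelli. It serves both mollification and mild solutions. The bound on `f` is required only
where `k s ≠ 0`, so that for a mollifier only small translations count. -/
theorem lintegral_sq_integral_le {E F : Type*} [NormedAddCommGroup E] [NormedAddCommGroup F]
    [NormedSpace ℝ F]
    {μ ν : Measure ℝ} [SFinite μ] [SFinite ν] {k : ℝ → ℝ}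
    (hk : AEMeasurable k μ) (f : ℝ → ℝ → E)
    (hf : AEStronglyMeasurable (Function.uncurry f) (ν.prod μ))
    (w : ℝ → F) (hw : ∀ᵐ t ∂ν, ‖w t‖ₑ ≤ ∫⁻ s, ENNReal.ofReal (k s) * ‖f t s‖ₑ ∂μ) {δ : ℝ≥0∞}
    (hδ : ∀ᵐ s ∂μ, k s ≠ 0 → ∫⁻ t, ‖f t s‖ₑ ^ 2 ∂ν ≤ δ) :
    ∫⁻ t, ‖w t‖ₑ ^ 2 ∂ν ≤ (∫⁻ s, ENNReal.ofReal (k s) ∂μ) ^ 2 * δ := by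
  set c := ∫⁻ s, ENNReal.ofReal (k s) ∂μ
  have hF : AEMeasurable (fun p : ℝ × ℝ => ENNReal.ofReal (k p.2) * ‖f p.1 p.2‖ₑ ^ 2)
      (ν.prod μ) := (hk.comp_snd (μ := ν)).ennreal_ofReal.mul (hf.enorm.pow_const 2)
  calc ∫⁻ t, ‖w t‖ₑ ^ 2 ∂ν
      ≤ ∫⁻ t, c * ∫⁻ s, ENNReal.ofReal (k s) * ‖f t s‖ₑ ^ 2 ∂μ ∂ν := by
        refine lintegral_mono_ae ?_
        filter_upwards [hw, hf.prodMk_left] with t ht ht'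
        exact (pow_le_pow_left' ht 2).trans (lintegral_mul_sq_le μ hk.ennreal_ofReal ht'.enorm)
    _ = c * ∫⁻ t, ∫⁻ s, ENNReal.ofReal (k s) * ‖f t s‖ₑ ^ 2 ∂μ ∂ν :=
        lintegral_const_mul'' _ hF.lintegral_prod_right'
    _ = c * ∫⁻ s, ∫⁻ t, ENNReal.ofReal (k s) * ‖f t s‖ₑ ^ 2 ∂ν ∂μ := by
        rw [lintegral_lintegral_swap hF]
    _ ≤ c * ∫⁻ s, ENNReal.ofReal (k s) * δ ∂μ := by
        gcongr 1
        refine lintegral_mono_ae ?_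
        filter_upwards [hδ] with s hs
        rw [lintegral_const_mul' _ _ ENNReal.ofReal_ne_top]
        by_cases h0 : k s = 0
        · simp [h0]
        · gcongr; exact hs h0
    _ = c ^ 2 * δ := by
        rw [lintegral_mul_const'' _ hk.ennreal_ofReal, sq, mul_assoc]

theorem tendsto_eLpNorm_translate {E : Type*} [NormedAddCommGroup E] {f : ℝ → E}
    (hf : MemLp f 2 volume) :
    Tendsto (fun s : ℝ => eLpNorm (fun t => f (t - s) - f t) 2 volume) (𝓝 0) (𝓝 0) := by
  have hm : ∀ s : ℝ, MeasurePreserving (fun t : ℝ => t - s) volume volume :=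
    fun s => measurePreserving_sub_right volume s
  let G : C(ℝ × ℝ, ℝ) := ⟨fun p => p.2 - p.1, by fun_prop⟩
  have h := (tendsto_const_nhds (x := hf.toLp f) (f := 𝓝 (0 : ℝ))).compMeasurePreservingLp
    (g := fun s => G.curry s) (g₀ := G.curry 0) (G.curry.continuous.tendsto 0) (fun s => hm s)
    (hm 0) (by simp)
  rw [Lp.tendsto_Lp_iff_tendsto_eLpNorm'] at h
  refine h.congr fun s => eLpNorm_congr_ae ?_
  have e : ∀ s, Lp.compMeasurePreserving (G.curry s) (hm s) (hf.toLp f) =ᵐ[volume]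
      fun t => f (t - s) := fun s =>
    (Lp.coeFn_compMeasurePreserving _ _).trans
      ((hm s).quasiMeasurePreserving.ae_eq_comp hf.coeFn_toLp)
  filter_upwards [e s, e 0] with t h1 h2
  rw [Pi.sub_apply, h1, h2, sub_zero]

/-- A smooth probability density supported in `(-2/(n+1), 0)`. -/
def mollifierBump (n : ℕ) : ContDiffBump (-(1 / ((n : ℝ) + 1))) where
  rIn := 1 / (4 * ((n : ℝ) + 1))
  rOut := 1 / (2 * ((n : ℝ) + 1))
  rIn_pos := by positivity
  rIn_lt_rOut := by
    apply one_div_lt_one_div_of_lt <;> nlinarith [n.cast_nonneg (α := ℝ)]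

/-- The density of `mollifierBump`. -/
def mollifier (n : ℕ) : ℝ → ℝ := (mollifierBump n).normed volume

theorem mollifier_nonneg (n : ℕ) (s : ℝ) : 0 ≤ mollifier n s := (mollifierBump n).nonneg_normed s

theorem mollifier_contDiff (n : ℕ) : ContDiff ℝ ∞ (mollifier n) := (mollifierBump n).contDiff_normed

theorem mollifier_hasCompactSupport (n : ℕ) : HasCompactSupport (mollifier n) :=
  (mollifierBump n).hasCompactSupport_normed

theorem integral_mollifier (n : ℕ) : ∫ s, mollifier n s = 1 := (mollifierBump n).integral_normed

theorem integrable_mollifier (n : ℕ) : Integrable (mollifier n) :=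
  (mollifier_contDiff n).continuous.integrable_of_hasCompactSupport (mollifier_hasCompactSupport n)

theorem lintegral_mollifier (n : ℕ) : ∫⁻ s, ENNReal.ofReal (mollifier n s) = 1 := by
  rw [← ofReal_integral_eq_lintegral_ofReal (integrable_mollifier n)
    (ae_of_all _ (mollifier_nonneg n)), integral_mollifier, ENNReal.ofReal_one]

/-- With support strictly to the left of `0`, the mollification at time `t` averages values at times
later than `t`. At `t ≥ 0` it never sees times before `0`, so no extension across `0` has to
preserve the weak derivative. -/
theorem tsupport_mollifier_subset (n : ℕ) :
    tsupport (mollifier n) ⊆ Ioo (-(2 / ((n : ℝ) + 1))) 0 := by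
  rw [mollifier, ContDiffBump.tsupport_normed_eq, Real.closedBall_eq_Icc]
  have h : (0 : ℝ) < 1 / ((n : ℝ) + 1) := by positivity
  have e : (mollifierBump n).rOut = (1 / ((n : ℝ) + 1)) / 2 := by
    change 1 / (2 * ((n : ℝ) + 1)) = _
    field_simp
  have e2 : 2 / ((n : ℝ) + 1) = 2 * (1 / ((n : ℝ) + 1)) := by ring
  rw [e, e2]
  exact Icc_subset_Ioo (by linarith) (by linarith)

/-- The mollification of `f`, looking forward in time. -/
def mollify {E : Type*} [NormedAddCommGroup E] [NormedSpace ℝ E] (n : ℕ) (f : ℝ → E) : ℝ → E :=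
  mollifier n ⋆[ContinuousLinearMap.lsmul ℝ ℝ] f

theorem mollify_apply {E : Type*} [NormedAddCommGroup E] [NormedSpace ℝ E] (n : ℕ) (f : ℝ → E)
    (t : ℝ) : mollify n f t = ∫ s, mollifier n s • f (t - s) := rfl

theorem mollify_apply' {E : Type*} [NormedAddCommGroup E] [NormedSpace ℝ E] (n : ℕ) (f : ℝ → E)
    (t : ℝ) : mollify n f t = ∫ s, mollifier n (t - s) • f s := by
  rw [mollify_apply, ← integral_sub_left_eq_self _ volume t]
  simp

theorem integrable_mollifier_smul {E : Type*} [NormedAddCommGroup E] [NormedSpace ℝ E] (n : ℕ)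
    {f : ℝ → E} (hf : LocallyIntegrable f) (t : ℝ) :
    Integrable fun s => mollifier n s • f (t - s) :=
  (mollifier_hasCompactSupport n).convolutionExists_left (ContinuousLinearMap.lsmul ℝ ℝ)
    (mollifier_contDiff n).continuous hf t

theorem mollify_contDiff {E : Type*} [NormedAddCommGroup E] [NormedSpace ℝ E] (n : ℕ)
    {f : ℝ → E} (hf : LocallyIntegrable f) : ContDiff ℝ ∞ (mollify n f) :=
  (mollifier_hasCompactSupport n).contDiff_convolution_left (n := ⊤) _ (mollifier_contDiff n) hf

/-- Since the mollifier has mass one, `mollify n f - f` is an average of the differences `f(· - s) -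
f` over a shrinking range of `s`; Young's inequality and continuity of translations in `L²` finish.
-/
theorem tendsto_eLpNorm_mollify_sub {E : Type*} [NormedAddCommGroup E] [NormedSpace ℝ E]
    [CompleteSpace E] {f : ℝ → E} (hf : MemLp f 2 volume) :
    Tendsto (fun n => eLpNorm (mollify n f - f) 2 volume) atTop (𝓝 0) := by
  have hloc : LocallyIntegrable f := hf.locallyIntegrable (by norm_num)
  rw [ENNReal.tendsto_nhds_zero]
  intro ε hε
  have h1 := (ENNReal.tendsto_nhds_zero.1 (tendsto_eLpNorm_translate hf)) ε hε
  obtain ⟨r, hr, hball⟩ := Metric.eventually_nhds_iff.1 h1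
  obtain ⟨N, hN⟩ := exists_nat_gt (2 / r)
  filter_upwards [eventually_ge_atTop N] with n hn
  have hn' : 2 / ((n : ℝ) + 1) < r := by
    rw [div_lt_iff₀ (by positivity)]
    rw [div_lt_iff₀ hr] at hN
    have : (N : ℝ) ≤ n := by exact_mod_cast hn
    nlinarith
  have key : ∫⁻ t, ‖(mollify n f - f) t‖ₑ ^ 2 ≤
      (∫⁻ s, ENNReal.ofReal (mollifier n s)) ^ 2 * ε ^ 2 := by
    refine lintegral_sq_integral_le
      (integrable_mollifier n).aestronglyMeasurable.aemeasurable
      (fun t s => f (t - s) - f t) ?_ _ (ae_of_all _ fun t => ?_) (ae_of_all _ fun s hs => ?_)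
    · exact (hf.1.comp_quasiMeasurePreserving (quasiMeasurePreserving_sub _ _)).sub hf.1.comp_fst
    · have e : (mollify n f - f) t = ∫ s, mollifier n s • (f (t - s) - f t) := by
        simp only [smul_sub]
        rw [integral_sub (integrable_mollifier_smul n hloc t)
          ((integrable_mollifier n).smul_const _), integral_smul_const, integral_mollifier,
          one_smul]; rfl
      rw [e]
      refine (enorm_integral_le_lintegral_enorm _).trans_eq (lintegral_congr fun s => ?_)
      rw [enorm_smul, Real.enorm_of_nonneg (mollifier_nonneg n s)]
    · rw [← eLpNorm_two_sq]
      have hs' := tsupport_mollifier_subset n (subset_tsupport _ hs)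
      have : dist s 0 < r := by
        rw [Real.dist_eq, sub_zero, abs_of_neg hs'.2]
        linarith [hs'.1]
      exact pow_le_pow_left' (hball this) 2
  rw [lintegral_mollifier, one_pow, one_mul, ← eLpNorm_two_sq] at key
  exact (ENNReal.pow_le_pow_left_iff (two_ne_zero)).1 key

end

section

/-! ### `L²` norms and pairings -/

theorem norm_sq_eq_integral {α E : Type*} {m : MeasurableSpace α} [NormedAddCommGroup E]
    {μ : Measure α} (f : Lp E 2 μ) : ‖f‖ ^ 2 = ∫ x, ‖f x‖ ^ 2 ∂μ := by
  rw [integral_eq_lintegral_of_nonneg_ae (ae_of_all _ fun x => sq_nonneg _)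
    ((Lp.aestronglyMeasurable f).norm.pow 2), Lp.norm_def, ← ENNReal.toReal_pow, eLpNorm_two_sq]
  congr 1
  refine lintegral_congr fun x => ?_
  rw [ENNReal.ofReal_pow (norm_nonneg _), ofReal_norm]

theorem norm_toLp_sq {α E : Type*} {m : MeasurableSpace α} [NormedAddCommGroup E]
    {μ : Measure α} {f : α → E} (hf : MemLp f 2 μ) : ‖hf.toLp f‖ ^ 2 = ∫ x, ‖f x‖ ^ 2 ∂μ := by
  rw [norm_sq_eq_integral]
  refine integral_congr_ae ?_
  filter_upwards [hf.coeFn_toLp] with x hx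
  rw [hx]

theorem integrable_norm_sq {α E : Type*} {m : MeasurableSpace α} [NormedAddCommGroup E]
    {μ : Measure α} {f : α → E} (hf : MemLp f 2 μ) : Integrable (fun x => ‖f x‖ ^ 2) μ :=
  hf.norm.integrable_sq

theorem integrable_bilin {α E F G : Type*} {m : MeasurableSpace α}
    [NormedAddCommGroup E] [NormedSpace ℝ E] [NormedAddCommGroup F] [NormedSpace ℝ F]
    [NormedAddCommGroup G] [NormedSpace ℝ G] {μ : Measure α} (B : E →L[ℝ] F →L[ℝ] G)
    {f : α → E} {g : α → F} (hf : MemLp f 2 μ) (hg : MemLp g 2 μ) :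
    Integrable (fun x => B (f x) (g x)) μ :=
  memLp_one_iff_integrable.1 (B.memLp_of_bilin 1 hf hg)

theorem tendsto_integral_bilin {α E F G : Type*} {m : MeasurableSpace α}
    [NormedAddCommGroup E] [NormedSpace ℝ E] [NormedAddCommGroup F] [NormedSpace ℝ F]
    [NormedAddCommGroup G] [NormedSpace ℝ G] [CompleteSpace G]
    {μ : Measure α} (B : E →L[ℝ] F →L[ℝ] G)
    {f : α → E} {g : α → F} (hf : MemLp f 2 μ) (hg : MemLp g 2 μ)
    {fn : ℕ → α → E} {gn : ℕ → α → F} (hfn : ∀ n, MemLp (fn n) 2 μ) (hgn : ∀ n, MemLp (gn n) 2 μ)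
    (hf' : Tendsto (fun n => eLpNorm (fn n - f) 2 μ) atTop (𝓝 0))
    (hg' : Tendsto (fun n => eLpNorm (gn n - g) 2 μ) atTop (𝓝 0)) :
    Tendsto (fun n => ∫ x, B (fn n x) (gn n x) ∂μ) atTop (𝓝 (∫ x, B (f x) (g x) ∂μ)) := by
  have e : ∀ {a : α → E} {b : α → F} (ha : MemLp a 2 μ) (hb : MemLp b 2 μ),
      B.lpPairing μ 2 2 (ha.toLp a) (hb.toLp b) = ∫ x, B (a x) (b x) ∂μ := by
    intro a b ha hb
    rw [B.lpPairing_eq_integral]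
    refine integral_congr_ae ?_
    filter_upwards [ha.coeFn_toLp, hb.coeFn_toLp] with x h1 h2
    rw [h1, h2]
  have h1 : Tendsto (fun n => (hfn n).toLp (fn n)) atTop (𝓝 (hf.toLp f)) :=
    (Lp.tendsto_Lp_iff_tendsto_eLpNorm'' fn hfn f hf).2 hf'
  have h2 : Tendsto (fun n => (hgn n).toLp (gn n)) atTop (𝓝 (hg.toLp g)) :=
    (Lp.tendsto_Lp_iff_tendsto_eLpNorm'' gn hgn g hg).2 hg'
  have h3 := ((B.lpPairing μ 2 2).continuous₂.tendsto (hf.toLp f, hg.toLp g)).comp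
    (h1.prodMk_nhds h2)
  simp only [Function.comp_def, Function.uncurry, e] at h3
  exact h3

theorem tendsto_eLpNorm_clm {α E F : Type*} {m : MeasurableSpace α}
    [NormedAddCommGroup E] [NormedSpace ℝ E] [NormedAddCommGroup F] [NormedSpace ℝ F]
    {μ : Measure α} (B : E →L[ℝ] F) {f : α → E} {fn : ℕ → α → E}
    (hf' : Tendsto (fun n => eLpNorm (fn n - f) 2 μ) atTop (𝓝 0)) :
    Tendsto (fun n => eLpNorm ((fun x => B (fn n x)) - fun x => B (f x)) 2 μ) atTop (𝓝 0) := by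
  have h : ∀ n, eLpNorm ((fun x => B (fn n x)) - fun x => B (f x)) 2 μ ≤
      ENNReal.ofReal ‖B‖ * eLpNorm (fn n - f) 2 μ := fun n => by
    refine eLpNorm_le_mul_eLpNorm_of_ae_le_mul (ae_of_all _ fun x => ?_) 2
    simp only [Pi.sub_apply, ← map_sub]
    exact B.le_opNorm _
  refine tendsto_of_tendsto_of_tendsto_of_le_of_le tendsto_const_nhds ?_ (fun _ => zero_le) h
  simpa using ENNReal.Tendsto.const_mul (a := ENNReal.ofReal ‖B‖) hf'
    (Or.inr ENNReal.ofReal_ne_top)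

/-! ### Continuity in time: the Lions–Magenes lemma -/

/-- The reflected and translated mollifier lives at times `s > t ≥ 0`, so it may be inserted in the
definition of the weak derivative. This makes mollification commute with `d/dt` on all of `[0, ∞)`,
endpoint included. -/
theorem isTest_mollifier (n : ℕ) {t : ℝ} (ht : 0 ≤ t) :
    IsTest (Ioi 0) fun s => mollifier n (t - s) := by
  have hc : Continuous fun s : ℝ => t - s := by fun_prop
  have hsub : tsupport (fun s => mollifier n (t - s)) ⊆ (fun s => t - s) ⁻¹' tsupport (mollifier n) :=
    closure_minimal (fun s hs => subset_tsupport _ hs) ((isClosed_tsupport _).preimage hc)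
  refine ⟨(mollifier_contDiff n).comp (by fun_prop), ?_, fun s hs => ?_⟩
  · exact (mollifier_hasCompactSupport n).comp_homeomorph (Homeomorph.subLeft t)
  · have := (tsupport_mollifier_subset n (hsub hs)).2
    simp only [mem_Ioi]; linarith

theorem tendsto_mollify_indicator {E : Type*} [NormedAddCommGroup E] [NormedSpace ℝ E]
    [CompleteSpace E] {f : ℝ → E} (hf : MemLp f 2 (volume.restrict (Ioi (0 : ℝ)))) :
    (LocallyIntegrable ((Ioi 0).indicator f)) ∧
      Tendsto (fun n => eLpNorm (mollify n ((Ioi 0).indicator f) - f) 2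
        (volume.restrict (Ioi (0 : ℝ)))) atTop (𝓝 0) := by
  have hf' := (memLp_indicator_iff_restrict measurableSet_Ioi).2 hf
  refine ⟨hf'.locallyIntegrable (by norm_num), ?_⟩
  refine tendsto_of_tendsto_of_tendsto_of_le_of_le tendsto_const_nhds
    (tendsto_eLpNorm_mollify_sub hf') (fun _ => zero_le) fun n => ?_
  refine le_trans (eLpNorm_congr_ae ?_).le (eLpNorm_mono_measure _ Measure.restrict_le_self)
  filter_upwards [ae_restrict_mem measurableSet_Ioi] with t ht
  simp [indicator_of_mem ht]

theorem memLp_of_eLpNorm_sub_lt_top {E : Type*} [NormedAddCommGroup E] {μ : Measure ℝ}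
    {f h : ℝ → E} (hf : MemLp f 2 μ) (hh : AEStronglyMeasurable h μ)
    (hlt : eLpNorm (h - f) 2 μ < ⊤) : MemLp h 2 μ := by
  have : MemLp (h - f) 2 μ := ⟨hh.sub hf.1, hlt⟩
  simpa using this.add hf

theorem exists_smooth_approx {X Z : Type*} [NormedAddCommGroup X] [NormedSpace ℝ X]
    [CompleteSpace X] [NormedAddCommGroup Z] [NormedSpace ℝ Z] [CompleteSpace Z]
    (e : X →L[ℝ] Z) {y : ℝ → X} {g : ℝ → Z}
    (hy : MemLp y 2 (volume.restrict (Ioi (0 : ℝ)))) (hg : MemLp g 2 (volume.restrict (Ioi (0 : ℝ))))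
    (hw : ∀ φ : ℝ → ℝ, IsTest (Ioi 0) φ →
      ∫ t in Ioi 0, deriv φ t • e (y t) = -∫ t in Ioi 0, φ t • g t) :
    ∃ (yn : ℕ → ℝ → X) (gn : ℕ → ℝ → Z), (∀ n, ContDiff ℝ 1 (yn n)) ∧ (∀ n, Continuous (gn n)) ∧
      (∀ n t, 0 ≤ t → e (deriv (yn n) t) = gn n t) ∧
      (∀ n, MemLp (yn n) 2 (volume.restrict (Ioi (0 : ℝ)))) ∧
      (∀ n, MemLp (gn n) 2 (volume.restrict (Ioi (0 : ℝ)))) ∧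
      Tendsto (fun n => eLpNorm (yn n - y) 2 (volume.restrict (Ioi (0 : ℝ)))) atTop (𝓝 0) ∧
      Tendsto (fun n => eLpNorm (gn n - g) 2 (volume.restrict (Ioi (0 : ℝ)))) atTop (𝓝 0) := by
  obtain ⟨hyl, hyt⟩ := tendsto_mollify_indicator hy
  obtain ⟨hgl, hgt⟩ := tendsto_mollify_indicator hg
  -- Membership of the mollifications in `L²(0,∞)` is inferred from a finite distance to the limit.
  -- That is available only for large `n`, hence the shift of the sequences by `N`.
  obtain ⟨N1, hN1⟩ := eventually_atTop.1 (hyt.eventually_lt_const ENNReal.zero_lt_top)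
  obtain ⟨N2, hN2⟩ := eventually_atTop.1 (hgt.eventually_lt_const ENNReal.zero_lt_top)
  set N := max N1 N2
  have hcy : ∀ n, ContDiff ℝ 1 (mollify n ((Ioi 0).indicator y)) := fun n =>
    (mollify_contDiff n hyl).of_le (by norm_cast)
  have hcg : ∀ n, Continuous (mollify n ((Ioi 0).indicator g)) := fun n =>
    (mollify_contDiff n hgl).continuous
  refine ⟨fun n => mollify (n + N) ((Ioi 0).indicator y),
    fun n => mollify (n + N) ((Ioi 0).indicator g), fun n => hcy _, fun n => hcg _, fun n t ht => ?_,
    fun n => memLp_of_eLpNorm_sub_lt_top hy (hcy _).continuous.aestronglyMeasurable (hN1 (n + N) (by omega)),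
    fun n => memLp_of_eLpNorm_sub_lt_top hg (hcg _).aestronglyMeasurable (hN2 (n + N) (by omega)),
    hyt.comp (tendsto_add_atTop_nat N), hgt.comp (tendsto_add_atTop_nat N)⟩
  set k := n + N
  have hd : deriv (mollify k ((Ioi 0).indicator y)) t =
      (deriv (mollifier k) ⋆[ContinuousLinearMap.lsmul ℝ ℝ] ((Ioi 0).indicator y)) t :=
    ((mollifier_hasCompactSupport k).hasDerivAt_convolution_left _
      ((mollifier_contDiff k).of_le (by norm_cast)) hyl t).deriv
  have hφ := isTest_mollifier k ht
  have hint : Integrable fun s => deriv (mollifier k) s • (Ioi 0).indicator y (t - s) :=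
    (mollifier_hasCompactSupport k).deriv.convolutionExists_left (ContinuousLinearMap.lsmul ℝ ℝ)
      ((mollifier_contDiff k).continuous_deriv (by simp)) hyl t
  have hdφ : ∀ s, deriv (fun s => mollifier k (t - s)) s = -deriv (mollifier k) (t - s) := fun s => by
    rw [deriv_comp_const_sub]
  rw [hd, convolution_def]
  simp only [ContinuousLinearMap.lsmul_apply]
  rw [← ContinuousLinearMap.integral_comp_comm e hint, mollify_apply',
    ← integral_sub_left_eq_self _ volume t]
  have h := hw _ hφ
  simp only [hdφ, neg_smul, integral_neg, neg_inj] at h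
  rw [← integral_indicator measurableSet_Ioi, ← integral_indicator measurableSet_Ioi] at h
  refine (integral_congr_ae (ae_of_all _ fun s => ?_)).trans
    (h.trans (integral_congr_ae (ae_of_all _ fun s => ?_)))
  · by_cases hs : s ∈ Ioi (0 : ℝ)
    · simp [indicator_of_mem hs]
    · simp [indicator_of_notMem hs]
  · by_cases hs : s ∈ Ioi (0 : ℝ)
    · simp [k, indicator_of_mem hs]
    · simp [indicator_of_notMem hs]

end

/-! ### Energy identity, uniform bounds and the continuous representative -/

section

theorem abs_two_mul_intervalIntegral_le {V : Type*} [NormedAddCommGroup V] [NormedSpace ℝ V]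
    {y : ℝ → V} {g : ℝ → StrongDual ℝ V} (hy : MemLp y 2 (volume.restrict (Ioi (0 : ℝ))))
    (hg : MemLp g 2 (volume.restrict (Ioi (0 : ℝ)))) {a b : ℝ} (ha : 0 ≤ a) (hab : a ≤ b) :
    |2 * ∫ t in a..b, g t (y t)| ≤
      (∫ t in Ioi 0, ‖y t‖ ^ 2) + ∫ t in Ioi 0, ‖g t‖ ^ 2 := by
  have hsub : Ioc a b ⊆ Ioi 0 := fun t ht => lt_of_le_of_lt ha ht.1
  have hint : Integrable (fun t => ‖y t‖ ^ 2 + ‖g t‖ ^ 2) (volume.restrict (Ioi (0 : ℝ))) :=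
    (integrable_norm_sq hy).add (integrable_norm_sq hg)
  rw [intervalIntegral.integral_of_le hab, ← integral_const_mul, ← Real.norm_eq_abs,
    ← integral_add (integrable_norm_sq hy) (integrable_norm_sq hg)]
  calc ‖∫ t in Ioc a b, 2 * g t (y t)‖
      ≤ ∫ t in Ioc a b, (‖y t‖ ^ 2 + ‖g t‖ ^ 2) := by
        refine norm_integral_le_of_norm_le (hint.mono_measure (Measure.restrict_mono hsub le_rfl))
          (ae_of_all _ fun t => ?_)
        have h1 := (g t).le_opNorm (y t)
        rw [norm_mul, Real.norm_ofNat]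
        nlinarith [sq_nonneg (‖y t‖ - ‖g t‖)]
    _ ≤ _ := setIntegral_mono_set hint (ae_of_all _ fun t => by positivity) hsub.eventuallyLE

section LionsMagenes

variable {V Y : Type*} [NormedAddCommGroup V] [InnerProductSpace ℝ V] [NormedAddCommGroup Y]
  [InnerProductSpace ℝ Y] {i : V →L[ℝ] Y} {p : Y →L[ℝ] StrongDual ℝ V}

theorem energy_identity_of_contDiff (hp : ∀ x v, p x v = inner ℝ x (i v)) {z : ℝ → V}
    {G : ℝ → StrongDual ℝ V} (hz : ContDiff ℝ 1 z) (hG : Continuous G)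
    (hzG : ∀ t, 0 ≤ t → p (i (deriv z t)) = G t) {a b : ℝ} (ha : 0 ≤ a) (hab : a ≤ b) :
    ‖i (z b)‖ ^ 2 - ‖i (z a)‖ ^ 2 = 2 * ∫ t in a..b, G t (z t) := by
  rw [← intervalIntegral.integral_const_mul]
  symm
  refine intervalIntegral.integral_eq_sub_of_hasDerivAt (f := fun t => ‖i (z t)‖ ^ 2)
    (fun t ht => ?_) ?_
  · rw [uIcc_of_le hab] at ht
    have h1 : HasDerivAt (fun t => i (z t)) (i (deriv z t)) t :=
      i.hasFDerivAt.comp_hasDerivAt t ((hz.differentiable one_ne_zero) t).hasDerivAt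
    rw [← hzG t (ha.trans ht.1), hp, real_inner_comm]
    exact h1.norm_sq
  · exact (continuous_const.mul (hG.clm_apply hz.continuous)).intervalIntegrable _ _

/-- The energy identity compares `‖z(t)‖²` with `‖z(s)‖²`; averaging over `s ∈ [t, t+1]` replaces
the latter by an `L²` norm. The bound is uniform in `t`, so it transfers Cauchy sequences in `W` to
uniformly Cauchy sequences in `Y`. -/
theorem norm_sq_le_of_contDiff (hp : ∀ x v, p x v = inner ℝ x (i v)) {z : ℝ → V}
    {G : ℝ → StrongDual ℝ V} (hz : ContDiff ℝ 1 z) (hG : Continuous G)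
    (hzG : ∀ t, 0 ≤ t → p (i (deriv z t)) = G t)
    (hz2 : MemLp z 2 (volume.restrict (Ioi (0 : ℝ))))
    (hG2 : MemLp G 2 (volume.restrict (Ioi (0 : ℝ)))) {t : ℝ} (ht : 0 ≤ t) :
    ‖i (z t)‖ ^ 2 ≤ (‖i‖ ^ 2 + 1) * (∫ t in Ioi 0, ‖z t‖ ^ 2) + ∫ t in Ioi 0, ‖G t‖ ^ 2 := by
  set I1 := ∫ t in Ioi 0, ‖z t‖ ^ 2
  set I2 := ∫ t in Ioi 0, ‖G t‖ ^ 2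
  have key : ∀ s ∈ Icc t (t + 1), ‖i (z t)‖ ^ 2 ≤ ‖i‖ ^ 2 * ‖z s‖ ^ 2 + (I1 + I2) := fun s hs => by
    have h1 := energy_identity_of_contDiff hp hz hG hzG ht hs.1
    have h2 := abs_le.1 (abs_two_mul_intervalIntegral_le hz2 hG2 ht hs.1)
    have h3 : ‖i (z s)‖ ^ 2 ≤ ‖i‖ ^ 2 * ‖z s‖ ^ 2 := by
      rw [← mul_pow]; exact pow_le_pow_left₀ (norm_nonneg _) (i.le_opNorm _) 2
    linarith [h2.1]
  have hc : Continuous fun s => ‖i‖ ^ 2 * ‖z s‖ ^ 2 + (I1 + I2) := by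
    have := hz.continuous
    fun_prop
  have h := intervalIntegral.integral_mono_on (a := t) (b := t + 1) (by linarith)
    (intervalIntegrable_const (μ := volume) (c := ‖i (z t)‖ ^ 2)) (hc.intervalIntegrable _ _) key
  have hc' : Continuous fun s => ‖i‖ ^ 2 * ‖z s‖ ^ 2 := by
    have := hz.continuous
    fun_prop
  rw [intervalIntegral.integral_add (hc'.intervalIntegrable _ _) intervalIntegrable_const,
    intervalIntegral.integral_const_mul] at h
  simp only [intervalIntegral.integral_const, smul_eq_mul, add_sub_cancel_left, one_mul] at h
  have h4 : ∫ s in t..t + 1, ‖z s‖ ^ 2 ≤ I1 := by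
    rw [intervalIntegral.integral_of_le (by linarith)]
    exact setIntegral_mono_set (integrable_norm_sq hz2) (ae_of_all _ fun t => by positivity)
      (LE.le.eventuallyLE fun s hs => lt_of_le_of_lt ht hs.1)
  nlinarith [mul_le_mul_of_nonneg_left h4 (sq_nonneg ‖i‖)]

/-- An element of `W(0,∞)` has a continuous representative with values in the pivot space, for
which the energy identity and integration by parts hold. -/
theorem exists_continuous_representative [CompleteSpace V] [CompleteSpace Y]
    (hp : ∀ x v, p x v = inner ℝ x (i v)) {y : ℝ → V} {g : ℝ → StrongDual ℝ V}
    (hy : MemLp y 2 (volume.restrict (Ioi (0 : ℝ)))) (hg : MemLp g 2 (volume.restrict (Ioi (0 : ℝ))))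
    (hw : ∀ φ : ℝ → ℝ, IsTest (Ioi 0) φ →
      ∫ t in Ioi 0, deriv φ t • p (i (y t)) = -∫ t in Ioi 0, φ t • g t) :
    ∃ c : ℝ → Y, ContinuousOn c (Ici 0) ∧
      (∀ᵐ t ∂volume.restrict (Ioi (0 : ℝ)), i (y t) = c t) ∧
      (∀ t, 0 ≤ t → ‖c t‖ ^ 2 ≤
        (‖i‖ ^ 2 + 1) * (∫ t in Ioi 0, ‖y t‖ ^ 2) + ∫ t in Ioi 0, ‖g t‖ ^ 2) ∧
      (∀ a b, 0 ≤ a → a ≤ b → ‖c b‖ ^ 2 - ‖c a‖ ^ 2 = 2 * ∫ t in a..b, g t (y t)) ∧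
      (∀ φ : ℝ → ℝ, ContDiff ℝ 1 φ → ∀ a b, 0 ≤ a → a ≤ b →
        φ b • p (c b) - φ a • p (c a) =
          (∫ t in a..b, deriv φ t • p (i (y t))) + ∫ t in a..b, φ t • g t) := by
  obtain ⟨yn, gn, hyn, hgn, hd, hyn2, hgn2, hty, htg⟩ := exists_smooth_approx (p.comp i) hy hg hw
  have hLy := (Lp.tendsto_Lp_iff_tendsto_eLpNorm'' yn hyn2 y hy).2 hty
  have hLg := (Lp.tendsto_Lp_iff_tendsto_eLpNorm'' gn hgn2 g hg).2 htg
  -- uniform Cauchy property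
  have hsup : ∀ m n t, 0 ≤ t → ‖i (yn m t) - i (yn n t)‖ ^ 2 ≤
      (‖i‖ ^ 2 + 1) * ‖(hyn2 m).toLp (yn m) - (hyn2 n).toLp (yn n)‖ ^ 2 +
        ‖(hgn2 m).toLp (gn m) - (hgn2 n).toLp (gn n)‖ ^ 2 := fun m n t ht => by
    rw [← MemLp.toLp_sub, ← MemLp.toLp_sub, norm_toLp_sq, norm_toLp_sq, ← map_sub]
    refine norm_sq_le_of_contDiff hp (z := yn m - yn n) (G := gn m - gn n) ((hyn m).sub (hyn n))
      ((hgn m).sub (hgn n)) (fun s hs => ?_) ((hyn2 m).sub (hyn2 n)) ((hgn2 m).sub (hgn2 n)) ht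
    rw [deriv_sub ((hyn m).differentiable one_ne_zero s) ((hyn n).differentiable one_ne_zero s),
      map_sub, map_sub]
    exact congr_arg₂ _ (hd m s hs) (hd n s hs)
  have hcau : UniformCauchySeqOn (fun n t => i (yn n t)) atTop (Ici (0 : ℝ)) := by
    have hT : Tendsto (fun q : ℕ × ℕ =>
        (‖i‖ ^ 2 + 1) * ‖(hyn2 q.1).toLp (yn q.1) - (hyn2 q.2).toLp (yn q.2)‖ ^ 2 +
        ‖(hgn2 q.1).toLp (gn q.1) - (hgn2 q.2).toLp (gn q.2)‖ ^ 2) (atTop ×ˢ atTop) (𝓝 0) := by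
      have h1 := ((hLy.comp tendsto_fst).sub (hLy.comp tendsto_snd)).norm.pow 2 |>.const_mul
        (‖i‖ ^ 2 + 1)
      have h2 := ((hLg.comp (tendsto_fst (f := atTop) (g := atTop))).sub
        (hLg.comp tendsto_snd)).norm.pow 2
      simpa using h1.add h2
    rw [Metric.uniformCauchySeqOn_iff]
    intro ε hε
    have := hT.eventually_lt_const (show (0 : ℝ) < ε ^ 2 by positivity)
    rw [prod_atTop_atTop_eq, eventually_atTop] at this
    obtain ⟨⟨N, N'⟩, hN⟩ := this
    refine ⟨max N N', fun m hm n hn t ht => ?_⟩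
    rw [dist_eq_norm]
    refine lt_of_pow_lt_pow_left₀ 2 hε.le ((hsup m n t ht).trans_lt
      (hN (m, n) ⟨le_trans (le_max_left _ _) hm, le_trans (le_max_right _ _) hn⟩))
  choose! c hc using fun t (ht : t ∈ Ici (0 : ℝ)) => cauchySeq_tendsto_of_complete (hcau.cauchySeq ht)
  have hunif : TendstoUniformlyOn (fun n t => i (yn n t)) c atTop (Ici (0 : ℝ)) :=
    hcau.tendstoUniformlyOn_of_tendsto hc
  have hcc : ContinuousOn c (Ici 0) := hunif.continuousOn
    (Eventually.frequently (Eventually.of_forall fun n =>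
      (i.continuous.comp (hyn n).continuous).continuousOn))
  -- The `L²(I; V)` limit and the uniform limit agree: along a subsequence the approximations
  -- converge to `y` almost everywhere in `V`.
  have hae : ∀ᵐ t ∂volume.restrict (Ioi (0 : ℝ)), i (y t) = c t := by
    obtain ⟨ns, hns, hlim⟩ := (tendstoInMeasure_of_tendsto_eLpNorm (by norm_num)
      (fun n => (hyn2 n).1) hy.1 hty).exists_seq_tendsto_ae
    filter_upwards [hlim, ae_restrict_mem measurableSet_Ioi] with t h1 h2
    exact tendsto_nhds_unique ((i.continuous.tendsto _).comp h1)
      ((hc t (mem_Ici.2 (le_of_lt h2))).comp hns.tendsto_atTop)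
  have hres : ∀ a b : ℝ, 0 ≤ a → volume.restrict (Ioc a b) ≤ volume.restrict (Ioi 0) :=
    fun a b ha => Measure.restrict_mono (fun t ht => lt_of_le_of_lt ha ht.1) le_rfl
  have hresT : ∀ {E : Type _} [NormedAddCommGroup E] {f : ℕ → ℝ → E} {a b : ℝ}, 0 ≤ a →
      Tendsto (fun n => eLpNorm (f n) 2 (volume.restrict (Ioi (0 : ℝ)))) atTop (𝓝 0) →
      Tendsto (fun n => eLpNorm (f n) 2 (volume.restrict (Ioc a b))) atTop (𝓝 0) :=
    fun ha h => tendsto_of_tendsto_of_tendsto_of_le_of_le tendsto_const_nhds h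
      (fun _ => zero_le) fun n => eLpNorm_mono_measure _ (hres _ _ ha)
  refine ⟨c, hcc, hae, fun t ht => ?_, fun a b ha hab => ?_, fun φ hφ a b ha hab => ?_⟩
  · have h1 := (hc t ht).norm.pow 2
    have h2 := ((hLy.norm.pow 2).const_mul (‖i‖ ^ 2 + 1)).add (hLg.norm.pow 2)
    rw [norm_toLp_sq, norm_toLp_sq] at h2
    refine le_of_tendsto_of_tendsto' h1 h2 fun n => ?_
    rw [norm_toLp_sq, norm_toLp_sq]
    exact norm_sq_le_of_contDiff hp (hyn n) (hgn n) (hd n) (hyn2 n) (hgn2 n) ht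
  · have h1 := ((hc b (ha.trans hab)).norm.pow 2).sub ((hc a ha).norm.pow 2)
    have h2 := tendsto_integral_bilin (ContinuousLinearMap.id ℝ (StrongDual ℝ V))
      (hg.mono_measure (hres a b ha)) (hy.mono_measure (hres a b ha))
      (fun n => (hgn2 n).mono_measure (hres a b ha)) (fun n => (hyn2 n).mono_measure (hres a b ha))
      (hresT ha htg) (hresT ha hty)
    have h3 := h2.const_mul 2
    simp only [ContinuousLinearMap.id_apply, ← intervalIntegral.integral_of_le hab] at h3
    exact tendsto_nhds_unique (h1.congr fun n =>
      energy_identity_of_contDiff hp (hyn n) (hgn n) (hd n) ha hab) h3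
  · have mφ : ∀ {ψ : ℝ → ℝ}, Continuous ψ → MemLp ψ 2 (volume.restrict (Ioc a b)) := fun {ψ} hψ => by
      obtain ⟨C, hC⟩ := isCompact_Icc.exists_bound_of_continuousOn (hψ.continuousOn (s := Icc a b))
      refine MemLp.of_bound hψ.aestronglyMeasurable C ?_
      filter_upwards [ae_restrict_mem measurableSet_Ioc] with t ht using hC t ⟨ht.1.le, ht.2⟩
    have hφ' : Continuous (deriv φ) := hφ.continuous_deriv le_rfl
    have hconst : ∀ ψ : ℝ → ℝ, Tendsto (fun _ : ℕ => eLpNorm (ψ - ψ) 2 (volume.restrict (Ioc a b)))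
        atTop (𝓝 0) := fun ψ => by simp
    have h1 := (((p.continuous.tendsto _).comp (hc b (ha.trans hab))).const_smul (φ b)).sub
      (((p.continuous.tendsto _).comp (hc a ha)).const_smul (φ a))
    have h2 := tendsto_integral_bilin (ContinuousLinearMap.lsmul ℝ ℝ) (mφ hφ')
      (((p.comp i).comp_memLp' hy).mono_measure (hres a b ha)) (fun _ => mφ hφ')
      (fun n => ((p.comp i).comp_memLp' (hyn2 n)).mono_measure (hres a b ha)) (hconst _)
      (hresT ha (tendsto_eLpNorm_clm (p.comp i) hty))
    have h3 := tendsto_integral_bilin (ContinuousLinearMap.lsmul ℝ ℝ) (mφ hφ.continuous)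
      (hg.mono_measure (hres a b ha)) (fun _ => mφ hφ.continuous)
      (fun n => (hgn2 n).mono_measure (hres a b ha)) (hconst _) (hresT ha htg)
    have h4 := h2.add h3
    simp only [ContinuousLinearMap.lsmul_apply, ← intervalIntegral.integral_of_le hab] at h4
    refine tendsto_nhds_unique (h1.congr fun n => ?_) h4
    have hcy : Continuous fun t => p (i (yn n t)) :=
      p.continuous.comp (i.continuous.comp (hyn n).continuous)
    have hI1 : IntervalIntegrable (fun t => deriv φ t • p (i (yn n t))) volume a b :=
      (hφ'.smul hcy).intervalIntegrable _ _
    have hI2 : IntervalIntegrable (fun t => φ t • gn n t) volume a b :=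
      (hφ.continuous.smul (hgn n)).intervalIntegrable _ _
    refine Eq.trans (Eq.symm ?_) (intervalIntegral.integral_add hI1 hI2)
    refine intervalIntegral.integral_eq_sub_of_hasDerivAt (f := fun t => φ t • p (i (yn n t)))
      (fun t ht => ?_) (hI1.add hI2)
    rw [uIcc_of_le hab] at ht
    have hdy : HasDerivAt (fun t => p (i (yn n t))) (gn n t) t := by
      rw [← hd n t (ha.trans ht.1)]
      exact (p.comp i).hasFDerivAt.comp_hasDerivAt t
        ((hyn n).differentiable one_ne_zero t).hasDerivAt
    have := ((hφ.differentiable one_ne_zero) t).hasDerivAt.smul hdy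
    rwa [add_comm] at this

end LionsMagenes

end

section

/-! ### The space `W(0,∞)` and its trace at time `0` -/

theorem continuous_integral_smul {E : Type*} [NormedAddCommGroup E] [NormedSpace ℝ E]
    [CompleteSpace E] (J : Set ℝ) {ψ : ℝ → ℝ} (hψ : Continuous ψ) (hc : HasCompactSupport ψ) :
    Continuous fun g : Lp E 2 (volume.restrict J) => ∫ t in J, ψ t • g t := by
  have hm : MemLp ψ 2 (volume.restrict J) := hψ.memLp_of_hasCompactSupport hc
  have e : (fun g : Lp E 2 (volume.restrict J) => ∫ t in J, ψ t • g t) =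
      (ContinuousLinearMap.lsmul ℝ ℝ : ℝ →L[ℝ] E →L[ℝ] E).lpPairing (volume.restrict J) 2 2
        (hm.toLp ψ) := by
    ext g
    rw [ContinuousLinearMap.lpPairing_eq_integral]
    refine integral_congr_ae ?_
    filter_upwards [hm.coeFn_toLp] with t ht
    rw [ht]; rfl
  rw [e]
  exact ContinuousLinearMap.continuous _

/-- Each test function imposes one equation between continuous maps of `(y, dy/dt)`. Completeness of
`W` follows, which the closed-range and open-mapping arguments need. -/
theorem isClosed_timeSobolev {X Z : Type*} [NormedAddCommGroup X] [NormedSpace ℝ X]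
    [NormedAddCommGroup Z] [NormedSpace ℝ Z] [CompleteSpace Z] (e : X →L[ℝ] Z) (J : Set ℝ) :
    IsClosed (timeSobolev e J : Set (PairSpace X Z J)) := by
  have h : (timeSobolev e J : Set (PairSpace X Z J)) = ⋂ φ : {φ : ℝ → ℝ // IsTest J φ},
      {w | ∫ t in J, deriv φ.1 t • (e.compLpL 2 (volume.restrict J) w.fst) t =
        -∫ t in J, φ.1 t • w.snd t} := by
    ext w
    simp only [SetLike.mem_coe, mem_iInter, mem_ofPred_eq, Subtype.forall]
    refine forall₂_congr fun φ _ => ?_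
    have : ∫ t in J, deriv φ t • (e.compLpL 2 (volume.restrict J) w.fst) t =
        ∫ t in J, deriv φ t • e (w.fst t) := by
      refine integral_congr_ae ?_
      filter_upwards [e.coeFn_compLpL w.fst] with t ht
      rw [ht]
    rw [this]
  rw [h]
  refine isClosed_iInter fun ⟨φ, hφ⟩ => isClosed_eq ?_ ?_
  · exact (continuous_integral_smul J (hφ.1.continuous_deriv (by simp)) hφ.2.1.deriv).comp
      ((e.compLpL 2 (volume.restrict J)).continuous.comp (WithLp.fstL 2 ℝ _ _).continuous)
  · exact ((continuous_integral_smul J hφ.1.continuous hφ.2.1).comp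
      (WithLp.sndL 2 ℝ _ _).continuous).neg

variable {d : ℕ} {Ω : Set (EuclideanSpace ℝ (Fin d))}

instance (J : Set ℝ) : CompleteSpace (W Ω J) :=
  (isClosed_timeSobolev (gelfand Ω) J).completeSpace_coe

/-- The function underlying an element of `W(J)`, as a continuous linear map. -/
def W.stateL (Ω : Set (EuclideanSpace ℝ (Fin d))) (J : Set ℝ) :
    W Ω J →L[ℝ] Lp (V Ω) 2 (volume.restrict J) :=
  (WithLp.fstL 2 ℝ _ _).comp (timeSobolev (gelfand Ω) J).subtypeL

/-- The time derivative, as a continuous linear map. -/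
def W.timeDerivL (Ω : Set (EuclideanSpace ℝ (Fin d))) (J : Set ℝ) :
    W Ω J →L[ℝ] Lp (VDual Ω) 2 (volume.restrict J) :=
  (WithLp.sndL 2 ℝ _ _).comp (timeSobolev (gelfand Ω) J).subtypeL

theorem W.norm_sq {J : Set ℝ} (y : W Ω J) : ‖y‖ ^ 2 = ‖W.state y‖ ^ 2 + ‖W.timeDeriv y‖ ^ 2 :=
  WithLp.prod_norm_sq_eq_of_L2 _

theorem W.norm_state_le {J : Set ℝ} (y : W Ω J) : ‖W.state y‖ ≤ ‖y‖ := by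
  refine le_of_sq_le_sq ?_ (norm_nonneg _)
  nlinarith [W.norm_sq y, sq_nonneg ‖W.timeDeriv y‖]

theorem W.norm_le {J : Set ℝ} (y : W Ω J) : ‖y‖ ≤ ‖W.state y‖ + ‖W.timeDeriv y‖ := by
  refine le_of_sq_le_sq ?_ (by positivity)
  nlinarith [W.norm_sq y, norm_nonneg (W.state y), norm_nonneg (W.timeDeriv y)]

theorem W.weakDeriv {J : Set ℝ} (y : W Ω J) {φ : ℝ → ℝ} (hφ : IsTest J φ) :
    ∫ t in J, deriv φ t • gelfand Ω (W.state y t) = -∫ t in J, φ t • W.timeDeriv y t :=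
  y.2 φ hφ

theorem W.exists_of_memLp {J : Set ℝ} {y : ℝ → V Ω} {g : ℝ → VDual Ω}
    (hy : MemLp y 2 (volume.restrict J)) (hg : MemLp g 2 (volume.restrict J))
    (hw : ∀ φ : ℝ → ℝ, IsTest J φ →
      ∫ t in J, deriv φ t • gelfand Ω (y t) = -∫ t in J, φ t • g t) :
    ∃ w : W Ω J, W.state w = hy.toLp y ∧ W.timeDeriv w = hg.toLp g := by
  refine ⟨⟨WithLp.toLp 2 (hy.toLp y, hg.toLp g), fun φ hφ => ?_⟩, rfl, rfl⟩
  have h1 : ∫ t in J, deriv φ t • gelfand Ω ((hy.toLp y) t) =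
      ∫ t in J, deriv φ t • gelfand Ω (y t) := by
    refine integral_congr_ae ?_
    filter_upwards [hy.coeFn_toLp] with t ht
    rw [ht]
  have h2 : ∫ t in J, φ t • (hg.toLp g) t = ∫ t in J, φ t • g t := by
    refine integral_congr_ae ?_
    filter_upwards [hg.coeFn_toLp] with t ht
    rw [ht]
  exact h1.trans ((hw φ hφ).trans (congr_arg Neg.neg h2.symm))

theorem norm_incl_apply_le (v : V Ω) : ‖incl Ω v‖ ≤ ‖v‖ := by
  refine le_of_sq_le_sq ?_ (norm_nonneg _)
  have h := WithLp.prod_norm_sq_eq_of_L2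
    ((H10 Ω).subtype v : GraphSpace Ω)
  have e1 : ‖((H10 Ω).subtype v : GraphSpace Ω)‖ = ‖v‖ := rfl
  have e2 : ((H10 Ω).subtype v : GraphSpace Ω).fst = incl Ω v := rfl
  rw [e1, e2] at h
  rw [h]
  exact le_add_of_nonneg_right (sq_nonneg _)

theorem norm_incl_le : ‖incl Ω‖ ≤ 1 :=
  ContinuousLinearMap.opNorm_le_bound _ zero_le_one fun v => by
    rw [one_mul]; exact norm_incl_apply_le v

theorem pivot_apply (x : Y Ω) (v : V Ω) : pivot Ω x v = inner ℝ x (incl Ω v) := rfl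

theorem norm_pivot_apply_le (x : Y Ω) : ‖pivot Ω x‖ ≤ ‖x‖ :=
  ContinuousLinearMap.opNorm_le_bound _ (norm_nonneg _) fun v =>
    (norm_inner_le_norm _ _).trans
      (mul_le_mul_of_nonneg_left (norm_incl_apply_le v) (norm_nonneg _))

/-- Since `‖incl Ω‖ ≤ 1`, the general bound reads `‖c(t)‖² ≤ 2 ‖y‖²_{L²(V)} + ‖dy/dt‖²_{L²(V*)}`,
rounded up to the constant `2` for the norms. -/
theorem W.exists_rep (y : WInf Ω) : ∃ c : ℝ → Y Ω, ContinuousOn c (Ici 0) ∧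
      (∀ᵐ t ∂volume.restrict (Ioi (0 : ℝ)), incl Ω (W.state y t) = c t) ∧
      (∀ t, 0 ≤ t → ‖c t‖ ≤ 2 * ‖y‖) ∧
      (∀ a b, 0 ≤ a → a ≤ b →
        ‖c b‖ ^ 2 - ‖c a‖ ^ 2 = 2 * ∫ t in a..b, W.timeDeriv y t (W.state y t)) ∧
      (∀ φ : ℝ → ℝ, ContDiff ℝ 1 φ → ∀ a b, 0 ≤ a → a ≤ b →
        φ b • pivot Ω (c b) - φ a • pivot Ω (c a) =
          (∫ t in a..b, deriv φ t • gelfand Ω (W.state y t)) +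
            ∫ t in a..b, φ t • W.timeDeriv y t) := by
  obtain ⟨c, h1, h2, h3, h4, h5⟩ := exists_continuous_representative (i := incl Ω) (p := pivot Ω)
    pivot_apply (Lp.memLp (W.state y)) (Lp.memLp (W.timeDeriv y)) fun φ hφ => W.weakDeriv y hφ
  refine ⟨c, h1, h2, fun t ht => ?_, h4, h5⟩
  have h := h3 t ht
  rw [← norm_sq_eq_integral, ← norm_sq_eq_integral] at h
  have h6 : ‖incl Ω‖ ^ 2 ≤ 1 := pow_le_one₀ (norm_nonneg _) norm_incl_le
  refine le_of_sq_le_sq ?_ (by positivity)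
  have h7 := W.norm_sq y
  nlinarith [mul_le_mul_of_nonneg_right h6 (sq_nonneg ‖W.state y‖), sq_nonneg ‖W.state y‖,
    sq_nonneg ‖W.timeDeriv y‖]

/-- The continuous `Y`-valued representative of an element of `W_∞`. -/
def W.rep (y : WInf Ω) : ℝ → Y Ω := (W.exists_rep y).choose

theorem W.rep_continuousOn (y : WInf Ω) : ContinuousOn (W.rep y) (Ici 0) :=
  (W.exists_rep y).choose_spec.1

theorem W.rep_ae (y : WInf Ω) :
    ∀ᵐ t ∂volume.restrict (Ioi (0 : ℝ)), incl Ω (W.state y t) = W.rep y t :=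
  (W.exists_rep y).choose_spec.2.1

theorem W.norm_rep_le (y : WInf Ω) {t : ℝ} (ht : 0 ≤ t) : ‖W.rep y t‖ ≤ 2 * ‖y‖ :=
  (W.exists_rep y).choose_spec.2.2.1 t ht

theorem W.energy (y : WInf Ω) {a b : ℝ} (ha : 0 ≤ a) (hab : a ≤ b) :
    ‖W.rep y b‖ ^ 2 - ‖W.rep y a‖ ^ 2 = 2 * ∫ t in a..b, W.timeDeriv y t (W.state y t) :=
  (W.exists_rep y).choose_spec.2.2.2.1 a b ha hab

theorem W.integral_by_parts (y : WInf Ω) {φ : ℝ → ℝ} (hφ : ContDiff ℝ 1 φ) {a b : ℝ} (ha : 0 ≤ a)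
    (hab : a ≤ b) : φ b • pivot Ω (W.rep y b) - φ a • pivot Ω (W.rep y a) =
      (∫ t in a..b, deriv φ t • gelfand Ω (W.state y t)) + ∫ t in a..b, φ t • W.timeDeriv y t :=
  (W.exists_rep y).choose_spec.2.2.2.2 φ hφ a b ha hab

theorem eqOn_Ici_of_ae_eq {E : Type*} [TopologicalSpace E] [T2Space E] {f g : ℝ → E}
    (hf : ContinuousOn f (Ici 0)) (hg : ContinuousOn g (Ici 0))
    (h : f =ᵐ[volume.restrict (Ioi (0 : ℝ))] g) : EqOn f g (Ici 0) := by
  rw [restrict_Ioi_eq_restrict_Ici] at h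
  exact Measure.eqOn_of_ae_eq h hf hg (by rw [interior_Ici, closure_Ioi])

theorem W.rep_unique (y : WInf Ω) {c : ℝ → Y Ω} (hc : ContinuousOn c (Ici 0))
    (h : ∀ᵐ t ∂volume.restrict (Ioi (0 : ℝ)), incl Ω (W.state y t) = c t) :
    EqOn (W.rep y) c (Ici 0) := by
  refine eqOn_Ici_of_ae_eq (W.rep_continuousOn y) hc ?_
  filter_upwards [W.rep_ae y, h] with t h1 h2
  rw [← h1, h2]

theorem hasInitialValue_iff (y : WInf Ω) (y₀ : Y Ω) : HasInitialValue y y₀ ↔ W.rep y 0 = y₀ := by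
  constructor
  · rintro ⟨c, h1, h2, rfl⟩
    exact W.rep_unique y h1 h2 (mem_Ici.2 le_rfl)
  · exact fun h => ⟨W.rep y, W.rep_continuousOn y, W.rep_ae y, h⟩

/-- The trace `y ↦ y(0)`. -/
def trace (Ω : Set (EuclideanSpace ℝ (Fin d))) : WInf Ω →L[ℝ] Y Ω :=
  LinearMap.mkContinuous
    { toFun := fun y => W.rep y 0
      map_add' := fun y z => by
        refine W.rep_unique (y + z) (c := fun t => W.rep y t + W.rep z t)
          ((W.rep_continuousOn y).add (W.rep_continuousOn z)) ?_ (mem_Ici.2 le_rfl)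
        filter_upwards [W.rep_ae y, W.rep_ae z, Lp.coeFn_add (W.state y) (W.state z)] with t h1 h2 h3
        rw [← h1, ← h2, ← map_add]
        exact congr_arg _ h3
      map_smul' := fun a y => by
        refine W.rep_unique (a • y) (c := fun t => a • W.rep y t)
          ((W.rep_continuousOn y).const_smul a) ?_ (mem_Ici.2 le_rfl)
        filter_upwards [W.rep_ae y, Lp.coeFn_smul a (W.state y)] with t h1 h3
        rw [← h1, ← map_smul]
        exact congr_arg _ h3 } 2 fun y => W.norm_rep_le y le_rfl

theorem trace_apply (y : WInf Ω) : trace Ω y = W.rep y 0 := rfl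

/-- Pairing of `L²(J; V*)` with `L²(J; V)`. -/
def dualPairing (Ω : Set (EuclideanSpace ℝ (Fin d))) (J : Set ℝ) :
    Lp (VDual Ω) 2 (volume.restrict J) →L[ℝ] Lp (V Ω) 2 (volume.restrict J) →L[ℝ] ℝ :=
  (ContinuousLinearMap.id ℝ (VDual Ω)).lpPairing (volume.restrict J) 2 2

theorem dualPairing_apply {J : Set ℝ} (g : Lp (VDual Ω) 2 (volume.restrict J))
    (y : Lp (V Ω) 2 (volume.restrict J)) : dualPairing Ω J g y = ∫ t in J, g t (y t) :=
  ContinuousLinearMap.lpPairing_eq_integral _ _ _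

theorem abs_dualPairing_le {J : Set ℝ} (g : Lp (VDual Ω) 2 (volume.restrict J))
    (y : Lp (V Ω) 2 (volume.restrict J)) : |dualPairing Ω J g y| ≤ ‖g‖ * ‖y‖ := by
  set B := ContinuousLinearMap.id ℝ (VDual Ω)
  have h1 : dualPairing Ω J g y = L1.integral (B.holder 1 g y) := by
    rw [dualPairing_apply, L1.integral_eq_integral]
    exact (integral_congr_ae (B.coeFn_holder g y)).symm
  rw [h1, ← Real.norm_eq_abs]
  refine (L1.norm_integral_le _).trans ((B.norm_holder_apply_apply_le g y).trans ?_)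
  have h2 : ‖B‖ ≤ 1 := ContinuousLinearMap.norm_id_le
  calc ‖B‖ * ‖g‖ * ‖y‖ ≤ 1 * ‖g‖ * ‖y‖ := by gcongr
    _ = _ := by rw [one_mul]

/-- `∫₀^∞ ⟨y', y⟩ dt = -½ ‖y(0)‖²`. -/
theorem W.energy_Ioi (y : WInf Ω) :
    2 * dualPairing Ω (Ioi 0) (W.timeDeriv y) (W.state y) = -‖trace Ω y‖ ^ 2 := by
  have hint : IntegrableOn (fun t => W.timeDeriv y t (W.state y t)) (Ioi 0) :=
    integrable_bilin (ContinuousLinearMap.id ℝ (VDual Ω)) (Lp.memLp _) (Lp.memLp _)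
  have h1 : Tendsto (fun b => ∫ t in (0 : ℝ)..b, W.timeDeriv y t (W.state y t)) atTop
      (𝓝 (∫ t in Ioi 0, W.timeDeriv y t (W.state y t))) :=
    intervalIntegral_tendsto_integral_Ioi 0 hint tendsto_id
  have h2 : Tendsto (fun b => ‖W.rep y b‖ ^ 2) atTop
      (𝓝 (‖trace Ω y‖ ^ 2 + 2 * ∫ t in Ioi 0, W.timeDeriv y t (W.state y t))) := by
    refine ((h1.const_mul 2).const_add (‖trace Ω y‖ ^ 2)).congr' ?_
    filter_upwards [eventually_ge_atTop 0] with b hb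
    rw [← W.energy y le_rfl hb, trace_apply]; ring
  have h3 : IntegrableOn (fun t => ‖W.rep y t‖ ^ 2) (Ioi 0) := by
    refine (integrable_norm_sq ((incl Ω).comp_memLp' (Lp.memLp (W.state y)))).congr ?_
    filter_upwards [W.rep_ae y] with t ht
    rw [Function.comp_apply, ht]
  -- `‖y(t)‖²` has a limit at infinity by the energy identity and is integrable, so the limit is
  -- `0`.
  have h4 := IntegrableAtFilter.eq_zero_of_tendsto (l := atTop) ⟨Ioi 0, Ioi_mem_atTop 0, h3⟩
    (fun s hs => by
      obtain ⟨b, hb⟩ := mem_atTop_sets.1 hs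
      rw [← top_le_iff, ← Real.volume_Ici (a := b)]
      exact measure_mono hb) h2
  rw [dualPairing_apply]
  linarith

end

section

/-! ### Test functions in `V` and in `W(0,∞)` -/

theorem IsTest.exists_incl_eq {d : ℕ} {Ω : Set (EuclideanSpace ℝ (Fin d))}
    {φ : EuclideanSpace ℝ (Fin d) → ℝ} (hφ : IsTest Ω φ) :
    ∃ v : V Ω, incl Ω v =ᵐ[volume.restrict Ω] φ := by
  have h1 : MemLp φ 2 (volume.restrict Ω) := hφ.1.continuous.memLp_of_hasCompactSupport hφ.2.1
  have hc : Continuous (gradient φ) := (InnerProductSpace.toDual ℝ _).symm.continuous.comp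
    (hφ.1.continuous_fderiv (by simp))
  have hs : HasCompactSupport (gradient φ) :=
    (hφ.2.1.fderiv ℝ).comp_left (g := (InnerProductSpace.toDual ℝ _).symm) (map_zero _)
  have h2 : MemLp (gradient φ) 2 (volume.restrict Ω) := hc.memLp_of_hasCompactSupport hs
  exact ⟨⟨WithLp.toLp 2 (h1.toLp φ, h2.toLp _), Submodule.le_topologicalClosure _
    (Submodule.subset_span ⟨φ, hφ, h1.coeFn_toLp, h2.coeFn_toLp⟩)⟩, h1.coeFn_toLp⟩

/-- Density of `V` in `Y`: test functions lie in `V`, and the fundamental lemma of the calculus of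
variations applies. -/
theorem eq_zero_of_inner_incl {d : ℕ} {Ω : Set (EuclideanSpace ℝ (Fin d))} (hΩ : IsOpen Ω)
    {h : Y Ω} (hh : ∀ v : V Ω, inner ℝ h (incl Ω v) = 0) : h = 0 := by
  have key : ∀ᵐ x ∂volume.restrict Ω, x ∈ Ω → h x = 0 := by
    refine hΩ.ae_eq_zero_of_integral_contDiff_smul_eq_zero
      (((Lp.memLp h).locallyIntegrable (by norm_num)).locallyIntegrableOn _) fun φ h1 h2 h3 => ?_
    obtain ⟨v, hv⟩ := IsTest.exists_incl_eq (Ω := Ω) ⟨h1, h2, h3⟩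
    rw [← hh v, L2.inner_def]
    refine integral_congr_ae ?_
    filter_upwards [hv] with x hx
    rw [hx]; rfl
  refine Lp.ext ?_
  filter_upwards [key, ae_restrict_mem hΩ.measurableSet, Lp.coeFn_zero ℝ 2 (volume.restrict Ω)]
    with x h1 h2 h3
  rw [h1 h2, h3]; rfl

variable {d : ℕ} {Ω : Set (EuclideanSpace ℝ (Fin d))}

theorem gelfand_symm (v w : V Ω) : gelfand Ω v w = gelfand Ω w v :=
  real_inner_comm (incl Ω w) (incl Ω v)

theorem IsTest.apply_zero {φ : ℝ → ℝ} (hφ : IsTest (Ioi 0) φ) : φ 0 = 0 := by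
  by_contra h
  exact lt_irrefl (0 : ℝ) (mem_Ioi.1 (hφ.2.2 (subset_tsupport _ h)))

/-- The products `φ(t) x` are the test elements for the duality argument: with `φ(0) = 0` they
detect the adjoint equation, with `φ(0) = 1` the initial value. -/
theorem W.exists_smul {φ : ℝ → ℝ} (hφ : ContDiff ℝ 1 φ) (hc : HasCompactSupport φ) (x : V Ω) :
    ∃ w : WInf Ω, (W.state w =ᵐ[volume.restrict (Ioi 0)] fun t => φ t • x) ∧
      (W.timeDeriv w =ᵐ[volume.restrict (Ioi 0)] fun t => deriv φ t • gelfand Ω x) ∧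
      trace Ω w = φ 0 • incl Ω x := by
  have hφ' : Continuous (deriv φ) := hφ.continuous_deriv le_rfl
  have m1 : MemLp (fun t => φ t • x) 2 (volume.restrict (Ioi (0 : ℝ))) :=
    (hφ.continuous.smul continuous_const).memLp_of_hasCompactSupport hc.smul_right
  have m2 : MemLp (fun t => deriv φ t • gelfand Ω x) 2 (volume.restrict (Ioi (0 : ℝ))) :=
    (hφ'.smul continuous_const).memLp_of_hasCompactSupport hc.deriv.smul_right
  obtain ⟨w, h1, h2⟩ := W.exists_of_memLp m1 m2 fun ψ hψ => by
    have hψ1 : ContDiff ℝ 1 ψ := hψ.1.of_le (by norm_cast)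
    have hψ0 := hψ.apply_zero
    have h := (hψ.2.1.mul_right (f' := φ)).integral_Ioi_deriv_eq (hψ1.mul hφ) 0
    have hd : ∀ t, deriv (fun t => ψ t * φ t) t = deriv ψ t * φ t + ψ t * deriv φ t := fun t =>
      deriv_fun_mul (hψ1.differentiable one_ne_zero t) (hφ.differentiable one_ne_zero t)
    simp only [hd, hψ0, zero_mul, neg_zero] at h
    have i1 : Integrable (fun t => deriv ψ t * φ t) (volume.restrict (Ioi (0 : ℝ))) :=
      (((hψ1.continuous_deriv le_rfl).mul hφ.continuous).integrable_of_hasCompactSupport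
        hc.mul_left).integrableOn
    have i2 : Integrable (fun t => ψ t * deriv φ t) (volume.restrict (Ioi (0 : ℝ))) :=
      ((hψ1.continuous.mul hφ').integrable_of_hasCompactSupport hc.deriv.mul_left).integrableOn
    rw [integral_add i1 i2] at h
    simp only [map_smul, smul_smul]
    rw [integral_smul_const, integral_smul_const, ← neg_smul, eq_neg_of_add_eq_zero_left h]
  have e1 : W.state w =ᵐ[volume.restrict (Ioi 0)] fun t => φ t • x := by
    rw [h1]; exact m1.coeFn_toLp
  refine ⟨w, e1, by rw [h2]; exact m2.coeFn_toLp, ?_⟩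
  refine W.rep_unique w (c := fun t => φ t • incl Ω x)
    (hφ.continuous.smul continuous_const).continuousOn ?_ (mem_Ici.2 le_rfl)
  filter_upwards [e1] with t ht
  rw [ht, map_smul]

/-! ### The coercive linear problem -/

/-- `y ↦ y_t - 𝒢 y`. -/
def evolution (𝒢 : V Ω →L[ℝ] VDual Ω) : WInf Ω →L[ℝ] L2VDual Ω :=
  W.timeDerivL Ω (Ioi 0) - (𝒢.compLpL 2 (volume.restrict (Ioi 0))).comp (W.stateL Ω (Ioi 0))

theorem evolution_apply (𝒢 : V Ω →L[ℝ] VDual Ω) (y : WInf Ω) :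
    evolution 𝒢 y = W.timeDeriv y - 𝒢.compLpL 2 (volume.restrict (Ioi 0)) (W.state y) := rfl

theorem coeFn_evolution (𝒢 : V Ω →L[ℝ] VDual Ω) (y : WInf Ω) :
    evolution 𝒢 y =ᵐ[volume.restrict (Ioi 0)] fun t => W.timeDeriv y t - 𝒢 (W.state y t) := by
  rw [evolution_apply]
  filter_upwards [Lp.coeFn_sub (W.timeDeriv y) (𝒢.compLpL 2 (volume.restrict (Ioi 0)) (W.state y)),
    𝒢.coeFn_compLpL (p := 2) (W.state y)] with t h1 h2
  rw [h1, Pi.sub_apply, h2]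

theorem mul_norm_sq_le_dualPairing {𝒢 : V Ω →L[ℝ] VDual Ω} {θ : ℝ}
    (h𝒢 : ∀ v, θ * ‖v‖ ^ 2 ≤ -𝒢 v v) (v : Lp (V Ω) 2 (volume.restrict (Ioi (0 : ℝ)))) :
    θ * ‖v‖ ^ 2 ≤ -dualPairing Ω (Ioi 0) (𝒢.compLpL 2 (volume.restrict (Ioi 0)) v) v := by
  rw [dualPairing_apply, norm_sq_eq_integral, ← integral_const_mul, ← integral_neg]
  refine integral_mono_ae ((integrable_norm_sq (Lp.memLp v)).const_mul _)
    (integrable_bilin (ContinuousLinearMap.id ℝ (VDual Ω)) (Lp.memLp _) (Lp.memLp _)).neg ?_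
  filter_upwards [𝒢.coeFn_compLpL (p := 2) v] with t ht
  rw [ht]
  exact h𝒢 _

/-- Pairing the equation with `y` and using `2 ∫ ⟨y', y⟩ = -‖y(0)‖²` gives `2θ ‖y‖² ≤ ‖y(0)‖² + 2 ∫
⟨g, y⟩` in `L²(I; V)`. Young's inequality absorbs the last term, and the equation itself bounds
`y'`. Hence the solution map is injective with closed range. -/
theorem exists_norm_le_evolution {𝒢 : V Ω →L[ℝ] VDual Ω} {θ : ℝ} (hθ : 0 < θ)
    (h𝒢 : ∀ v, θ * ‖v‖ ^ 2 ≤ -𝒢 v v) :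
    ∃ C : ℝ, 0 < C ∧ ∀ y : WInf Ω, ‖y‖ ≤ C * (‖evolution 𝒢 y‖ + ‖trace Ω y‖) := by
  refine ⟨√(1 / θ + 1 / θ ^ 2) * (1 + ‖𝒢‖) + 1, by positivity, fun y => ?_⟩
  set s := W.state y
  set g := evolution 𝒢 y
  set x := trace Ω y
  have hy' : W.timeDeriv y = g + 𝒢.compLpL 2 (volume.restrict (Ioi 0)) s := by
    simp [g, s, evolution_apply]
  have h1 := W.energy_Ioi y
  rw [hy', map_add, add_apply] at h1
  have h2 := mul_norm_sq_le_dualPairing h𝒢 s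
  have h3 := (abs_le.1 (abs_dualPairing_le g s)).2
  have h4 : 2 * (‖g‖ * ‖s‖) ≤ θ * ‖s‖ ^ 2 + ‖g‖ ^ 2 / θ := by
    have : 0 ≤ (θ * ‖s‖ - ‖g‖) ^ 2 / θ := by positivity
    have e : (θ * ‖s‖ - ‖g‖) ^ 2 / θ = θ * ‖s‖ ^ 2 + ‖g‖ ^ 2 / θ - 2 * (‖g‖ * ‖s‖) := by
      field_simp; ring
    linarith
  have h5 : θ * ‖s‖ ^ 2 ≤ ‖x‖ ^ 2 + ‖g‖ ^ 2 / θ := by linarith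
  have h6 : ‖s‖ ≤ √(1 / θ + 1 / θ ^ 2) * (‖g‖ + ‖x‖) := by
    refine le_of_sq_le_sq ?_ (by positivity)
    rw [mul_pow, Real.sq_sqrt (by positivity)]
    have h7 : ‖s‖ ^ 2 ≤ (‖x‖ ^ 2 + ‖g‖ ^ 2 / θ) / θ := by
      rw [le_div_iff₀ hθ]; linarith
    refine h7.trans ?_
    have e : (1 / θ + 1 / θ ^ 2) * (‖g‖ + ‖x‖) ^ 2 - (‖x‖ ^ 2 + ‖g‖ ^ 2 / θ) / θ =
      (1 / θ) * (‖g‖ ^ 2 + 2 * ‖g‖ * ‖x‖) + (1 / θ ^ 2) * (‖x‖ ^ 2 + 2 * ‖g‖ * ‖x‖) := by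
      field_simp; ring
    have : 0 ≤ (1 / θ) * (‖g‖ ^ 2 + 2 * ‖g‖ * ‖x‖) + (1 / θ ^ 2) * (‖x‖ ^ 2 + 2 * ‖g‖ * ‖x‖) := by
      positivity
    linarith
  have h8 : ‖W.timeDeriv y‖ ≤ ‖g‖ + ‖𝒢‖ * ‖s‖ := by
    rw [hy']
    exact (norm_add_le _ _).trans (add_le_add_right (𝒢.norm_compLp_le s) _)
  have h9 := W.norm_le y
  nlinarith [norm_nonneg g, norm_nonneg x, norm_nonneg 𝒢, mul_le_mul_of_nonneg_left h6 (norm_nonneg 𝒢)]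

/-- The inverse of the Riesz isomorphism. -/
def riesz (E : Type*) [NormedAddCommGroup E] [InnerProductSpace ℝ E] [CompleteSpace E] :
    StrongDual ℝ E →L[ℝ] E :=
  LinearMap.mkContinuous
    { toFun := (InnerProductSpace.toDual ℝ E).symm
      map_add' := map_add _
      map_smul' := fun c x => by simp } 1 fun x => by simp

theorem inner_riesz {E : Type*} [NormedAddCommGroup E] [InnerProductSpace ℝ E] [CompleteSpace E]
    (g : StrongDual ℝ E) (v : E) : inner ℝ (riesz E g) v = g v :=
  InnerProductSpace.toDual_symm_apply

theorem norm_riesz {E : Type*} [NormedAddCommGroup E] [InnerProductSpace ℝ E] [CompleteSpace E]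
    (g : StrongDual ℝ E) : ‖riesz E g‖ = ‖g‖ := (InnerProductSpace.toDual ℝ E).symm.norm_map g

theorem norm_compLpL_riesz (g : L2VDual Ω) :
    ‖(riesz (V Ω)).compLpL 2 (volume.restrict (Ioi 0)) g‖ = ‖g‖ := by
  rw [Lp.norm_def, Lp.norm_def]
  congr 1
  refine eLpNorm_congr_norm_ae ?_
  filter_upwards [(riesz (V Ω)).coeFn_compLpL (p := 2) g] with t ht
  rw [ht, norm_riesz]

theorem inner_compLpL_riesz (g : L2VDual Ω) (v : Lp (V Ω) 2 (volume.restrict (Ioi (0 : ℝ)))) :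
    inner ℝ ((riesz (V Ω)).compLpL 2 (volume.restrict (Ioi 0)) g) v =
      dualPairing Ω (Ioi 0) g v := by
  rw [L2.inner_def, dualPairing_apply]
  refine integral_congr_ae ?_
  filter_upwards [(riesz (V Ω)).coeFn_compLpL (p := 2) g] with t ht
  rw [ht, inner_riesz]

/-- Dense range by duality. Testing with `φ(t) x`, `φ(0) = 0`, shows that an annihilating `v`
satisfies `v' = -𝒢* v`, so `v ∈ W_∞`. Then `∫ ⟨v', v⟩` is at least `θ ‖v‖²` by coercivity and equals
`-½ ‖v(0)‖²` by the energy identity, which forces `v = 0`. Finally `h` is orthogonal to `V`, which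
is dense in `Y`. -/
theorem eq_zero_of_annihilates {𝒢 : V Ω →L[ℝ] VDual Ω} (hΩ : IsOpen Ω) {θ : ℝ} (hθ : 0 < θ)
    (h𝒢 : ∀ v, θ * ‖v‖ ^ 2 ≤ -𝒢 v v) {v : Lp (V Ω) 2 (volume.restrict (Ioi (0 : ℝ)))} {h : Y Ω}
    (hv : ∀ y : WInf Ω, dualPairing Ω (Ioi 0) (evolution 𝒢 y) v + inner ℝ (trace Ω y) h = 0) :
    v = 0 ∧ h = 0 := by
  have m1 : MemLp (fun t => -𝒢.flip (v t)) 2 (volume.restrict (Ioi (0 : ℝ))) :=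
    (𝒢.flip.comp_memLp' (Lp.memLp v)).neg
  obtain ⟨z, hz1, hz2⟩ := W.exists_of_memLp (Lp.memLp v) m1 fun φ hφ => by
    have hφ1 : ContDiff ℝ 1 φ := hφ.1.of_le (by norm_cast)
    have hφ0 := hφ.apply_zero
    have i1 := hφ.integrable_deriv (gelfand Ω) v
    have i2 : Integrable (fun t => φ t • -𝒢.flip (v t)) (volume.restrict (Ioi (0 : ℝ))) :=
      integrable_smul_of_compact _ _ hφ.1.continuous hφ.2.1 _ m1
    ext x
    obtain ⟨w, hw1, hw2, hw3⟩ := W.exists_smul hφ1 hφ.2.1 x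
    have h1 := hv w
    rw [hw3, hφ0, zero_smul, inner_zero_left, add_zero, dualPairing_apply] at h1
    rw [neg_apply, ContinuousLinearMap.integral_apply i1,
      ContinuousLinearMap.integral_apply i2, ← sub_eq_zero,
      sub_neg_eq_add, ← integral_add (i1.apply_continuousLinearMap x) (i2.apply_continuousLinearMap x)]
    refine (integral_congr_ae ?_).trans h1
    filter_upwards [coeFn_evolution 𝒢 w, hw1, hw2] with t e1 e2 e3
    rw [e1, e2, e3]
    simp [gelfand_symm (v t) x, sub_eq_add_neg]
  rw [Lp.toLp_coeFn] at hz1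
  have h1 := W.energy_Ioi z
  have h2 := mul_norm_sq_le_dualPairing h𝒢 v
  have h3 : dualPairing Ω (Ioi 0) (W.timeDeriv z) (W.state z) =
      -dualPairing Ω (Ioi 0) (𝒢.compLpL 2 (volume.restrict (Ioi 0)) v) v := by
    rw [hz1, hz2, dualPairing_apply, dualPairing_apply, ← integral_neg]
    refine integral_congr_ae ?_
    filter_upwards [𝒢.coeFn_compLpL (p := 2) v, m1.coeFn_toLp] with t e1 e2
    rw [e1, e2]; simp
  have hv0 : v = 0 := by
    have : ‖v‖ ^ 2 = 0 := by nlinarith [sq_nonneg ‖v‖, sq_nonneg ‖trace Ω z‖]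
    simpa using this
  refine ⟨hv0, eq_zero_of_inner_incl hΩ fun x => ?_⟩
  obtain ⟨b⟩ : Nonempty (ContDiffBump (0 : ℝ)) := inferInstance
  obtain ⟨w, -, -, hw⟩ := W.exists_smul (Ω := Ω) (φ := b) b.contDiff b.hasCompactSupport x
  have h4 := hv w
  rw [hv0, map_zero, zero_add, hw, b.one_of_mem_closedBall (by simp [b.rIn_pos.le]), one_smul] at h4
  rw [real_inner_comm, h4]

/-- Solvability of `y_t = 𝒢 y + g`, `y(0) = x`, for coercive `-𝒢`. -/
theorem exists_evolution_eq_of_coercive {𝒢 : V Ω →L[ℝ] VDual Ω} (hΩ : IsOpen Ω) {θ : ℝ}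
    (hθ : 0 < θ) (h𝒢 : ∀ v, θ * ‖v‖ ^ 2 ≤ -𝒢 v v) (g : L2VDual Ω) (x : Y Ω) :
    ∃ y : WInf Ω, evolution 𝒢 y = g ∧ trace Ω y = x := by
  -- The Riesz map moves `L²(I; V*)` isometrically into the Hilbert space `L²(I; V)`, so that
  -- density of the range can be tested on its orthogonal complement.
  let R := (riesz (V Ω)).compLpL 2 (volume.restrict (Ioi (0 : ℝ)))
  let e := (WithLp.prodContinuousLinearEquiv 2 ℝ (Lp (V Ω) 2 (volume.restrict (Ioi (0 : ℝ))))
    (Y Ω)).symm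
  let Λ := (e : _ →L[ℝ] WithLp 2 (Lp (V Ω) 2 (volume.restrict (Ioi (0 : ℝ))) × Y Ω)).comp
    ((R.comp (evolution 𝒢)).prod (trace Ω))
  have hΛ : ∀ y, Λ y = WithLp.toLp 2 (R (evolution 𝒢 y), trace Ω y) := fun y => rfl
  obtain ⟨C, hC, hCy⟩ := exists_norm_le_evolution hθ h𝒢
  have hanti : AntilipschitzWith (2 * C).toNNReal Λ := by
    refine Λ.antilipschitz_of_bound fun y => ?_
    rw [Real.coe_toNNReal _ (by positivity)]
    have h1 : ‖evolution 𝒢 y‖ ≤ ‖Λ y‖ := by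
      have h := WithLp.norm_fst_le (p := 2) (x := Λ y)
      rwa [hΛ, WithLp.toLp_fst, norm_compLpL_riesz, ← hΛ] at h
    have h2 : ‖trace Ω y‖ ≤ ‖Λ y‖ := WithLp.norm_snd_le (p := 2) (x := Λ y)
    nlinarith [hCy y]
  have hclosed : IsClosed (Λ.range : Set (WithLp 2 (Lp (V Ω) 2 (volume.restrict (Ioi (0 : ℝ))) × Y Ω))) :=
    hanti.isClosed_range Λ.uniformContinuous
  have htop : Λ.range = ⊤ := by
    rw [← hclosed.submodule_topologicalClosure_eq, Submodule.topologicalClosure_eq_top_iff,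
      Submodule.eq_bot_iff]
    intro q hq
    have h1 := eq_zero_of_annihilates hΩ hθ h𝒢 (v := q.fst) (h := q.snd) fun y => by
      rw [← inner_compLpL_riesz]
      exact hq (Λ y) ⟨y, rfl⟩
    exact WithLp.ofLp_injective _ (Prod.ext h1.1 h1.2)
  obtain ⟨y, hy⟩ : WithLp.toLp 2 (R g, x) ∈ Λ.range := by rw [htop]; trivial
  have hy' := (hΛ y).symm.trans hy
  have e1 : R (evolution 𝒢 y) = R g := congr_arg (fun q => q.fst) hy'
  refine ⟨y, ?_, congr_arg (fun q => q.snd) hy'⟩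
  rw [← sub_eq_zero, ← norm_eq_zero, ← norm_compLpL_riesz, map_sub]
  exact norm_eq_zero.2 (sub_eq_zero.2 e1)

end

section

/-! ### Mild solutions for exponentially stable semigroups -/

section Mild

variable {X : Type*} [NormedAddCommGroup X] [NormedSpace ℝ X]
  {S : ℝ → X →L[ℝ] X} {C μ : ℝ}

theorem norm_semigroup_apply_le (hμ : 0 < μ) (hb : ∀ t, 0 ≤ t → ‖S t‖ ≤ C * Real.exp (-μ * t))
    {t : ℝ} (ht : 0 ≤ t) (x : X) : ‖S t x‖ ≤ C * ‖x‖ := by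
  have hC : 0 ≤ C := by simpa using (norm_nonneg _).trans (hb 0 le_rfl)
  refine (S t).le_of_opNorm_le ((hb t ht).trans ?_) x
  have : Real.exp (-μ * t) ≤ 1 := Real.exp_le_one_iff.2 (by nlinarith)
  nlinarith

/-- The absolute value turns the one-sided limit at `0` into a two-sided one, so increments of
either sign can be inserted. -/
theorem IsC0Semigroup.tendsto_abs (hS : IsC0Semigroup S) (x : X) :
    Tendsto (fun r : ℝ => S |r| x) (𝓝 0) (𝓝 x) := by
  have h0 : S 0 x = x := by rw [hS.zero]; rfl
  have h1 : ContinuousWithinAt (fun t => S t x) (Ici 0) 0 := by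
    rw [← continuousWithinAt_Ioi_iff_Ici, ContinuousWithinAt, h0]
    exact hS.tendsto x
  rw [ContinuousWithinAt, h0] at h1
  refine h1.comp (tendsto_nhdsWithin_iff.2 ⟨?_, Eventually.of_forall fun r => abs_nonneg r⟩)
  simpa using (continuous_abs.tendsto (0 : ℝ))

theorem IsC0Semigroup.norm_sub_le (hS : IsC0Semigroup S) (hμ : 0 < μ)
    (hb : ∀ t, 0 ≤ t → ‖S t‖ ≤ C * Real.exp (-μ * t)) {s t : ℝ} (hs : 0 ≤ s) (ht : 0 ≤ t) (x : X) :
    ‖S s x - S t x‖ ≤ C * ‖S |s - t| x - x‖ := by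
  wlog hst : s ≤ t generalizing s t
  · rw [norm_sub_rev, abs_sub_comm]
    exact this ht hs (le_of_not_ge hst)
  have h := hS.add s (t - s) hs (by linarith)
  rw [add_sub_cancel] at h
  rw [norm_sub_rev, abs_of_nonpos (by linarith), neg_sub, h, ContinuousLinearMap.comp_apply,
    ← map_sub]
  exact norm_semigroup_apply_le hμ hb hs _

theorem IsC0Semigroup.continuousOn_apply (hS : IsC0Semigroup S) (hμ : 0 < μ)
    (hb : ∀ t, 0 ≤ t → ‖S t‖ ≤ C * Real.exp (-μ * t)) {k : ℝ → X} (hk : Continuous k) :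
    ContinuousOn (fun s => S s (k s)) (Ici 0) := by
  intro t ht
  have h1 : Tendsto (fun s => C * ‖k s - k t‖ + C * ‖S |s - t| (k t) - k t‖) (𝓝 t) (𝓝 0) := by
    have e1 : Tendsto (fun s => C * ‖k s - k t‖) (𝓝 t) (𝓝 0) := by
      have : Continuous fun s => C * ‖k s - k t‖ := by fun_prop
      simpa using this.tendsto t
    have e2 : Tendsto (fun s : ℝ => s - t) (𝓝 t) (𝓝 0) := by
      have : Continuous fun s : ℝ => s - t := by fun_prop
      simpa using this.tendsto t
    have e3 := (((hS.tendsto_abs (k t)).comp e2).sub_const (k t)).norm.const_mul C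
    simpa using e1.add e3
  rw [ContinuousWithinAt, tendsto_iff_norm_sub_tendsto_zero]
  refine squeeze_zero' (Eventually.of_forall fun _ => norm_nonneg _) ?_
    (h1.mono_left nhdsWithin_le_nhds)
  filter_upwards [self_mem_nhdsWithin] with s hs
  calc ‖S s (k s) - S t (k t)‖ = ‖S s (k s - k t) + (S s (k t) - S t (k t))‖ := by
        rw [map_sub]; congr 1; abel
    _ ≤ _ := (norm_add_le _ _).trans
        (add_le_add (norm_semigroup_apply_le hμ hb hs _) (hS.norm_sub_le hμ hb hs ht _))

/-- `t ↦ ∫₀^∞ S(s) h(t - s) ds`. -/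
def mild (S : ℝ → X →L[ℝ] X) (h : ℝ → X) (t : ℝ) : X := ∫ s in Ioi (0 : ℝ), S s (h (t - s))

theorem integrableOn_exp_bound (hμ : 0 < μ) (c : ℝ) :
    IntegrableOn (fun s => c * Real.exp (-μ * s)) (Ioi 0) :=
  (integrableOn_exp_mul_Ioi (by linarith) 0).const_mul c

theorem aestronglyMeasurable_mild (hS : IsC0Semigroup S) (hμ : 0 < μ)
    (hb : ∀ t, 0 ≤ t → ‖S t‖ ≤ C * Real.exp (-μ * t)) {h : ℝ → X} (hh : Continuous h) (t : ℝ) :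
    AEStronglyMeasurable (fun s => S s (h (t - s))) (volume.restrict (Ioi (0 : ℝ))) :=
  ((hS.continuousOn_apply hμ hb (k := fun s => h (t - s)) (by fun_prop)).mono
    Ioi_subset_Ici_self).aestronglyMeasurable measurableSet_Ioi

theorem norm_mild_integrand_le (hb : ∀ t, 0 ≤ t → ‖S t‖ ≤ C * Real.exp (-μ * t)) {h : ℝ → X}
    {D : ℝ} (hD : ∀ t, ‖h t‖ ≤ D) {s : ℝ} (hs : 0 ≤ s) (t : ℝ) :
    ‖S s (h (t - s))‖ ≤ C * D * Real.exp (-μ * s) := by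
  refine ((S s).le_of_opNorm_le (hb s hs) _).trans ?_
  have h1 : 0 ≤ C * Real.exp (-μ * s) := (norm_nonneg _).trans (hb s hs)
  nlinarith [mul_le_mul_of_nonneg_left (hD (t - s)) h1]

theorem integrableOn_mild (hS : IsC0Semigroup S) (hμ : 0 < μ)
    (hb : ∀ t, 0 ≤ t → ‖S t‖ ≤ C * Real.exp (-μ * t)) {h : ℝ → X} (hh : Continuous h)
    {D : ℝ} (hD : ∀ t, ‖h t‖ ≤ D) (t : ℝ) :
    IntegrableOn (fun s => S s (h (t - s))) (Ioi 0) := by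
  refine (integrableOn_exp_bound hμ (C * D)).mono' (aestronglyMeasurable_mild hS hμ hb hh t) ?_
  filter_upwards [ae_restrict_mem measurableSet_Ioi] with s hs
  exact norm_mild_integrand_le hb hD (le_of_lt hs) t

theorem continuous_mild (hS : IsC0Semigroup S) (hμ : 0 < μ)
    (hb : ∀ t, 0 ≤ t → ‖S t‖ ≤ C * Real.exp (-μ * t)) {h : ℝ → X} (hh : Continuous h)
    {D : ℝ} (hD : ∀ t, ‖h t‖ ≤ D) : Continuous (mild S h) := by
  refine continuous_of_dominated (fun t => aestronglyMeasurable_mild hS hμ hb hh t)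
    (fun t => ?_) (integrableOn_exp_bound hμ (C * D)) (ae_of_all _ fun s => by fun_prop)
  filter_upwards [ae_restrict_mem measurableSet_Ioi] with s hs
  exact norm_mild_integrand_le hb hD (le_of_lt hs) t

/-- In `∫₀^∞ S(s) h(t - s) ds` the time `t` enters only through `h`: the derivative falls on `h` and
no boundary term appears. -/
theorem hasDerivAt_mild [CompleteSpace X] (hS : IsC0Semigroup S) (hμ : 0 < μ)
    (hb : ∀ t, 0 ≤ t → ‖S t‖ ≤ C * Real.exp (-μ * t)) {h : ℝ → X} (hh : ContDiff ℝ 1 h)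
    {D D' : ℝ} (hD : ∀ t, ‖h t‖ ≤ D) (hD' : ∀ t, ‖deriv h t‖ ≤ D') (t : ℝ) :
    HasDerivAt (mild S h) (mild S (deriv h) t) t := by
  refine (hasDerivAt_integral_of_dominated_loc_of_deriv_le (s := univ)
    (F' := fun t s => S s (deriv h (t - s)))
    (bound := fun s => C * D' * Real.exp (-μ * s)) univ_mem
    (Eventually.of_forall fun t => aestronglyMeasurable_mild hS hμ hb hh.continuous t)
    (integrableOn_mild hS hμ hb hh.continuous hD t)
    (aestronglyMeasurable_mild hS hμ hb (hh.continuous_deriv le_rfl) t) ?_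
    (integrableOn_exp_bound hμ (C * D')) ?_).2
  · filter_upwards [ae_restrict_mem measurableSet_Ioi] with s hs r _
    exact norm_mild_integrand_le hb hD' (le_of_lt hs) r
  · refine ae_of_all _ fun s r _ => ?_
    have h1 : HasDerivAt (fun r => h (r - s)) (deriv h (r - s)) r :=
      ((hh.differentiable one_ne_zero (r - s)).hasDerivAt).comp_sub_const r s
    exact (S s).hasFDerivAt.comp_hasDerivAt r h1

/-- By the semigroup law, `S(τ)` shifts the variable of integration by `τ`; what is missing from the
integral at time `t + τ` is the piece over `(0, τ)`. -/
theorem semigroup_apply_mild [CompleteSpace X] (hS : IsC0Semigroup S) (hμ : 0 < μ)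
    (hb : ∀ t, 0 ≤ t → ‖S t‖ ≤ C * Real.exp (-μ * t)) {h : ℝ → X} (hh : Continuous h)
    {D : ℝ} (hD : ∀ t, ‖h t‖ ≤ D) (t : ℝ) {τ : ℝ} (hτ : 0 ≤ τ) :
    S τ (mild S h t) = mild S h (t + τ) - ∫ s in (0 : ℝ)..τ, S s (h (t + τ - s)) := by
  have hint := integrableOn_mild hS hμ hb hh hD (t + τ)
  have h1 : S τ (mild S h t) = ∫ s in Ioi (0 : ℝ), S (s + τ) (h (t + τ - (s + τ))) := by
    rw [mild, ← ContinuousLinearMap.integral_comp_comm _ (integrableOn_mild hS hμ hb hh hD t)]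
    refine setIntegral_congr_fun measurableSet_Ioi fun s hs => ?_
    have h2 := hS.add τ s hτ (le_of_lt hs)
    have h3 : t + τ - (s + τ) = t - s := by ring
    rw [h3, add_comm s τ, h2]
    rfl
  have h2 : ∫ s in Ioi (0 : ℝ), S (s + τ) (h (t + τ - (s + τ))) =
      ∫ s in Ioi τ, S s (h (t + τ - s)) := by
    have := (measurePreserving_add_right volume τ).setIntegral_preimage_emb
      (measurableEmbedding_addRight τ) (fun s => S s (h (t + τ - s))) (Ioi τ)
    rwa [preimage_add_const_Ioi, sub_self] at this
  have h3 := intervalIntegral.integral_interval_add_Ioi hint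
    (hint.mono_set (Ioi_subset_Ioi hτ))
  rw [h1, h2, mild, ← h3]
  abel

theorem tendsto_average_semigroup [CompleteSpace X] (hS : IsC0Semigroup S) (hμ : 0 < μ)
    (hb : ∀ t, 0 ≤ t → ‖S t‖ ≤ C * Real.exp (-μ * t)) {h : ℝ → X} (hh : Continuous h) (t : ℝ) :
    Tendsto (fun τ : ℝ => τ⁻¹ • ∫ s in (0 : ℝ)..τ, S s (h (t + τ - s))) (𝓝[>] 0) (𝓝 (h t)) := by
  have hC : 0 ≤ C := by simpa using (norm_nonneg _).trans (hb 0 le_rfl)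
  rw [Metric.tendsto_nhds]
  intro ε hε
  have e1 : Tendsto (fun r : ℝ => C * ‖h (t + r) - h t‖) (𝓝 0) (𝓝 0) := by
    have : Continuous fun r => C * ‖h (t + r) - h t‖ := by fun_prop
    simpa using this.tendsto 0
  have e2 : Tendsto (fun r : ℝ => ‖S |r| (h t) - h t‖) (𝓝 0) (𝓝 0) := by
    simpa using ((hS.tendsto_abs (h t)).sub_const (h t)).norm
  obtain ⟨δ, hδ, hball⟩ := Metric.eventually_nhds_iff.1
    ((e1.eventually_lt_const (show 0 < ε / 4 by linarith)).and
      (e2.eventually_lt_const (show 0 < ε / 4 by linarith)))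
  filter_upwards [Ioo_mem_nhdsGT hδ] with τ hτ
  have hτ0 : (0 : ℝ) < τ := hτ.1
  have hI : IntervalIntegrable (fun s => S s (h (t + τ - s))) volume 0 τ :=
    ((hS.continuousOn_apply hμ hb (k := fun s => h (t + τ - s)) (by fun_prop)).mono fun s hs => by
      rw [uIcc_of_le hτ0.le] at hs; exact hs.1).intervalIntegrable
  have e3 : τ⁻¹ • (∫ s in (0 : ℝ)..τ, S s (h (t + τ - s))) - h t =
      τ⁻¹ • ∫ s in (0 : ℝ)..τ, (S s (h (t + τ - s)) - h t) := by
    rw [intervalIntegral.integral_sub hI intervalIntegrable_const, intervalIntegral.integral_const,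
      smul_sub, sub_zero, smul_smul, inv_mul_cancel₀ hτ0.ne', one_smul]
  have e4 : ‖∫ s in (0 : ℝ)..τ, (S s (h (t + τ - s)) - h t)‖ ≤ ε / 2 * |τ - 0| := by
    refine intervalIntegral.norm_integral_le_of_norm_le_const fun s hs => ?_
    rw [uIoc_of_le hτ0.le] at hs
    have b1 := (hball (y := τ - s) (by
      rw [Real.dist_eq, sub_zero, abs_of_nonneg (by linarith [hs.2])]
      linarith [hs.1, hτ.2])).1
    have b2 := (hball (y := s) (by
      rw [Real.dist_eq, sub_zero, abs_of_nonneg hs.1.le]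
      linarith [hs.2, hτ.2])).2
    rw [abs_of_nonneg hs.1.le] at b2
    have b3 := norm_semigroup_apply_le hμ hb hs.1.le (h (t + τ - s) - h t)
    rw [map_sub] at b3
    have e5 : t + (τ - s) = t + τ - s := by ring
    rw [e5] at b1
    calc ‖S s (h (t + τ - s)) - h t‖
        = ‖(S s (h (t + τ - s)) - S s (h t)) + (S s (h t) - h t)‖ := by congr 1; abel
      _ ≤ _ := (norm_add_le _ _).trans (by linarith)
  rw [dist_eq_norm, e3, norm_smul, Real.norm_eq_abs, abs_inv, abs_of_pos hτ0]
  rw [sub_zero, abs_of_pos hτ0] at e4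
  calc τ⁻¹ * _ ≤ τ⁻¹ * (ε / 2 * τ) := by gcongr
    _ = ε / 2 := by field_simp
    _ < ε := by linarith

/-- The generator's difference quotient is the time difference quotient of the mild solution minus
the mean of `S(s) h(t + τ - s)` over `(0, τ)`, which tends to `h(t)`. So for `C¹` data the mild
solution lies in the domain of the generator and solves the equation strongly. -/
theorem tendsto_generator_mild [CompleteSpace X] (hS : IsC0Semigroup S) (hμ : 0 < μ)
    (hb : ∀ t, 0 ≤ t → ‖S t‖ ≤ C * Real.exp (-μ * t)) {h : ℝ → X} (hh : ContDiff ℝ 1 h)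
    {D D' : ℝ} (hD : ∀ t, ‖h t‖ ≤ D) (hD' : ∀ t, ‖deriv h t‖ ≤ D') (t : ℝ) :
    Tendsto (fun τ : ℝ => τ⁻¹ • (S τ (mild S h t) - mild S h t)) (𝓝[>] 0)
      (𝓝 (mild S (deriv h) t - h t)) := by
  have h1 := (hasDerivAt_mild hS hμ hb hh hD hD' t).tendsto_slope_zero_right
  refine (h1.sub (tendsto_average_semigroup hS hμ hb hh.continuous t)).congr' ?_
  filter_upwards [self_mem_nhdsWithin] with τ hτ
  rw [semigroup_apply_mild hS hμ hb hh.continuous hD t (le_of_lt hτ), ← smul_sub]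
  congr 1
  abel

/-- Young's inequality with the kernel `C exp(-μ s)`, integrable by exponential stability. The
constant involves no derivative of `h`, so it survives the passage from smooth to general data. -/
theorem exists_eLpNorm_mild_le (hμ : 0 < μ) (hb : ∀ t, 0 ≤ t → ‖S t‖ ≤ C * Real.exp (-μ * t)) :
    ∃ K : NNReal, ∀ h : ℝ → X, Continuous h → eLpNorm (mild S h) 2 volume ≤ K * eLpNorm h 2 volume := by
  set k := fun s => C * Real.exp (-μ * s)
  have hfin : ∫⁻ s in Ioi (0 : ℝ), ENNReal.ofReal (k s) ≠ ⊤ :=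
    (integrableOn_exp_bound hμ C).lintegral_lt_top.ne
  refine ⟨(∫⁻ s in Ioi (0 : ℝ), ENNReal.ofReal (k s)).toNNReal, fun h hh => ?_⟩
  rw [ENNReal.coe_toNNReal hfin, ← ENNReal.pow_le_pow_left_iff two_ne_zero, mul_pow,
    eLpNorm_two_sq volume (mild S h)]
  refine lintegral_sq_integral_le (k := k) (by fun_prop) (fun t s => h (t - s)) ?_ _
    (ae_of_all _ fun t => ?_) (ae_of_all _ fun s _ => ?_)
  · exact (hh.comp (by fun_prop : Continuous fun p : ℝ × ℝ => p.1 - p.2)).aestronglyMeasurable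
  · refine (enorm_integral_le_lintegral_enorm _).trans
      (setLIntegral_mono_ae' measurableSet_Ioi (ae_of_all _ fun s hs => ?_))
    rw [← ofReal_norm, ← ofReal_norm, ← ENNReal.ofReal_mul ((norm_nonneg _).trans (hb s (le_of_lt hs)))]
    exact ENNReal.ofReal_le_ofReal ((S s).le_of_opNorm_le (hb s (le_of_lt hs)) _)
  · rw [eLpNorm_two_sq]
    exact (lintegral_sub_right_eq_self (fun t => ‖h t‖ₑ ^ 2) s).le

end Mild

end

section

/-! ### The closed-loop linear problem -/

variable {d : ℕ} {Ω : Set (EuclideanSpace ℝ (Fin d))}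

/-- `𝒜 - T` as an operator `V → V*`, for a bounded operator `T` on `Y`. -/
def perturb (𝒜 : V Ω →L[ℝ] VDual Ω) (T : Y Ω →L[ℝ] Y Ω) : V Ω →L[ℝ] VDual Ω :=
  𝒜 - (pivot Ω).comp (T.comp (incl Ω))

theorem perturb_apply (𝒜 : V Ω →L[ℝ] VDual Ω) (T : Y Ω →L[ℝ] Y Ω) (v : V Ω) :
    perturb 𝒜 T v = 𝒜 v - pivot Ω (T (incl Ω v)) := rfl

/-- Embedding of `L²(I; Y)` into `L²(I; V*)`. -/
def pivotL2 (Ω : Set (EuclideanSpace ℝ (Fin d))) :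
    Lp (Y Ω) 2 (volume.restrict (Ioi (0 : ℝ))) →L[ℝ] L2VDual Ω :=
  (pivot Ω).compLpL 2 (volume.restrict (Ioi 0))

/-- Embedding of `L²(I; V)` into `L²(I; Y)`, on `W_∞`. -/
def inclL2 (Ω : Set (EuclideanSpace ℝ (Fin d))) :
    WInf Ω →L[ℝ] Lp (Y Ω) 2 (volume.restrict (Ioi (0 : ℝ))) :=
  ((incl Ω).compLpL 2 (volume.restrict (Ioi 0))).comp (W.stateL Ω (Ioi 0))

theorem coeFn_pivotL2 (h : Lp (Y Ω) 2 (volume.restrict (Ioi (0 : ℝ)))) :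
    pivotL2 Ω h =ᵐ[volume.restrict (Ioi 0)] fun t => pivot Ω (h t) :=
  (pivot Ω).coeFn_compLpL h

theorem coeFn_inclL2 (y : WInf Ω) :
    inclL2 Ω y =ᵐ[volume.restrict (Ioi 0)] fun t => incl Ω (W.state y t) :=
  (incl Ω).coeFn_compLpL (p := 2) (W.state y)

theorem norm_pivotL2_le (h : Lp (Y Ω) 2 (volume.restrict (Ioi (0 : ℝ)))) :
    ‖pivotL2 Ω h‖ ≤ ‖h‖ := by
  refine Lp.norm_le_norm_of_ae_le ?_
  filter_upwards [coeFn_pivotL2 h] with t ht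
  rw [ht]
  exact norm_pivot_apply_le _

theorem evolution_perturb (𝒜 : V Ω →L[ℝ] VDual Ω) (T : Y Ω →L[ℝ] Y Ω) (y : WInf Ω) :
    evolution (perturb 𝒜 T) y = evolution 𝒜 y +
      pivotL2 Ω (T.compLpL 2 (volume.restrict (Ioi 0)) (inclL2 Ω y)) := by
  refine Lp.ext ?_
  filter_upwards [coeFn_evolution (perturb 𝒜 T) y, coeFn_evolution 𝒜 y,
    Lp.coeFn_add (evolution 𝒜 y) (pivotL2 Ω (T.compLpL 2 (volume.restrict (Ioi 0)) (inclL2 Ω y))),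
    coeFn_pivotL2 (T.compLpL 2 (volume.restrict (Ioi 0)) (inclL2 Ω y)),
    T.coeFn_compLpL (p := 2) (inclL2 Ω y), coeFn_inclL2 y] with t h1 h2 h3 h4 h5 h6
  rw [h3, Pi.add_apply, h1, h2, h4, h5, h6, perturb_apply]
  abel

theorem Garding.perturb_coercive {𝒜 : V Ω →L[ℝ] VDual Ω} {ρ θ : ℝ}
    (hg : ∀ v : V Ω, θ * ‖v‖ ^ 2 ≤ ρ * ‖incl Ω v‖ ^ 2 - 𝒜 v v) (v : V Ω) :
    θ * ‖v‖ ^ 2 ≤ -perturb 𝒜 (ρ • ContinuousLinearMap.id ℝ (Y Ω)) v v := by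
  have h : perturb 𝒜 (ρ • ContinuousLinearMap.id ℝ (Y Ω)) v v = 𝒜 v v - ρ * ‖incl Ω v‖ ^ 2 := by
    rw [perturb_apply, sub_apply, pivot_apply]
    simp [inner_smul_left]
  rw [h]
  linarith [hg v]

/-- When `𝒜 v` lies in `Y`, Gårding's inequality bounds `θ ‖v‖²_V` by the `Y` norms of `v` and `𝒜
v`. Applied to increments, this upgrades continuity from `Y` to `V`. -/
theorem continuous_of_garding {𝒜 : V Ω →L[ℝ] VDual Ω} {ρ θ : ℝ} (hθ : 0 < θ)
    (hg : ∀ v : V Ω, θ * ‖v‖ ^ 2 ≤ ρ * ‖incl Ω v‖ ^ 2 - 𝒜 v v) {v : ℝ → V Ω} {q w : ℝ → Y Ω}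
    (hw : Continuous w) (hq : Continuous q) (hvw : ∀ t, incl Ω (v t) = w t)
    (hvq : ∀ t, 𝒜 (v t) = pivot Ω (q t)) : Continuous v := by
  rw [continuous_iff_continuousAt]
  intro t
  rw [ContinuousAt, tendsto_iff_norm_sub_tendsto_zero]
  have h1 : ∀ s, ‖v s - v t‖ ^ 2 ≤
      (ρ * ‖w s - w t‖ ^ 2 - inner ℝ (q s - q t) (w s - w t)) / θ := fun s => by
    rw [le_div_iff₀ hθ]
    have h := hg (v s - v t)
    rw [map_sub (incl Ω), map_sub 𝒜, hvw, hvw, hvq, hvq, ← map_sub, pivot_apply, map_sub, hvw,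
      hvw] at h
    linarith
  have h2 : Tendsto (fun s => √((ρ * ‖w s - w t‖ ^ 2 - inner ℝ (q s - q t) (w s - w t)) / θ))
      (𝓝 t) (𝓝 0) := by
    have : Continuous fun s =>
        √((ρ * ‖w s - w t‖ ^ 2 - inner ℝ (q s - q t) (w s - w t)) / θ) := by fun_prop
    simpa using this.tendsto t
  exact squeeze_zero (fun _ => norm_nonneg _) (fun s => Real.le_sqrt_of_sq_le (h1 s)) h2

/-- The same inequality without increments: `θ ‖v‖² ≤ ρ ‖w‖² + ‖q‖ ‖w‖ ≤ (ρ + 1)(‖w‖ + ‖q‖)²`. -/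
theorem memLp_of_garding {𝒜 : V Ω →L[ℝ] VDual Ω} {ρ θ : ℝ} (hρ : 0 ≤ ρ) (hθ : 0 < θ)
    (hg : ∀ v : V Ω, θ * ‖v‖ ^ 2 ≤ ρ * ‖incl Ω v‖ ^ 2 - 𝒜 v v) {μ : Measure ℝ} {v : ℝ → V Ω}
    {q w : ℝ → Y Ω} (hv : Continuous v) (hw : MemLp w 2 μ) (hq : MemLp q 2 μ)
    (hvw : ∀ t, incl Ω (v t) = w t) (hvq : ∀ t, 𝒜 (v t) = pivot Ω (q t)) : MemLp v 2 μ := by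
  refine MemLp.of_le_mul (c := √((ρ + 1) / θ)) (hw.norm.add hq.norm) hv.aestronglyMeasurable
    (ae_of_all _ fun t => ?_)
  have h := hg (v t)
  rw [hvw, hvq, pivot_apply, hvw] at h
  have h2 := neg_le_of_abs_le (abs_real_inner_le_norm (q t) (w t))
  have e : ‖((fun t => ‖w t‖) + fun t => ‖q t‖) t‖ = ‖w t‖ + ‖q t‖ :=
    Real.norm_of_nonneg (by simp only [Pi.add_apply]; positivity)
  rw [e]
  refine le_of_sq_le_sq ?_ (by positivity)
  rw [mul_pow, Real.sq_sqrt (by positivity), div_mul_eq_mul_div, le_div_iff₀ hθ]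
  have h3 := norm_nonneg (w t)
  have h4 := norm_nonneg (q t)
  nlinarith [mul_nonneg hρ h3, mul_nonneg hρ h4, mul_nonneg h3 h4, mul_nonneg (mul_nonneg hρ h3) h4,
    mul_nonneg (mul_nonneg hρ h4) h4]

theorem weakDeriv_pivot {w : ℝ → Y Ω} {w' : ℝ → Y Ω} (hw : ∀ t, HasDerivAt w (w' t) t)
    (hw' : Continuous w') {φ : ℝ → ℝ} (hφ : IsTest (Ioi 0) φ) :
    ∫ t in Ioi 0, deriv φ t • pivot Ω (w t) = -∫ t in Ioi 0, φ t • pivot Ω (w' t) := by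
  have hφ1 : ContDiff ℝ 1 φ := hφ.1.of_le (by norm_cast)
  have hwc : Continuous w := continuous_iff_continuousAt.2 fun t => (hw t).continuousAt
  have hp : ∀ t, HasDerivAt (fun t => pivot Ω (w t)) (pivot Ω (w' t)) t := fun t =>
    (pivot Ω).hasFDerivAt.comp_hasDerivAt t (hw t)
  have hd : ∀ t, HasDerivAt (fun t => φ t • pivot Ω (w t))
      (φ t • pivot Ω (w' t) + deriv φ t • pivot Ω (w t)) t := fun t =>
    (hφ1.differentiable one_ne_zero t).hasDerivAt.smul (hp t)
  have hc1 : Continuous fun t => φ t • pivot Ω (w' t) :=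
    hφ1.continuous.smul ((pivot Ω).continuous.comp hw')
  have hc2 : Continuous fun t => deriv φ t • pivot Ω (w t) :=
    (hφ1.continuous_deriv le_rfl).smul ((pivot Ω).continuous.comp hwc)
  have hC : ContDiff ℝ 1 fun t => φ t • pivot Ω (w t) := by
    rw [contDiff_one_iff_deriv]
    refine ⟨fun t => (hd t).differentiableAt, ?_⟩
    rw [funext fun t => (hd t).deriv]
    exact hc1.add hc2
  have h := (hφ.2.1.smul_right (f' := fun t => pivot Ω (w t))).integral_Ioi_deriv_eq hC 0
  have i1 : Integrable (fun t => φ t • pivot Ω (w' t)) (volume.restrict (Ioi (0 : ℝ))) :=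
    (hc1.integrable_of_hasCompactSupport hφ.2.1.smul_right).integrableOn
  have i2 : Integrable (fun t => deriv φ t • pivot Ω (w t)) (volume.restrict (Ioi (0 : ℝ))) :=
    (hc2.integrable_of_hasCompactSupport hφ.2.1.deriv.smul_right).integrableOn
  simp only [fun t => (hd t).deriv, hφ.apply_zero, zero_smul, neg_zero] at h
  rw [integral_add i1 i2] at h
  exact eq_neg_of_add_eq_zero_right h

/-- Solvability of `z_t = (𝒜 - T) z + h`, `z(0) = 0`, for smooth `h`, when `A - T` generates an
exponentially stable semigroup. -/
theorem exists_evolution_eq_of_smooth {A : Y Ω →ₗ.[ℝ] Y Ω} {𝒜 : V Ω →L[ℝ] VDual Ω}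
    (hext : IsExtension A 𝒜) {ρ θ : ℝ} (hρ : 0 ≤ ρ) (hθ : 0 < θ)
    (hg : ∀ v : V Ω, θ * ‖v‖ ^ 2 ≤ ρ * ‖incl Ω v‖ ^ 2 - 𝒜 v v) {T : Y Ω →L[ℝ] Y Ω}
    {S : ℝ → Y Ω →L[ℝ] Y Ω} (hS : IsC0Semigroup S)
    (hgen : IsGenerator ((-T : Y Ω →L[ℝ] Y Ω).toLinearMap +ᵥ A) S) {C μ : ℝ} (hμ : 0 < μ)
    (hb : ∀ t, 0 ≤ t → ‖S t‖ ≤ C * Real.exp (-μ * t)) {K : NNReal}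
    (hK : ∀ h : ℝ → Y Ω, Continuous h → eLpNorm (mild S h) 2 volume ≤ K * eLpNorm h 2 volume)
    {h : ℝ → Y Ω} (hh : ContDiff ℝ 1 h) (hc : HasCompactSupport h) (hs : tsupport h ⊆ Ioi 0)
    (mh : MemLp h 2 (volume.restrict (Ioi (0 : ℝ)))) :
    ∃ z : WInf Ω, evolution (perturb 𝒜 T) z = pivotL2 Ω (mh.toLp h) ∧ trace Ω z = 0 ∧
      ‖inclL2 Ω z‖ ≤ K * ‖mh.toLp h‖ := by
  have hh' := hh.continuous_deriv le_rfl
  obtain ⟨D, hD⟩ := hh.continuous.bounded_above_of_compact_support hc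
  obtain ⟨D', hD'⟩ := hh'.bounded_above_of_compact_support hc.deriv
  set w := mild S h with hw_def
  set w' := mild S (deriv h) with hw'_def
  have hwc : Continuous w := continuous_mild hS hμ hb hh.continuous hD
  have hwc' : Continuous w' := continuous_mild hS hμ hb hh' hD'
  have mw : MemLp w 2 volume := ⟨hwc.aestronglyMeasurable, (hK h hh.continuous).trans_lt
    (ENNReal.mul_lt_top ENNReal.coe_lt_top (hh.continuous.memLp_of_hasCompactSupport hc).2)⟩
  have mw' : MemLp w' 2 volume := ⟨hwc'.aestronglyMeasurable, (hK _ hh').trans_lt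
    (ENNReal.mul_lt_top ENNReal.coe_lt_top (hh'.memLp_of_hasCompactSupport hc.deriv).2)⟩
  -- The value of `A w(t)`, read off from the strong equation `(A - T) w = w' - h`.
  set q : ℝ → Y Ω := fun t => w' t - h t + T (w t)
  have hv : ∀ t, ∃ v : V Ω, incl Ω v = w t ∧ 𝒜 v = pivot Ω (q t) := fun t => by
    have h1 := (hgen _ _).1 (tendsto_generator_mild hS hμ hb hh hD hD' t)
    obtain ⟨⟨x, hx⟩, hx1, hx2⟩ := (LinearPMap.mem_graph_iff _).1 h1
    obtain ⟨v, hv1, hv2⟩ := hext ⟨x, hx⟩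
    refine ⟨v, hv1.trans hx1, hv2.trans (congr_arg _ ?_)⟩
    have h2 : A ⟨x, hx⟩ + -T x = w' t - h t := by
      rw [add_comm]; exact hx2
    have h3 : x = w t := hx1
    change _ = w' t - h t + T (w t)
    rw [← h2, ← h3]
    abel
  choose v hv1 hv2 using hv
  have hvc := continuous_of_garding hθ hg hwc ((hwc'.sub hh.continuous).add (T.continuous.comp hwc))
    hv1 hv2
  have mq : MemLp q 2 (volume.restrict (Ioi (0 : ℝ))) :=
    ((mw'.restrict _).sub mh).add (T.comp_memLp' (mw.restrict _))
  have mv := memLp_of_garding hρ hθ hg hvc (mw.restrict (Ioi (0 : ℝ))) mq hv1 hv2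
  obtain ⟨z, hz1, hz2⟩ := W.exists_of_memLp mv ((pivot Ω).comp_memLp' (mw'.restrict (Ioi 0)))
    fun φ hφ => by
      have := weakDeriv_pivot (hasDerivAt_mild hS hμ hb hh hD hD') hwc' hφ
      simp only [← hw_def, ← hw'_def, ← hv1] at this
      exact this
  have ez1 : W.state z =ᵐ[volume.restrict (Ioi 0)] v := by rw [hz1]; exact mv.coeFn_toLp
  have ez2 : W.timeDeriv z =ᵐ[volume.restrict (Ioi 0)] fun t => pivot Ω (w' t) := by
    rw [hz2]; exact MemLp.coeFn_toLp _
  refine ⟨z, Lp.ext ?_, ?_, ?_⟩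
  · filter_upwards [coeFn_evolution (perturb 𝒜 T) z, ez1, ez2, coeFn_pivotL2 (mh.toLp h),
      mh.coeFn_toLp] with t h1 h2 h3 h4 h5
    rw [h1, h2, h3, h4, h5, perturb_apply, hv1, hv2, ← map_sub, ← map_sub]
    congr 1
    simp only [q]
    abel
  -- At time `0` the integral only involves `h` at negative times, where it vanishes.
  · have h0 : w 0 = 0 := by
      rw [hw_def, mild]
      refine (setIntegral_congr_fun measurableSet_Ioi fun s hs' => ?_).trans
        (integral_zero _ _)
      have : h (0 - s) = 0 := by
        by_contra hne
        have h1 := mem_Ioi.1 (hs (subset_tsupport _ hne))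
        have h2 := mem_Ioi.1 hs'
        linarith
      simp only [this, map_zero]
    rw [trace_apply, W.rep_unique z hwc.continuousOn _ (mem_Ici.2 le_rfl), h0]
    filter_upwards [ez1] with t ht
    rw [ht, hv1]
  · rw [Lp.norm_def, Lp.norm_toLp]
    have e1 : eLpNorm (inclL2 Ω z) 2 (volume.restrict (Ioi 0)) ≤ eLpNorm w 2 volume := by
      refine le_trans (eLpNorm_congr_ae ?_).le (eLpNorm_mono_measure _ Measure.restrict_le_self)
      filter_upwards [coeFn_inclL2 z, ez1] with t h1 h2
      rw [h1, h2, hv1]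
    have e2 : eLpNorm h 2 volume = eLpNorm h 2 (volume.restrict (Ioi 0)) := by
      rw [← eLpNorm_indicator_eq_eLpNorm_restrict measurableSet_Ioi]
      congr 1
      refine (indicator_eq_self.2 ?_).symm
      exact (subset_tsupport h).trans hs
    have e3 := e1.trans (hK h hh.continuous)
    rw [e2] at e3
    have e4 := ENNReal.toReal_mono (ENNReal.mul_ne_top ENNReal.coe_ne_top mh.2.ne) e3
    rwa [ENNReal.toReal_mul, ENNReal.coe_toReal] at e4

end

section

theorem dense_smooth_L2 (E : Type*) [NormedAddCommGroup E] [InnerProductSpace ℝ E]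
    [CompleteSpace E] : ∃ D : Submodule ℝ (Lp E 2 (volume.restrict (Ioi (0 : ℝ)))),
    D.topologicalClosure = ⊤ ∧ ∀ g ∈ D, ∃ (h : ℝ → E)
      (mh : MemLp h 2 (volume.restrict (Ioi (0 : ℝ)))), ContDiff ℝ 1 h ∧ HasCompactSupport h ∧
        tsupport h ⊆ Ioi 0 ∧ mh.toLp h = g := by
  let D : Submodule ℝ (Lp E 2 (volume.restrict (Ioi (0 : ℝ)))) :=
    { carrier := {g | ∃ (h : ℝ → E) (mh : MemLp h 2 (volume.restrict (Ioi (0 : ℝ)))),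
        ContDiff ℝ 1 h ∧ HasCompactSupport h ∧ tsupport h ⊆ Ioi 0 ∧ mh.toLp h = g}
      zero_mem' := ⟨0, MemLp.zero, contDiff_const, HasCompactSupport.zero, by simp [tsupport],
        MemLp.toLp_zero _⟩
      add_mem' := by
        rintro _ _ ⟨h, mh, h1, h2, h3, rfl⟩ ⟨k, mk, k1, k2, k3, rfl⟩
        exact ⟨h + k, mh.add mk, h1.add k1, h2.add k2,
          (tsupport_add h k).trans (union_subset h3 k3), MemLp.toLp_add mh mk⟩
      smul_mem' := by
        rintro c _ ⟨h, mh, h1, h2, h3, rfl⟩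
        exact ⟨c • h, mh.const_smul c, h1.const_smul c, h2.smul_left (f := fun _ => c),
          (closure_mono (Function.support_const_smul_subset c h)).trans h3,
          MemLp.toLp_const_smul c mh⟩ }
  refine ⟨D, ?_, fun g hg => hg⟩
  rw [Submodule.topologicalClosure_eq_top_iff, Submodule.eq_bot_iff]
  intro g hg
  have key : ∀ᵐ t ∂volume.restrict (Ioi (0 : ℝ)), t ∈ Ioi (0 : ℝ) → g t = 0 := by
    refine isOpen_Ioi.ae_eq_zero_of_integral_contDiff_smul_eq_zero
      (((Lp.memLp g).locallyIntegrable (by norm_num)).locallyIntegrableOn _) fun φ h1 h2 h3 => ?_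
    have i1 := integrable_smul_of_compact _ φ h1.continuous h2 _ (Lp.memLp g)
    refine ext_inner_left ℝ fun x => ?_
    have m : MemLp (fun t => φ t • x) 2 (volume.restrict (Ioi (0 : ℝ))) :=
      (h1.continuous.smul continuous_const).memLp_of_hasCompactSupport h2.smul_right
    have h4 : m.toLp _ ∈ D := ⟨_, m, (h1.of_le (by norm_cast)).smul contDiff_const, h2.smul_right,
      (closure_mono (Function.support_smul_subset_left φ _)).trans h3, rfl⟩
    have h5 := hg _ h4
    rw [L2.inner_def] at h5
    rw [inner_zero_right, ← integral_inner i1]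
    refine (integral_congr_ae ?_).trans h5
    filter_upwards [m.coeFn_toLp] with t ht
    rw [ht, inner_smul_left, inner_smul_right]; rfl
  refine Lp.ext ?_
  filter_upwards [key, ae_restrict_mem measurableSet_Ioi,
    Lp.coeFn_zero E 2 (volume.restrict (Ioi (0 : ℝ)))] with t h1 h2 h3
  rw [h1 h2, h3]; rfl

/-- Successive approximation: `y` is a series of elements of `D` with summable norms, the associated
solutions form a convergent series, and the closed relation `P` contains the sum. -/
theorem exists_mem_of_dense {E F : Type*} [NormedAddCommGroup E] [NormedSpace ℝ E]
    [CompleteSpace E] [NormedAddCommGroup F] [NormedSpace ℝ F] [CompleteSpace F]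
    {P : Submodule ℝ (E × F)} (hP : IsClosed (P : Set (E × F))) {D : Submodule ℝ F}
    (hD : D.topologicalClosure = ⊤) {C : ℝ} (hC : 0 ≤ C)
    (h : ∀ y ∈ D, ∃ x, (x, y) ∈ P ∧ ‖x‖ ≤ C * ‖y‖) (y : F) : ∃ x, (x, y) ∈ P := by
  have : CompleteSpace P := hP.completeSpace_coe
  let f : NormedAddGroupHom P F :=
    AddMonoidHom.mkNormedAddGroupHom
      { toFun := fun q => q.1.2, map_zero' := rfl, map_add' := fun _ _ => rfl } 1
      fun q => by rw [one_mul]; exact le_max_right _ _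
  -- The norm on `P` is the maximum of both components, so `C` is enlarged to `C + 1`.
  have hsurj : f.SurjectiveOnWith D.toAddSubgroup (C + 1) := by
    intro y hy
    obtain ⟨x, hx1, hx2⟩ := h y hy
    refine ⟨⟨(x, y), hx1⟩, rfl, max_le ?_ ?_⟩
    · exact hx2.trans (by nlinarith [norm_nonneg y])
    · change ‖y‖ ≤ _
      nlinarith [norm_nonneg y, mul_nonneg hC (norm_nonneg y)]
  obtain ⟨⟨⟨x, y'⟩, hx⟩, hxf, -⟩ := controlled_closure_of_complete (by positivity) one_pos hsurj y (by
    have : y ∈ D.topologicalClosure := by rw [hD]; trivial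
    exact this)
  have : y' = y := hxf
  exact ⟨x, this ▸ hx⟩

variable {d : ℕ} {Ω : Set (EuclideanSpace ℝ (Fin d))}

/-- Solvability of the stabilized problem `y_t = (𝒜 - BK) y + g`, `y(0) = x`. -/
theorem exists_evolution_eq_of_stabilizable (hΩ : IsOpen Ω) {A : Y Ω →ₗ.[ℝ] Y Ω}
    {𝒜 : V Ω →L[ℝ] VDual Ω} (hext : IsExtension A 𝒜) {ρ θ : ℝ} (hρ : 0 ≤ ρ) (hθ : 0 < θ)
    (hg : ∀ v : V Ω, θ * ‖v‖ ^ 2 ≤ ρ * ‖incl Ω v‖ ^ 2 - 𝒜 v v) {T : Y Ω →L[ℝ] Y Ω}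
    {S : ℝ → Y Ω →L[ℝ] Y Ω} (hS : IsC0Semigroup S)
    (hgen : IsGenerator ((-T : Y Ω →L[ℝ] Y Ω).toLinearMap +ᵥ A) S) (hst : IsExpStable S)
    (g : L2VDual Ω) (x : Y Ω) :
    ∃ y : WInf Ω, evolution (perturb 𝒜 T) y = g ∧ trace Ω y = x := by
  obtain ⟨C, μ, hμ, hb⟩ := hst
  obtain ⟨K, hK⟩ := exists_eLpNorm_mild_le hμ hb
  obtain ⟨D, hD, hDs⟩ := dense_smooth_L2 (Y Ω)
  let Tρ := ρ • ContinuousLinearMap.id ℝ (Y Ω)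
  let 𝒢 := perturb 𝒜 Tρ
  have h𝒢 := Garding.perturb_coercive hg
  obtain ⟨C₁, hC₁, hC₁y⟩ := exists_norm_le_evolution (𝒢 := 𝒢) hθ h𝒢
  -- The coercive and the closed-loop operators differ by a bounded operator on `Y`; switching from
  -- one to the other costs a source in `L²(I; Y)` only.
  let L : Y Ω →L[ℝ] Y Ω := Tρ - T
  let LL : Lp (Y Ω) 2 (volume.restrict (Ioi (0 : ℝ))) →L[ℝ] _ :=
    L.compLpL 2 (volume.restrict (Ioi 0))
  have hdiff : ∀ y : WInf Ω, evolution 𝒢 y = evolution (perturb 𝒜 T) y +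
      pivotL2 Ω (LL (inclL2 Ω y)) := fun y => by
    simp only [𝒢, evolution_perturb]
    rw [add_assoc, ← map_add]
    congr 2
    rw [← add_apply, ← ContinuousLinearMap.add_compLpL]
    congr 2
    exact (add_sub_cancel _ _).symm
  -- the graph of the solution relation for data in `L²(I; Y)`
  let P : Submodule ℝ (WInf Ω × Lp (Y Ω) 2 (volume.restrict (Ioi (0 : ℝ)))) :=
    (((evolution (perturb 𝒜 T)).comp (ContinuousLinearMap.fst ℝ _ _) -
      (pivotL2 Ω).comp (ContinuousLinearMap.snd ℝ _ _)).prod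
        ((trace Ω).comp (ContinuousLinearMap.fst ℝ _ _))).ker
  have hP : ∀ q, q ∈ P ↔ evolution (perturb 𝒜 T) q.1 = pivotL2 Ω q.2 ∧ trace Ω q.1 = 0 := by
    intro q
    simp [P, LinearMap.mem_ker, sub_eq_zero]
  -- The `W_∞` bound comes from the coercive estimate: `z` solves the coercive problem with source
  -- `h + L z`, and `z` is bounded by `K ‖h‖` in `L²(I; Y)`.
  have hsurj : ∀ h ∈ D, ∃ w, (w, h) ∈ P ∧ ‖w‖ ≤ C₁ * (1 + ‖LL‖ * K) * ‖h‖ := by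
    intro h hh
    obtain ⟨k, mk, k1, k2, k3, rfl⟩ := hDs h hh
    obtain ⟨z, hz1, hz2, hz3⟩ := exists_evolution_eq_of_smooth hext hρ hθ hg hS hgen hμ hb hK
      k1 k2 k3 mk
    refine ⟨z, (hP _).2 ⟨hz1, hz2⟩, ?_⟩
    have h1 := hC₁y z
    rw [hz2, norm_zero, add_zero, hdiff, hz1, ← map_add] at h1
    refine h1.trans ?_
    rw [mul_assoc]
    refine mul_le_mul_of_nonneg_left ((norm_pivotL2_le _).trans ((norm_add_le _ _).trans ?_))
      hC₁.le
    have h3 := LL.le_opNorm (inclL2 Ω z)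
    have h4 := mul_le_mul_of_nonneg_left hz3 (norm_nonneg LL)
    linarith
  obtain ⟨z, hz1, hz2⟩ := exists_evolution_eq_of_coercive hΩ hθ h𝒢 g x
  obtain ⟨w, hw⟩ := exists_mem_of_dense (ContinuousLinearMap.isClosed_ker _) hD (by positivity)
    hsurj (LL (inclL2 Ω z))
  obtain ⟨hw1, hw2⟩ := (hP _).1 hw
  refine ⟨z + w, ?_, ?_⟩
  · have := hdiff z
    rw [hz1] at this
    simp only at hw1
    rw [map_add, hw1, ← this]
  · simp only at hw2
    rw [map_add, hz2, hw2, add_zero]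

end

section

/-! ### Feasible pairs for small initial data -/

variable {d : ℕ} {Ω : Set (EuclideanSpace ℝ (Fin d))} {𝒰 : Type*} [NormedAddCommGroup 𝒰]
  [InnerProductSpace ℝ 𝒰]

theorem norm_inclL2_le (y : WInf Ω) : ‖inclL2 Ω y‖ ≤ ‖y‖ := by
  refine le_trans (Lp.norm_le_norm_of_ae_le ?_) (W.norm_state_le y)
  filter_upwards [coeFn_inclL2 y] with t ht
  rw [ht]
  exact norm_incl_apply_le _

theorem cost_eq {X : Type*} [NormedAddCommGroup X] (α : ℝ) (y : WInf Ω) (u : Ctrl X) :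
    cost α y u = 1 / 2 * ‖inclL2 Ω y‖ ^ 2 + α / 2 * ‖u‖ ^ 2 := by
  rw [cost, norm_sq_eq_integral, norm_sq_eq_integral]
  congr 2
  refine integral_congr_ae ?_
  filter_upwards [coeFn_inclL2 y] with t ht
  rw [ht]

/-- The control operator `u ↦ B u`, from `L²(I; 𝒰)` to `L²(I; V*)`. -/
def ctrlL2 (B : 𝒰 →L[ℝ] Y Ω) : Ctrl 𝒰 →L[ℝ] L2VDual Ω :=
  (pivotL2 Ω).comp (B.compLpL 2 (volume.restrict (Ioi 0)))

theorem coeFn_ctrlL2 (B : 𝒰 →L[ℝ] Y Ω) (u : Ctrl 𝒰) :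
    ctrlL2 B u =ᵐ[volume.restrict (Ioi 0)] fun t => pivot Ω (B (u t)) := by
  filter_upwards [coeFn_pivotL2 (B.compLpL 2 (volume.restrict (Ioi 0)) u),
    B.coeFn_compLpL (p := 2) u] with t h1 h2
  exact h1.trans (by rw [h2])

theorem isFeasible_iff {η : ℝ} {𝒜 : V Ω →L[ℝ] VDual Ω} {F : WInf Ω → L2VDual Ω}
    {B : 𝒰 →L[ℝ] Y Ω} {y₀ : Y Ω} {y : WInf Ω} {u : Ctrl 𝒰} :
    IsFeasible η 𝒜 F B y₀ y u ↔
      u ∈ Uad 𝒰 η ∧ evolution 𝒜 y = F y + ctrlL2 B u ∧ trace Ω y = y₀ := by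
  have key : (∀ᵐ t ∂volume.restrict (Ioi (0 : ℝ)),
      W.timeDeriv y t = 𝒜 (W.state y t) + F y t + pivot Ω (B (u t))) ↔
      evolution 𝒜 y = F y + ctrlL2 B u := by
    constructor
    · intro h
      refine Lp.ext ?_
      filter_upwards [h, coeFn_evolution 𝒜 y, Lp.coeFn_add (F y) (ctrlL2 B u), coeFn_ctrlL2 B u]
        with t h1 h2 h3 h4
      rw [h2, h3, Pi.add_apply, h4, h1]; abel
    · intro h
      have h0 := coeFn_evolution 𝒜 y
      rw [h] at h0
      filter_upwards [h0, Lp.coeFn_add (F y) (ctrlL2 B u), coeFn_ctrlL2 B u] with t h2 h3 h4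
      rw [h3, Pi.add_apply, h4] at h2
      rw [add_assoc, h2]; abel
  constructor
  · rintro ⟨h1, h2, h3⟩
    exact ⟨h1, key.1 h2, (hasInitialValue_iff _ _).1 h3⟩
  · rintro ⟨h1, h2, h3⟩
    exact ⟨h1, key.2 h2, (hasInitialValue_iff _ _).2 h3⟩

/-- Local solvability of a semilinear problem whose linearization is solvable. -/
theorem exists_small_solution {E G X : Type*} [NormedAddCommGroup E] [NormedSpace ℝ E]
    [CompleteSpace E] [NormedAddCommGroup G] [NormedSpace ℝ G] [CompleteSpace G]
    [NormedAddCommGroup X] [NormedSpace ℝ X] [CompleteSpace X] (L : E →L[ℝ] G) (τ : E →L[ℝ] X)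
    (hL : ∀ g x, ∃ y, L y = g ∧ τ y = x) {F : E → G} (hF : HasStrictFDerivAt F (0 : E →L[ℝ] G) 0)
    (hF0 : F 0 = 0) :
    ∃ δ C : ℝ, 0 < δ ∧ 0 < C ∧ ∀ x, ‖x‖ < δ → ∃ y, L y = F y ∧ τ y = x ∧ ‖y‖ ≤ C * ‖x‖ := by
  have hstrict : HasStrictFDerivAt (fun y => (L y - F y, τ y)) (L.prod τ) 0 := by
    have := (L.hasStrictFDerivAt.sub hF).prodMk (τ.hasStrictFDerivAt (x := 0))
    rwa [sub_zero] at this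
  have hrange : (L.prod τ).range = ⊤ := LinearMap.range_eq_top.2 fun ⟨g, x⟩ => by
    obtain ⟨y, h1, h2⟩ := hL g x
    exact ⟨y, Prod.ext h1 h2⟩
  obtain ⟨R, hR⟩ := (L.prod τ).exists_nonlinearRightInverse_of_surjective hrange
  have hR' : (0 : ℝ) < R.nnnorm := by exact_mod_cast hR
  -- Half of the admissible Lipschitz error is allowed. The image of a ball of radius `ε` then
  -- contains a ball of radius `ε / (2 ‖R‖)`, and `ε = 2 ‖R‖ ‖x‖` gives exactly the radius `‖x‖`.
  obtain ⟨s, hs, happ⟩ := hstrict.approximates_deriv_on_nhds (c := R.nnnorm⁻¹ / 2)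
    (Or.inr (by positivity))
  obtain ⟨r, hr, hball⟩ := Metric.nhds_basis_closedBall.mem_iff.1 hs
  refine ⟨r / (2 * R.nnnorm), 2 * R.nnnorm, by positivity, by positivity, fun x hx => ?_⟩
  rw [lt_div_iff₀ (by positivity)] at hx
  have h := happ.surjOn_closedBall_of_nonlinearRightInverse R (ε := 2 * R.nnnorm * ‖x‖) (b := 0)
    (by positivity) ((Metric.closedBall_subset_closedBall (by linarith)).trans hball)
  have e : (((R.nnnorm : ℝ))⁻¹ - ((R.nnnorm⁻¹ / 2 : NNReal) : ℝ)) * (2 * R.nnnorm * ‖x‖) = ‖x‖ := by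
    push_cast
    field_simp
    ring
  rw [e] at h
  obtain ⟨y, hy1, hy2⟩ := h (show ((0 : G), x) ∈ _ by
    rw [mem_closedBall_iff_norm]
    simp [hF0, Prod.norm_def])
  have h1 := congr_arg Prod.fst hy2
  have h2 := congr_arg Prod.snd hy2
  exact ⟨y, sub_eq_zero.1 h1, h2, by simpa using hy1⟩

/-- The feedback `u = -K y` absorbs the control into the stabilized linear operator, so only `F`
remains as a perturbation. The bound of `y(t)` in `Y`, uniform in `t`, makes the feedback
admissible. -/
theorem exists_feasible_of_small (hΩ : IsOpen Ω) {η α : ℝ} (hη : 0 < η) (hα : 0 < α)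
    {A : Y Ω →ₗ.[ℝ] Y Ω} {𝒜 : V Ω →L[ℝ] VDual Ω} {B : 𝒰 →L[ℝ] Y Ω} (hext : IsExtension A 𝒜)
    (hgarding : Garding 𝒜) (hstab : Stabilizable A B) {F : WInf Ω → L2VDual Ω}
    (hF : ContDiff ℝ 2 F) (hF0 : F 0 = 0) (hF'0 : fderiv ℝ F 0 = 0) :
    ∃ δ C : ℝ, 0 < δ ∧ 0 < C ∧ ∀ y₀ : Y Ω, ‖y₀‖ < δ → ∃ (y : WInf Ω) (u : Ctrl 𝒰),
      IsFeasible η 𝒜 F B y₀ y u ∧ cost α y u ≤ C * ‖y₀‖ ^ 2 := by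
  obtain ⟨ρ, θ, hρ, hθ, hg⟩ := hgarding
  obtain ⟨K, S, hS, hgen, hst⟩ := hstab
  have hstrict : HasStrictFDerivAt F (0 : WInf Ω →L[ℝ] L2VDual Ω) 0 := by
    rw [← hF'0]
    exact hF.contDiffAt.hasStrictFDerivAt two_ne_zero
  obtain ⟨δ, C, hδ, hC, h⟩ := exists_small_solution (evolution (perturb 𝒜 (B.comp K))) (trace Ω)
    (exists_evolution_eq_of_stabilizable hΩ hext hρ hθ hg hS hgen hst) hstrict hF0
  -- The threshold ensures `‖K y(t)‖ ≤ ‖K‖ · 2 C ‖y₀‖ ≤ η`, the `2` being the embedding constant of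
  -- `W_∞` into bounded functions; `+ 1` keeps the quotient meaningful when `K = 0`.
  refine ⟨min δ (η / (2 * C * (‖K‖ + 1))), 1 / 2 * C ^ 2 + α / 2 * (‖K‖ * C) ^ 2,
    lt_min hδ (by positivity), by positivity, fun y₀ hy₀ => ?_⟩
  obtain ⟨y, hy1, hy2, hy3⟩ := h y₀ (hy₀.trans_le (min_le_left _ _))
  have hy₀' := hy₀.trans_le (min_le_right _ _)
  rw [lt_div_iff₀ (by positivity)] at hy₀'
  set u : Ctrl 𝒰 := -(K.compLpL 2 (volume.restrict (Ioi (0 : ℝ))) (inclL2 Ω y)) with hu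
  have hun : ‖u‖ ≤ ‖K‖ * ‖y‖ := by
    rw [hu, norm_neg]
    exact (K.norm_compLp_le _).trans (mul_le_mul_of_nonneg_left (norm_inclL2_le y) (norm_nonneg _))
  refine ⟨y, u, isFeasible_iff.2 ⟨?_, ?_, hy2⟩, ?_⟩
  · have hu0 : u =ᵐ[volume.restrict (Ioi (0 : ℝ))] fun t => -K (W.rep y t) := by
      filter_upwards [Lp.coeFn_neg (K.compLpL 2 (volume.restrict (Ioi (0 : ℝ))) (inclL2 Ω y)),
        K.coeFn_compLpL (p := 2) (inclL2 Ω y), coeFn_inclL2 y, W.rep_ae y] with t h1 h2 h3 h4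
      rw [hu, h1, Pi.neg_apply, h2, h3, h4]
    change ∀ᵐ t ∂volume.restrict (Ioi (0 : ℝ)), ‖u t‖ ≤ η
    filter_upwards [hu0, ae_restrict_mem measurableSet_Ioi] with t h1 h2
    rw [h1, norm_neg]
    have h3 := W.norm_rep_le y (le_of_lt h2)
    have h4 := K.le_opNorm (W.rep y t)
    have h5 : ‖K‖ * ‖W.rep y t‖ ≤ ‖K‖ * (2 * (C * ‖y₀‖)) :=
      mul_le_mul_of_nonneg_left (h3.trans (by linarith)) (norm_nonneg _)
    have h6 : 0 ≤ C * ‖y₀‖ := by positivity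
    nlinarith
  · rw [evolution_perturb] at hy1
    have e : ctrlL2 B u = -pivotL2 Ω ((B.comp K).compLpL 2 (volume.restrict (Ioi 0)) (inclL2 Ω y)) := by
      rw [ctrlL2, ContinuousLinearMap.comp_apply, hu, map_neg, map_neg]
      congr 2
      refine Lp.ext ?_
      filter_upwards [B.coeFn_compLpL (p := 2)
          (K.compLpL 2 (volume.restrict (Ioi (0 : ℝ))) (inclL2 Ω y)),
        K.coeFn_compLpL (p := 2) (inclL2 Ω y), (B.comp K).coeFn_compLpL (p := 2) (inclL2 Ω y)]
        with t h1 h2 h3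
      rw [h1, h2, h3]; rfl
    rw [e, ← hy1]; abel
  · rw [cost_eq]
    have h1 := (norm_inclL2_le y).trans hy3
    have h2 : ‖u‖ ≤ ‖K‖ * C * ‖y₀‖ := by
      rw [mul_assoc]; exact hun.trans (mul_le_mul_of_nonneg_left hy3 (norm_nonneg _))
    have h3 := pow_le_pow_left₀ (norm_nonneg _) h1 2
    have h4 := pow_le_pow_left₀ (norm_nonneg _) h2 2
    rw [mul_pow] at h3 h4
    have h5 := mul_le_mul_of_nonneg_left h4 (show 0 ≤ α / 2 by linarith)
    linarith

end

section

/-! ### The nonlinearity is local in time -/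

/-- Two representatives agree on test functions, whose span is dense in `H¹₀(Ω)`. Hence `F y` at
time `t` depends only on `y(t)`, which is what makes `F` local in time. -/
theorem Represents.unique {d : ℕ} {Ω : Set (EuclideanSpace ℝ (Fin d))} {f : ℝ → ℝ} {w : Y Ω}
    {g g' : VDual Ω} (hg : Represents f w g) (hg' : Represents f w g') : g = g' := by
  let D : Submodule ℝ (V Ω) := (g - g').ker
  have hD : IsClosed (D : Set (V Ω)) := (g - g').isClosed_ker
  let D' : Submodule ℝ (GraphSpace Ω) := D.map (H10 Ω).subtype
  have hD' : IsClosed (D' : Set (GraphSpace Ω)) := by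
    have h1 : IsClosed (H10 Ω : Set (GraphSpace Ω)) := Submodule.isClosed_topologicalClosure _
    have h2 := h1.isClosedEmbedding_subtypeVal.isClosedMap _ hD
    exact h2
  have hsub : H10 Ω ≤ D' := by
    refine Submodule.topologicalClosure_minimal _ (Submodule.span_le.2 ?_) hD'
    rintro w' ⟨φ, hφ, h1, h2⟩
    have hmem : w' ∈ H10 Ω := Submodule.le_topologicalClosure _
      (Submodule.subset_span ⟨φ, hφ, h1, h2⟩)
    let v : V Ω := ⟨w', hmem⟩
    refine ⟨v, ?_, rfl⟩
    change (g - g') v = 0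
    rw [sub_apply, hg.2 v φ hφ h1, hg'.2 v φ hφ h1, sub_self]
  ext v
  obtain ⟨v', hv', hvv⟩ := hsub v.2
  have : v' = v := Subtype.ext hvv
  rw [this] at hv'
  exact sub_eq_zero.1 hv'

variable {d : ℕ} {Ω : Set (EuclideanSpace ℝ (Fin d))}

/-! ### Concatenation in time -/

/-- The function `a` on `(-∞, T]`, followed by `b`. -/
def glue {E : Type*} (T : ℝ) (a b : ℝ → E) : ℝ → E := (Iic T).piecewise a fun t => b (t - T)

theorem glue_of_le {E : Type*} {T t : ℝ} (a b : ℝ → E) (h : t ≤ T) : glue T a b t = a t :=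
  piecewise_eq_of_mem _ _ _ h

theorem glue_of_lt {E : Type*} {T t : ℝ} (a b : ℝ → E) (h : T < t) : glue T a b t = b (t - T) :=
  piecewise_eq_of_notMem _ _ _ (not_le.2 h)

theorem measurePreserving_sub_Ioi (T : ℝ) :
    MeasurePreserving (fun t => t - T) (volume.restrict (Ioi T)) (volume.restrict (Ioi (0 : ℝ))) := by
  have h := (measurePreserving_sub_right volume T).restrict_preimage
    (measurableSet_Ioi (a := (0 : ℝ)))
  rwa [preimage_sub_const_Ioi, zero_add] at h

theorem integral_Ioi_comp_sub {E : Type*} [NormedAddCommGroup E] [NormedSpace ℝ E] (T : ℝ)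
    (H : ℝ → E) : ∫ t in Ioi T, H (t - T) = ∫ t in Ioi 0, H t :=
  (measurePreserving_sub_Ioi T).integral_comp (MeasurableEquiv.subRight T).measurableEmbedding H

theorem memLp_glue {E : Type*} [NormedAddCommGroup E] {T : ℝ} (hT : 0 ≤ T) {a b : ℝ → E}
    (ha : MemLp a 2 (volume.restrict (Ioi (0 : ℝ)))) (hb : MemLp b 2 (volume.restrict (Ioi (0 : ℝ)))) :
    MemLp (glue T a b) 2 (volume.restrict (Ioi (0 : ℝ))) := by
  refine MemLp.piecewise measurableSet_Iic (ha.restrict _) ?_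
  rw [Measure.restrict_restrict measurableSet_Iic.compl, compl_Iic,
    inter_eq_left.2 (Ioi_subset_Ioi hT)]
  exact hb.comp_measurePreserving (measurePreserving_sub_Ioi T)

theorem integral_glue {E F : Type*} [NormedAddCommGroup F] [NormedSpace ℝ F] {T : ℝ} (hT : 0 ≤ T)
    {a b : ℝ → E} (Φ : ℝ → E → F)
    (hint : IntegrableOn (fun t => Φ t (glue T a b t)) (Ioi 0)) :
    ∫ t in Ioi 0, Φ t (glue T a b t) =
      (∫ t in (0 : ℝ)..T, Φ t (a t)) + ∫ t in Ioi 0, Φ (t + T) (b t) := by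
  rw [← intervalIntegral.integral_interval_add_Ioi hint (hint.mono_set (Ioi_subset_Ioi hT))]
  congr 1
  · refine intervalIntegral.integral_congr fun t ht => ?_
    rw [uIcc_of_le hT] at ht
    simp only [glue_of_le a b ht.2]
  · rw [← integral_Ioi_comp_sub T]
    refine setIntegral_congr_fun measurableSet_Ioi fun t ht => ?_
    simp only [glue_of_lt a b ht, sub_add_cancel]

theorem W.integral_by_parts_Ioi (y : WInf Ω) {φ : ℝ → ℝ} (hφ : ContDiff ℝ 1 φ)
    (hc : HasCompactSupport φ) : -(φ 0 • pivot Ω (W.rep y 0)) =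
      (∫ t in Ioi 0, deriv φ t • gelfand Ω (W.state y t)) + ∫ t in Ioi 0, φ t • W.timeDeriv y t := by
  have i1 := integrable_smul_of_compact (Ioi (0 : ℝ)) _ (hφ.continuous_deriv le_rfl) hc.deriv _
    ((gelfand Ω).comp_memLp' (Lp.memLp (W.state y)))
  have i2 := integrable_smul_of_compact (Ioi (0 : ℝ)) _ hφ.continuous hc _
    (Lp.memLp (W.timeDeriv y))
  have h1 := (intervalIntegral_tendsto_integral_Ioi 0 i1 tendsto_id).add
    (intervalIntegral_tendsto_integral_Ioi 0 i2 tendsto_id)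
  refine tendsto_nhds_unique (tendsto_const_nhds.congr' ?_) h1
  obtain ⟨R, hR⟩ := hc.isCompact.isBounded.subset_closedBall 0
  filter_upwards [eventually_ge_atTop 0, eventually_gt_atTop R] with b hb hbR
  have h0 : φ b = 0 := by
    by_contra h
    have := hR (subset_tsupport _ h)
    rw [mem_closedBall_zero_iff, Real.norm_of_nonneg hb] at this
    linarith
  have := W.integral_by_parts y hφ le_rfl hb
  rw [h0, zero_smul, zero_sub] at this
  exact this

theorem restrict_Ioc_le (T : ℝ) : volume.restrict (Ioc 0 T) ≤ volume.restrict (Ioi (0 : ℝ)) :=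
  Measure.restrict_mono Ioc_subset_Ioi_self le_rfl

/-- Since `z(0) = y(T)`, the boundary terms of the two integrations by parts cancel, and the weak
derivative of the glued function has no jump part. -/
theorem W.exists_glue (y z : WInf Ω) {T : ℝ} (hT : 0 ≤ T) (h : trace Ω z = W.rep y T) :
    ∃ e : WInf Ω, (∀ᵐ t ∂volume.restrict (Ioc 0 T), W.state e t = W.state y t) ∧
      ‖e‖ ^ 2 = (∫ t in (0 : ℝ)..T, (‖W.state y t‖ ^ 2 + ‖W.timeDeriv y t‖ ^ 2)) + ‖z‖ ^ 2 := by
  have m1 := memLp_glue hT (Lp.memLp (W.state y)) (Lp.memLp (W.state z))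
  have m2 := memLp_glue hT (Lp.memLp (W.timeDeriv y)) (Lp.memLp (W.timeDeriv z))
  obtain ⟨e, he1, he2⟩ := W.exists_of_memLp m1 m2 fun φ hφ => by
    have hφ1 : ContDiff ℝ 1 φ := hφ.1.of_le (by norm_cast)
    have i1 := integrable_smul_of_compact (Ioi (0 : ℝ)) _ (hφ1.continuous_deriv le_rfl)
      hφ.2.1.deriv _ ((gelfand Ω).comp_memLp' m1)
    have i2 := integrable_smul_of_compact (Ioi (0 : ℝ)) _ hφ1.continuous hφ.2.1 _ m2
    rw [integral_glue hT (fun t v => deriv φ t • gelfand Ω v) i1,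
      integral_glue hT (fun t v => φ t • v) i2]
    have h1 := W.integral_by_parts y hφ1 le_rfl hT
    have hψ1 : ContDiff ℝ 1 fun t => φ (t + T) := hφ1.comp (by fun_prop)
    have hψc : HasCompactSupport fun t => φ (t + T) :=
      hφ.2.1.comp_homeomorph (Homeomorph.addRight T)
    have h2 := W.integral_by_parts_Ioi z hψ1 hψc
    simp only [deriv_comp_add_const, zero_add] at h2
    rw [← trace_apply, h] at h2
    rw [hφ.apply_zero, zero_smul, sub_zero] at h1
    rw [h1] at h2
    rw [eq_neg_iff_add_eq_zero]
    have h3 := neg_eq_iff_add_eq_zero.1 h2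
    rw [← h3]
    abel
  refine ⟨e, ?_, ?_⟩
  · have h1 : W.state e =ᵐ[volume.restrict (Ioi 0)] glue T (W.state y) (W.state z) := by
      rw [he1]; exact m1.coeFn_toLp
    have h2 := (ae_mono (restrict_Ioc_le T)) h1
    filter_upwards [h2, ae_restrict_mem measurableSet_Ioc] with t h3 h4
    rw [h3, glue_of_le _ _ h4.2]
  · rw [W.norm_sq, W.norm_sq z, he1, he2, norm_toLp_sq, norm_toLp_sq,
      integral_glue hT (fun _ v => ‖v‖ ^ 2) (integrable_norm_sq m1),
      integral_glue hT (fun _ v => ‖v‖ ^ 2) (integrable_norm_sq m2), ← norm_sq_eq_integral,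
      ← norm_sq_eq_integral, intervalIntegral.integral_add]
    · ring
    · exact (intervalIntegrable_iff_integrableOn_Ioc_of_le hT).2
        (IntegrableOn.mono_set (integrable_norm_sq (Lp.memLp (W.state y))) Ioc_subset_Ioi_self)
    · exact (intervalIntegrable_iff_integrableOn_Ioc_of_le hT).2
        (IntegrableOn.mono_set (integrable_norm_sq (Lp.memLp (W.timeDeriv y))) Ioc_subset_Ioi_self)

/-- Allows `F y` on `(0, T)` to be estimated through any continuation of `y` beyond `T`, in
particular one that is small in `W_∞`. -/
theorem IsSubstitution.eq_of_state_eq {f : ℝ → ℝ} {F : WInf Ω → L2VDual Ω}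
    (hF : IsSubstitution f F) {y e : WInf Ω} {T : ℝ}
    (h : ∀ᵐ t ∂volume.restrict (Ioc 0 T), W.state e t = W.state y t) :
    ∀ᵐ t ∂volume.restrict (Ioc 0 T), F e t = F y t := by
  have hm := restrict_Ioc_le T
  filter_upwards [h, ae_mono hm (hF y), ae_mono hm (hF e)] with t h1 h2 h3
  rw [h1] at h3
  exact h3.unique h2

end

section

/-! ### A priori estimate for small data -/

theorem setIntegral_Ioc_norm_sq_le {E : Type*} [NormedAddCommGroup E]
    (g : Lp E 2 (volume.restrict (Ioi (0 : ℝ)))) (T : ℝ) : ∫ t in Ioc 0 T, ‖g t‖ ^ 2 ≤ ‖g‖ ^ 2 := by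
  rw [norm_sq_eq_integral]
  exact setIntegral_mono_set (integrable_norm_sq (Lp.memLp g)) (ae_of_all _ fun t => sq_nonneg _)
    (LE.le.eventuallyLE Ioc_subset_Ioi_self)

theorem integrable_Ioc_norm_sq {E : Type*} [NormedAddCommGroup E]
    (g : Lp E 2 (volume.restrict (Ioi (0 : ℝ)))) (T : ℝ) :
    Integrable (fun t => ‖g t‖ ^ 2) (volume.restrict (Ioc 0 T)) :=
  integrable_norm_sq ((Lp.memLp g).mono_measure (restrict_Ioc_le T))

theorem integral_linear_combination {μ : Measure ℝ} {f₁ f₂ f₃ f₄ : ℝ → ℝ} (h₁ : Integrable f₁ μ)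
    (h₂ : Integrable f₂ μ) (h₃ : Integrable f₃ μ) (h₄ : Integrable f₄ μ) (a b c d : ℝ) :
    Integrable (fun t => a * f₁ t + b * f₂ t + c * f₃ t + d * f₄ t) μ ∧
      ∫ t, (a * f₁ t + b * f₂ t + c * f₃ t + d * f₄ t) ∂μ =
        a * (∫ t, f₁ t ∂μ) + b * (∫ t, f₂ t ∂μ) + c * (∫ t, f₃ t ∂μ) + d * ∫ t, f₄ t ∂μ := by
  have i₂ : Integrable (fun t => a * f₁ t + b * f₂ t) μ := (h₁.const_mul a).add (h₂.const_mul b)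
  have i₃ : Integrable (fun t => a * f₁ t + b * f₂ t + c * f₃ t) μ := i₂.add (h₃.const_mul c)
  refine ⟨i₃.add (h₄.const_mul d), ?_⟩
  rw [integral_add i₃ (h₄.const_mul d), integral_add i₂ (h₃.const_mul c),
    integral_add (h₁.const_mul a) (h₂.const_mul b), integral_const_mul, integral_const_mul,
    integral_const_mul, integral_const_mul]

/-- The arithmetic of the bootstrap. Here `X = ‖y(T)‖²`, `I₁` and `I₂` are the integrals of `‖y‖²_V`
and `‖y'‖²_{V*}` over `(0, T)`, `Φ` is the squared norm of the nonlinearity, the `qᵢ` are the data,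
`a = ‖𝒜‖²`, `b = ‖B‖²`, and `c` is the squared lifting constant. The energy estimates give a bound
by `C₁ (C₂ (q₁ + q₂ + q₃) + Φ)`; by `hM`, the term `C₁ Φ` is at most half the left side and is
absorbed. -/
theorem closing_estimate {θ ρ a b c X I₁ I₂ Φ q₁ q₂ q₃ C₁ C₂ : ℝ} (hθ : 0 < θ) (hρ : 0 ≤ ρ)
    (ha : 0 ≤ a) (hb : 0 ≤ b) (hc : 0 ≤ c) (hX : 0 ≤ X) (hI₁ : 0 ≤ I₁) (hΦ : 0 ≤ Φ) (h₁ : 0 ≤ q₁)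
    (h₂ : 0 ≤ q₂) (h₃ : 0 ≤ q₃) (hC₁ : C₁ = (c + (1 + 3 * a) / θ) * (1 + 1 / θ) + 3)
    (hC₂ : C₂ = 1 + (2 * ρ + 1) + b)
    (E₁ : X + θ * I₁ ≤ q₁ + (2 * ρ + 1) * q₂ + 1 / θ * Φ + b * q₃)
    (E₂ : I₂ ≤ 3 * a * I₁ + 3 * Φ + 3 * b * q₃) (hM : Φ ≤ 1 / (2 * C₁) * (I₁ + I₂ + c * X)) :
    I₁ + I₂ + c * X ≤ 2 * C₁ * C₂ * (q₁ + q₂ + q₃) := by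
  have hC₁p : 0 < C₁ := by rw [hC₁]; positivity
  obtain ⟨Q, hQ⟩ : ∃ Q, Q = C₂ * (q₁ + q₂ + q₃) := ⟨_, rfl⟩
  have hQB : q₁ + (2 * ρ + 1) * q₂ + b * q₃ ≤ Q := by
    rw [hQ, hC₂]
    nlinarith [mul_nonneg hb h₁, mul_nonneg hb h₂, mul_nonneg hρ h₁, mul_nonneg hρ h₃]
  have hBu : b * q₃ ≤ Q := by nlinarith [mul_nonneg hρ h₂]
  have hQ0 : 0 ≤ Q := (mul_nonneg hb h₃).trans hBu
  obtain ⟨S, hS⟩ : ∃ S, S = (1 + 1 / θ) * (Q + Φ) := ⟨_, rfl⟩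
  have hXS : X + θ * I₁ ≤ S := by
    have : 0 ≤ 1 / θ * Q := by positivity
    rw [hS]
    linarith
  have hI : I₁ ≤ S / θ := by
    rw [le_div_iff₀ hθ]; linarith
  have c₁ : c * X ≤ c * S := mul_le_mul_of_nonneg_left (by nlinarith) hc
  have c₂ : (1 + 3 * a) * I₁ ≤ (1 + 3 * a) * (S / θ) := mul_le_mul_of_nonneg_left hI (by positivity)
  have e₁ : C₁ * (Q + Φ) = c * S + (1 + 3 * a) * (S / θ) + 3 * (Q + Φ) := by
    rw [hC₁, hS]; ring
  have hMT : I₁ + I₂ + c * X ≤ C₁ * (Q + Φ) := by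
    rw [e₁]; linarith
  have hC₁Φ : C₁ * Φ ≤ (I₁ + I₂ + c * X) / 2 := by
    have h := mul_le_mul_of_nonneg_left hM hC₁p.le
    have e : C₁ * (1 / (2 * C₁) * (I₁ + I₂ + c * X)) = (I₁ + I₂ + c * X) / 2 := by field_simp
    linarith
  rw [mul_assoc, ← hQ]
  linarith

variable {d : ℕ} {Ω : Set (EuclideanSpace ℝ (Fin d))} {𝒰 : Type*} [NormedAddCommGroup 𝒰]
  [InnerProductSpace ℝ 𝒰]

theorem garding_pointwise {𝒜 : V Ω →L[ℝ] VDual Ω} {ρ θ : ℝ} (hθ : 0 < θ)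
    (hg : ∀ v : V Ω, θ * ‖v‖ ^ 2 ≤ ρ * ‖incl Ω v‖ ^ 2 - 𝒜 v v) (B : 𝒰 →L[ℝ] Y Ω) (v : V Ω)
    (n : VDual Ω) (u : 𝒰) :
    2 * (𝒜 v + n + pivot Ω (B u)) v ≤ -θ * ‖v‖ ^ 2 + (2 * ρ + 1) * ‖incl Ω v‖ ^ 2 +
      1 / θ * ‖n‖ ^ 2 + ‖B‖ ^ 2 * ‖u‖ ^ 2 := by
  rw [add_apply, add_apply, pivot_apply]
  have h1 : n v ≤ ‖n‖ * ‖v‖ := (le_abs_self _).trans (n.le_opNorm v)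
  have h2 : inner ℝ (B u) (incl Ω v) ≤ ‖B‖ * ‖u‖ * ‖incl Ω v‖ :=
    (real_inner_le_norm _ _).trans (mul_le_mul_of_nonneg_right (B.le_opNorm u) (norm_nonneg _))
  have h3 : 2 * (‖n‖ * ‖v‖) ≤ θ * ‖v‖ ^ 2 + 1 / θ * ‖n‖ ^ 2 := by
    have : 0 ≤ (θ * ‖v‖ - ‖n‖) ^ 2 / θ := by positivity
    have e : (θ * ‖v‖ - ‖n‖) ^ 2 / θ = θ * ‖v‖ ^ 2 + 1 / θ * ‖n‖ ^ 2 - 2 * (‖n‖ * ‖v‖) := by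
      field_simp; ring
    linarith
  have h4 := sq_nonneg (‖B‖ * ‖u‖ - ‖incl Ω v‖)
  have h5 := hg v
  nlinarith

theorem norm_rhs_sq_le (𝒜 : V Ω →L[ℝ] VDual Ω) (B : 𝒰 →L[ℝ] Y Ω) (v : V Ω) (n : VDual Ω) (u : 𝒰) :
    ‖𝒜 v + n + pivot Ω (B u)‖ ^ 2 ≤
      3 * ‖𝒜‖ ^ 2 * ‖v‖ ^ 2 + 3 * ‖n‖ ^ 2 + 3 * ‖B‖ ^ 2 * ‖u‖ ^ 2 := by
  have h1 : ‖𝒜 v + n + pivot Ω (B u)‖ ≤ ‖𝒜‖ * ‖v‖ + ‖n‖ + ‖B‖ * ‖u‖ :=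
    (norm_add₃_le).trans (add_le_add (add_le_add (𝒜.le_opNorm v) le_rfl)
      ((norm_pivot_apply_le _).trans (B.le_opNorm u)))
  have h2 := pow_le_pow_left₀ (norm_nonneg _) h1 2
  nlinarith [sq_nonneg (‖𝒜‖ * ‖v‖ - ‖n‖), sq_nonneg (‖𝒜‖ * ‖v‖ - ‖B‖ * ‖u‖),
    sq_nonneg (‖n‖ - ‖B‖ * ‖u‖)]

/-- The source `n` need only satisfy the equation on `(0, T)`: it will be `F e` for the continued
state `e`, not `F y`, whose norm is not under control. -/
theorem W.energy_estimate {𝒜 : V Ω →L[ℝ] VDual Ω} {ρ θ : ℝ} (hρ : 0 ≤ ρ) (hθ : 0 < θ)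
    (hg : ∀ v : V Ω, θ * ‖v‖ ^ 2 ≤ ρ * ‖incl Ω v‖ ^ 2 - 𝒜 v v) (B : 𝒰 →L[ℝ] Y Ω)
    (y : WInf Ω) (n : L2VDual Ω) (u : Ctrl 𝒰) {T : ℝ} (hT : 0 ≤ T)
    (heq : ∀ᵐ t ∂volume.restrict (Ioc 0 T),
      W.timeDeriv y t = 𝒜 (W.state y t) + n t + pivot Ω (B (u t))) :
    (‖W.rep y T‖ ^ 2 + θ * (∫ t in Ioc 0 T, ‖W.state y t‖ ^ 2) ≤ ‖trace Ω y‖ ^ 2 +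
      (2 * ρ + 1) * ‖inclL2 Ω y‖ ^ 2 + 1 / θ * ‖n‖ ^ 2 + ‖B‖ ^ 2 * ‖u‖ ^ 2) ∧
    ∫ t in Ioc 0 T, ‖W.timeDeriv y t‖ ^ 2 ≤ 3 * ‖𝒜‖ ^ 2 * (∫ t in Ioc 0 T, ‖W.state y t‖ ^ 2) +
      3 * ‖n‖ ^ 2 + 3 * ‖B‖ ^ 2 * ‖u‖ ^ 2 := by
  have iy := integrable_Ioc_norm_sq (W.state y) T
  have iy' := integrable_Ioc_norm_sq (W.timeDeriv y) T
  have ii := integrable_Ioc_norm_sq (inclL2 Ω y) T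
  have i_n := integrable_Ioc_norm_sq n T
  have iu := integrable_Ioc_norm_sq u T
  have bi := setIntegral_Ioc_norm_sq_le (inclL2 Ω y) T
  have bn := setIntegral_Ioc_norm_sq_le n T
  have bu := setIntegral_Ioc_norm_sq_le u T
  constructor
  · have h1 := W.energy y le_rfl hT
    rw [intervalIntegral.integral_of_le hT, ← integral_const_mul] at h1
    obtain ⟨ic, hic⟩ := integral_linear_combination iy ii i_n iu (-θ) (2 * ρ + 1) (1 / θ) (‖B‖ ^ 2)
    have ip : Integrable (fun t => 2 * W.timeDeriv y t (W.state y t)) (volume.restrict (Ioc 0 T)) :=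
      (integrable_bilin (ContinuousLinearMap.id ℝ (VDual Ω))
        ((Lp.memLp (W.timeDeriv y)).mono_measure (restrict_Ioc_le T))
        ((Lp.memLp (W.state y)).mono_measure (restrict_Ioc_le T))).const_mul 2
    have h2 := integral_mono_ae ip ic (by
      filter_upwards [heq, (ae_mono (restrict_Ioc_le T)) (coeFn_inclL2 y)] with t e1 e2
      rw [e1, e2]
      exact garding_pointwise hθ hg B _ _ _)
    rw [hic] at h2
    have c1 := mul_le_mul_of_nonneg_left bi (show 0 ≤ 2 * ρ + 1 by linarith)
    have c2 := mul_le_mul_of_nonneg_left bn (show 0 ≤ 1 / θ by positivity)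
    have c3 := mul_le_mul_of_nonneg_left bu (show 0 ≤ ‖B‖ ^ 2 by positivity)
    rw [trace_apply]
    linarith
  · obtain ⟨ic, hic⟩ := integral_linear_combination iy i_n iu iu (3 * ‖𝒜‖ ^ 2) 3 (3 * ‖B‖ ^ 2) 0
    have h2 := integral_mono_ae iy' ic (by
      filter_upwards [heq] with t e1
      rw [e1, zero_mul, add_zero]
      exact norm_rhs_sq_le 𝒜 B _ _ _)
    rw [hic] at h2
    have c3 := mul_le_mul_of_nonneg_left bu (show 0 ≤ 3 * ‖B‖ ^ 2 by positivity)
    linarith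

/-- The energy of `y` on `(0, T)`. -/
def W.energyOn (y : WInf Ω) (T : ℝ) : ℝ :=
  ∫ t in (0 : ℝ)..T, (‖W.state y t‖ ^ 2 + ‖W.timeDeriv y t‖ ^ 2)

theorem W.energyOn_eq (y : WInf Ω) {T : ℝ} (hT : 0 ≤ T) : W.energyOn y T =
    (∫ t in Ioc 0 T, ‖W.state y t‖ ^ 2) + ∫ t in Ioc 0 T, ‖W.timeDeriv y t‖ ^ 2 := by
  rw [W.energyOn, intervalIntegral.integral_of_le hT,
    integral_add (integrable_Ioc_norm_sq _ T) (integrable_Ioc_norm_sq _ T)]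

theorem W.integrable_energy (y : WInf Ω) :
    IntegrableOn (fun t => ‖W.state y t‖ ^ 2 + ‖W.timeDeriv y t‖ ^ 2) (Ioi 0) :=
  (integrable_norm_sq (Lp.memLp (W.state y))).add (integrable_norm_sq (Lp.memLp (W.timeDeriv y)))

theorem W.continuousOn_energyOn (y : WInf Ω) : ContinuousOn (W.energyOn y) (Ici 0) := by
  intro T hT
  have h : IntegrableOn (fun t => ‖W.state y t‖ ^ 2 + ‖W.timeDeriv y t‖ ^ 2) (uIcc 0 (T + 1)) := by
    rw [uIcc_of_le (by linarith [mem_Ici.1 hT]), integrableOn_Icc_iff_integrableOn_Ioc]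
    exact y.integrable_energy.mono_set Ioc_subset_Ioi_self
  have h2 := intervalIntegral.continuousOn_primitive_interval h
  rw [uIcc_of_le (by linarith [mem_Ici.1 hT])] at h2
  refine (h2 T ⟨hT, by linarith⟩).mono_of_mem_nhdsWithin ?_
  rw [← Ici_inter_Iic]
  exact inter_mem_nhdsWithin _ (Iic_mem_nhds (by linarith))

theorem W.tendsto_energyOn (y : WInf Ω) : Tendsto (W.energyOn y) atTop (𝓝 (‖y‖ ^ 2)) := by
  have h := intervalIntegral_tendsto_integral_Ioi 0 y.integrable_energy tendsto_id
  rwa [integral_add (integrable_norm_sq (Lp.memLp (W.state y)))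
    (integrable_norm_sq (Lp.memLp (W.timeDeriv y))), ← norm_sq_eq_integral, ← norm_sq_eq_integral,
    ← W.norm_sq] at h

/-- The coercive problem with zero source continues a given initial value into `W_∞` with linear
control of the norm. -/
theorem exists_lifting (hΩ : IsOpen Ω) {𝒜 : V Ω →L[ℝ] VDual Ω} (hgarding : Garding 𝒜) :
    ∃ C : ℝ, 0 < C ∧ ∀ x : Y Ω, ∃ z : WInf Ω, trace Ω z = x ∧ ‖z‖ ≤ C * ‖x‖ := by
  obtain ⟨ρ, θ, -, hθ, hg⟩ := hgarding
  have h𝒢 := Garding.perturb_coercive hg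
  obtain ⟨C, hC, hCy⟩ := exists_norm_le_evolution hθ h𝒢
  refine ⟨C, hC, fun x => ?_⟩
  obtain ⟨z, h1, h2⟩ := exists_evolution_eq_of_coercive hΩ hθ h𝒢 0 x
  refine ⟨z, h2, ?_⟩
  have := hCy z
  rwa [h1, h2, norm_zero, zero_add] at this

theorem initial_estimate {θ ρ a b c q₁ q₂ q₃ r C₁ C₂ : ℝ} (hθ : 0 < θ) (hρ : 0 ≤ ρ)
    (ha : 0 ≤ a) (hb : 0 ≤ b) (hc : 0 ≤ c) (h₁ : 0 ≤ q₁) (h₂ : 0 ≤ q₂) (h₃ : 0 ≤ q₃)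
    (hC₁ : C₁ = (c + (1 + 3 * a) / θ) * (1 + 1 / θ) + 3) (hC₂ : C₂ = 1 + (2 * ρ + 1) + b)
    (h : (q₁ + q₂ + q₃) * (2 * C₁ * C₂) < r) : c * q₁ < r := by
  have h4 : c ≤ C₁ := by
    have : 0 ≤ (1 + 3 * a) / θ * (1 + 1 / θ) + 3 + c * (1 / θ) := by positivity
    rw [hC₁]
    linarith
  have hC₁p : 0 ≤ C₁ := hc.trans h4
  have h5 : 1 ≤ C₂ := by rw [hC₂]; linarith
  have h6 : c * q₁ ≤ C₁ * (q₁ + q₂ + q₃) := mul_le_mul h4 (by linarith) h₁ hC₁p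
  have h7 : 0 ≤ C₁ * (q₁ + q₂ + q₃) := by positivity
  have h8 : C₁ * (q₁ + q₂ + q₃) ≤ C₁ * (q₁ + q₂ + q₃) * C₂ := le_mul_of_one_le_right h7 h5
  linarith

/-- Feasible pairs with small data and small cost are small in `W_∞`. -/
theorem exists_apriori_bound (hΩ : IsOpen Ω) {𝒜 : V Ω →L[ℝ] VDual Ω} (B : 𝒰 →L[ℝ] Y Ω)
    (hgarding : Garding 𝒜) {f : ℝ → ℝ} {F : WInf Ω → L2VDual Ω} (hsubst : IsSubstitution f F)
    (hF : HasFDerivAt F (0 : WInf Ω →L[ℝ] L2VDual Ω) 0) (hF0 : F 0 = 0) (η : ℝ) :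
    ∃ r C : ℝ, 0 < r ∧ 0 < C ∧ ∀ (y₀ : Y Ω) (y : WInf Ω) (u : Ctrl 𝒰),
      IsFeasible η 𝒜 F B y₀ y u → ‖y₀‖ ^ 2 + ‖inclL2 Ω y‖ ^ 2 + ‖u‖ ^ 2 < r →
        ‖y‖ ^ 2 ≤ C * (‖y₀‖ ^ 2 + ‖inclL2 Ω y‖ ^ 2 + ‖u‖ ^ 2) := by
  obtain ⟨C₀, hC₀, hlift⟩ := exists_lifting hΩ hgarding
  obtain ⟨ρ, θ, hρ, hθ, hg⟩ := hgarding
  obtain ⟨C₁, hC₁⟩ : ∃ C₁, C₁ = (C₀ ^ 2 + (1 + 3 * ‖𝒜‖ ^ 2) / θ) * (1 + 1 / θ) + 3 := ⟨_, rfl⟩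
  have hC₁p : 0 < C₁ := by rw [hC₁]; positivity
  obtain ⟨C₂, hC₂⟩ : ∃ C₂, C₂ = 1 + (2 * ρ + 1) + ‖B‖ ^ 2 := ⟨_, rfl⟩
  have hC₂p : 0 < C₂ := by rw [hC₂]; positivity
  -- Chosen so that `‖F e‖² ≤ ‖e‖² / (2 C₁)`, the smallness required by `closing_estimate`.
  obtain ⟨κ, hκp, hκ2⟩ : ∃ κ : ℝ, 0 < κ ∧ κ ^ 2 = 1 / (2 * C₁) :=
    ⟨√(1 / (2 * C₁)), by positivity, Real.sq_sqrt (by positivity)⟩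
  obtain ⟨R, hR, hsmall⟩ : ∃ R : ℝ, 0 < R ∧ ∀ e, ‖e‖ ≤ R → ‖F e‖ ≤ κ * ‖e‖ := by
    have h := hF.isLittleO.def hκp
    obtain ⟨R, hR, hb⟩ := Metric.nhds_basis_closedBall.mem_iff.1 h
    refine ⟨R, hR, fun e he => ?_⟩
    have := hb (mem_closedBall_zero_iff.2 he)
    simpa [hF0] using this
  refine ⟨R ^ 2 / (2 * C₁ * C₂), 2 * C₁ * C₂, by positivity, by positivity,
    fun y₀ y u hfeas hsm => ?_⟩
  rw [lt_div_iff₀ (by positivity)] at hsm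
  have htr : trace Ω y = y₀ := (isFeasible_iff.1 hfeas).2.2
  -- `M T` bounds the squared `W_∞` norm of `y` cut at `T` and continued by the lifting of `y(T)`;
  -- it is continuous in `T`.
  obtain ⟨M, hM⟩ : ∃ M : ℝ → ℝ, ∀ T, M T = W.energyOn y T + C₀ ^ 2 * ‖W.rep y T‖ ^ 2 :=
    ⟨_, fun _ => rfl⟩
  have hMc : ContinuousOn M (Ici 0) :=
    ((W.continuousOn_energyOn y).add (continuousOn_const.mul
      ((W.rep_continuousOn y).norm.pow 2))).congr fun T _ => hM T
  have hstep : ∀ T, 0 ≤ T → M T ≤ R ^ 2 →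
      M T ≤ 2 * C₁ * C₂ * (‖y₀‖ ^ 2 + ‖inclL2 Ω y‖ ^ 2 + ‖u‖ ^ 2) := by
    intro T hT hMR
    obtain ⟨z, hz1, hz2⟩ := hlift (W.rep y T)
    obtain ⟨e, he1, he2⟩ := W.exists_glue y z hT hz1
    have heM : ‖e‖ ^ 2 ≤ M T := by
      rw [he2, hM]
      have := pow_le_pow_left₀ (norm_nonneg _) hz2 2
      rw [mul_pow] at this
      exact add_le_add le_rfl this
    have hFe := hsmall e (le_of_sq_le_sq (heM.trans hMR) hR.le)
    have hFe2 : ‖F e‖ ^ 2 ≤ 1 / (2 * C₁) * M T := by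
      have h1 := pow_le_pow_left₀ (norm_nonneg _) hFe 2
      rw [mul_pow, hκ2] at h1
      exact h1.trans (mul_le_mul_of_nonneg_left heM (by positivity))
    obtain ⟨E1, E2⟩ := W.energy_estimate hρ hθ hg B y (F e) u hT (by
      filter_upwards [(ae_mono (restrict_Ioc_le T)) hfeas.equation, hsubst.eq_of_state_eq he1]
        with t h1 h2
      rw [h1, h2])
    have hI₁ : 0 ≤ ∫ t in Ioc 0 T, ‖W.state y t‖ ^ 2 := integral_nonneg fun t => sq_nonneg _
    have hen := hM T
    rw [W.energyOn_eq y hT] at hen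
    rw [htr] at E1
    rw [hen] at hFe2 ⊢
    exact closing_estimate hθ hρ (sq_nonneg ‖𝒜‖) (sq_nonneg ‖B‖) (sq_nonneg C₀)
      (sq_nonneg ‖W.rep y T‖) hI₁ (sq_nonneg ‖F e‖) (sq_nonneg ‖y₀‖) (sq_nonneg ‖inclL2 Ω y‖)
      (sq_nonneg ‖u‖) hC₁ hC₂ E1 E2 hFe2
  have hM0 : M 0 < R ^ 2 := by
    have h1 : M 0 = C₀ ^ 2 * ‖y₀‖ ^ 2 := by
      rw [hM, W.energyOn, intervalIntegral.integral_same, zero_add, ← htr, trace_apply]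
    rw [h1]
    exact initial_estimate hθ hρ (sq_nonneg ‖𝒜‖) (sq_nonneg ‖B‖) (sq_nonneg C₀) (sq_nonneg ‖y₀‖)
      (sq_nonneg ‖inclL2 Ω y‖) (sq_nonneg ‖u‖) hC₁ hC₂ hsm
  -- A first visit to the level `R²` is impossible: there `hstep` would apply and, by the choice of
  -- the data threshold, give a value strictly below `R²`.
  have hall : ∀ T, 0 ≤ T → M T < R ^ 2 := by
    intro T hT
    by_contra hcon
    obtain ⟨t, ht, htR⟩ := intermediate_value_Icc hT (hMc.mono Icc_subset_Ici_self)
      ⟨hM0.le, not_lt.1 hcon⟩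
    have := hstep t ht.1 htR.le
    linarith
  refine le_of_tendsto (W.tendsto_energyOn y) ?_
  filter_upwards [eventually_ge_atTop 0] with T hT
  have h1 := hstep T hT (hall T hT).le
  have h2 : W.energyOn y T ≤ M T := by
    rw [hM]
    exact le_add_of_nonneg_right (by positivity)
  exact h2.trans h1

end

section

/-! ### Weak convergence -/

section WeakConvergence

variable {X Z E : Type*} [NormedAddCommGroup X] [NormedSpace ℝ X] [NormedAddCommGroup Z]
  [NormedSpace ℝ Z] [NormedAddCommGroup E] [InnerProductSpace ℝ E]

theorem WeakLim.map {x : ℕ → X} {x₀ : X} (h : WeakLim x x₀) (L : X →L[ℝ] Z) :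
    WeakLim (fun n => L (x n)) (L x₀) := fun ℓ => h (ℓ.comp L)

theorem WeakLim.sub {x y : ℕ → X} {x₀ y₀ : X} (hx : WeakLim x x₀) (hy : WeakLim y y₀) :
    WeakLim (fun n => x n - y n) (x₀ - y₀) := fun ℓ => by
  simpa only [map_sub] using (hx ℓ).sub (hy ℓ)

theorem WeakLim.comp {x : ℕ → X} {x₀ : X} (h : WeakLim x x₀) {φ : ℕ → ℕ} (hφ : StrictMono φ) :
    WeakLim (fun n => x (φ n)) x₀ := fun ℓ => (h ℓ).comp hφ.tendsto_atTop

theorem weakLim_const (x₀ : X) : WeakLim (fun _ => x₀) x₀ := fun _ => tendsto_const_nhds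

theorem WeakLim.unique {x : ℕ → X} {a b : X} (ha : WeakLim x a) (hb : WeakLim x b) : a = b :=
  (SeparatingDual.eq_iff_forall_dual_eq (R := ℝ)).2 fun ℓ => tendsto_nhds_unique (ha ℓ) (hb ℓ)

/-- Mazur's theorem: a functional strictly separating the limit from the set would also separate it
from the sequence. -/
theorem WeakLim.mem_of_isClosed {x : ℕ → X} {x₀ : X} (h : WeakLim x x₀) {s : Set X}
    (hs : Convex ℝ s) (hc : IsClosed s) (hx : ∀ n, x n ∈ s) : x₀ ∈ s := by
  by_contra hcon
  obtain ⟨ℓ, c, h1, h2⟩ := geometric_hahn_banach_point_closed hs hc hcon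
  exact (ge_of_tendsto (h ℓ) (Eventually.of_forall fun n => (h2 _ (hx n)).le)).not_gt h1

/-- The closed span of the sequence is separable, so sequential Banach–Alaoglu applies there; the
Riesz map transports the limit, and functionals on `E` are restricted to the span. -/
theorem exists_weakLim_subseq [CompleteSpace E] {x : ℕ → E} {R : ℝ} (hx : ∀ n, ‖x n‖ ≤ R) :
    ∃ (x₀ : E) (φ : ℕ → ℕ), StrictMono φ ∧ WeakLim (fun n => x (φ n)) x₀ := by
  let S : Submodule ℝ E := (Submodule.span ℝ (range x)).topologicalClosure
  have hxS : ∀ n, x n ∈ S := fun n =>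
    Submodule.le_topologicalClosure _ (Submodule.subset_span (mem_range_self n))
  have hsep : TopologicalSpace.IsSeparable (S : Set E) :=
    ((countable_range x).isSeparable.span (R := ℝ)).closure
  have : TopologicalSpace.SeparableSpace S := hsep.separableSpace
  have : CompleteSpace S := (Submodule.isClosed_topologicalClosure _).completeSpace_coe
  obtain ⟨a, -, φ, hφ, ha⟩ := WeakDual.isSeqCompact_closedBall ℝ S 0 R
    (x := fun n => StrongDual.toWeakDual (InnerProductSpace.toDual ℝ S ⟨x n, hxS n⟩)) fun n => by
      rw [mem_preimage, mem_closedBall_zero_iff]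
      exact ((InnerProductSpace.toDual ℝ S).norm_map _).trans_le (hx n)
  refine ⟨(InnerProductSpace.toDual ℝ S).symm (WeakDual.toStrongDual a), φ, hφ, fun ℓ => ?_⟩
  let r : S := (InnerProductSpace.toDual ℝ S).symm (ℓ.comp S.subtypeL)
  have hr : ∀ s : S, ℓ s = inner ℝ s r := fun s => by
    rw [real_inner_comm]
    exact (InnerProductSpace.toDual_symm_apply (x := s) (y := ℓ.comp S.subtypeL)).symm
  have h := (tendsto_iff_forall_eval_tendsto_topDualPairing.1 ha) r
  rw [hr, InnerProductSpace.toDual_symm_apply]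
  exact h.congr fun n => (hr ⟨x (φ n), hxS _⟩).symm

/-- A space embedded as a closed subspace of a Hilbert space inherits weak compactness: the range is
weakly closed, and functionals on it extend by Hahn–Banach. It is used for `W_∞`, whose norm
involves the dual norm of `V*`. -/
theorem exists_weakLim_subseq_of_antilipschitz [CompleteSpace X] [CompleteSpace E] (Λ : X →L[ℝ] E)
    {K : NNReal} (hΛ : AntilipschitzWith K Λ) {x : ℕ → X} {R : ℝ} (hx : ∀ n, ‖x n‖ ≤ R) :
    ∃ (x₀ : X) (φ : ℕ → ℕ), StrictMono φ ∧ WeakLim (fun n => x (φ n)) x₀ := by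
  obtain ⟨e, φ, hφ, he⟩ := exists_weakLim_subseq (x := fun n => Λ (x n)) (R := ‖Λ‖ * R) fun n =>
    (Λ.le_opNorm _).trans (mul_le_mul_of_nonneg_left (hx n) (norm_nonneg _))
  have hclosed : IsClosed (range Λ) := hΛ.isClosed_range Λ.uniformContinuous
  have hconv : Convex ℝ (range Λ) := by
    rintro - ⟨a, rfl⟩ - ⟨b, rfl⟩ s t - - -
    exact ⟨s • a + t • b, by simp⟩
  obtain ⟨x₀, rfl⟩ := he.mem_of_isClosed hconv hclosed fun n => mem_range_self _
  refine ⟨x₀, φ, hφ, fun ℓ => ?_⟩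
  let Ψ := ContinuousLinearMap.equivRange hΛ.injective hclosed
  obtain ⟨g, hg, -⟩ := exists_extension_norm_eq Λ.range
    (ℓ.comp (Ψ.symm : Λ.range →L[ℝ] X))
  have hg' : ∀ y, g (Λ y) = ℓ y := fun y => by
    have h1 := hg (Ψ y)
    have h2 : ((Ψ y : Λ.range) : E) = Λ y := rfl
    rw [h2] at h1
    rw [h1]
    change ℓ (Ψ.symm (Ψ y)) = ℓ y
    rw [Ψ.symm_apply_apply]
  have h := he g
  rw [hg'] at h
  exact h.congr fun n => hg' _

/-- Together with `two_inner_sub_sq_le`, this is weak lower semicontinuity of the squared norm: its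
tangent at `x₀` is a weakly continuous affine minorant, exact at `x₀`. -/
theorem WeakLim.tendsto_two_inner_sub_sq {x : ℕ → E} {x₀ : E} (h : WeakLim x x₀) :
    Tendsto (fun n => 2 * inner ℝ x₀ (x n) - ‖x₀‖ ^ 2) atTop (𝓝 (‖x₀‖ ^ 2)) := by
  have h1 := ((h (innerSL ℝ x₀)).const_mul 2).sub_const (‖x₀‖ ^ 2)
  simp only [innerSL_apply_apply, real_inner_self_eq_norm_sq] at h1
  convert h1 using 2
  ring

theorem two_inner_sub_sq_le (a b : E) : 2 * inner ℝ a b - ‖a‖ ^ 2 ≤ ‖b‖ ^ 2 := by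
  have h := norm_sub_sq_real a b
  nlinarith [sq_nonneg ‖a - b‖]

end WeakConvergence

end

section

/-! ### Weak closedness of the constraints -/

section

variable {E F : Type*} [NormedAddCommGroup E] [NormedSpace ℝ E] [NormedAddCommGroup F]
  [NormedSpace ℝ F]

theorem restrict_Ioo_le (T : ℝ) : volume.restrict (Ioo 0 T) ≤ volume.restrict (Ioi (0 : ℝ)) :=
  Measure.restrict_mono Ioo_subset_Ioi_self le_rfl

/-- Restriction to `(0, T)`. -/
def restrictL2 (E : Type*) [NormedAddCommGroup E] [NormedSpace ℝ E] (T : ℝ) :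
    Lp E 2 (volume.restrict (Ioi (0 : ℝ))) →L[ℝ] Lp E 2 (volume.restrict (Ioo 0 T)) :=
  LinearMap.mkContinuous
    { toFun := fun g => ((Lp.memLp g).mono_measure (restrict_Ioo_le T)).toLp g
      map_add' := fun g h => by
        rw [← MemLp.toLp_add]
        exact MemLp.toLp_congr _ _ (ae_mono (restrict_Ioo_le T) (Lp.coeFn_add g h))
      map_smul' := fun c g => by
        rw [RingHom.id_apply, ← MemLp.toLp_const_smul]
        exact MemLp.toLp_congr _ _ (ae_mono (restrict_Ioo_le T) (Lp.coeFn_smul c g)) } 1 fun g => by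
    rw [one_mul]
    refine (Lp.norm_toLp _ ((Lp.memLp g).mono_measure (restrict_Ioo_le T))).trans_le ?_
    exact ENNReal.toReal_mono (Lp.eLpNorm_ne_top g) (eLpNorm_mono_measure _ (restrict_Ioo_le T))

theorem coeFn_restrictL2 {T : ℝ} (g : Lp E 2 (volume.restrict (Ioi (0 : ℝ)))) :
    restrictL2 E T g =ᵐ[volume.restrict (Ioo 0 T)] g :=
  ((Lp.memLp g).mono_measure (restrict_Ioo_le T)).coeFn_toLp

/-- The map `g ↦ L ∘ g` from `L²(0,∞)` to `L¹(0,T)`. -/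
def restrictL1 (L : E →L[ℝ] F) (T : ℝ) :
    Lp E 2 (volume.restrict (Ioi (0 : ℝ))) →L[ℝ] Lp F 1 (volume.restrict (Ioo 0 T)) :=
  -- Hölder's inequality against the constant `1 ∈ L²(0,T)` embeds `L²(0,T)` into `L¹(0,T)`.
  ((((ContinuousLinearMap.lsmul ℝ ℝ : ℝ →L[ℝ] F →L[ℝ] F).holderL (volume.restrict (Ioo 0 T)) 2 2 1)
    (indicatorConstLp 2 MeasurableSet.univ (measure_ne_top _ _) (1 : ℝ))).comp
      (L.compLpL 2 (volume.restrict (Ioo 0 T)))).comp (restrictL2 E T)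

theorem coeFn_restrictL1 (L : E →L[ℝ] F) {T : ℝ} (g : Lp E 2 (volume.restrict (Ioi (0 : ℝ)))) :
    restrictL1 L T g =ᵐ[volume.restrict (Ioo 0 T)] fun t => L (g t) := by
  filter_upwards [(ContinuousLinearMap.lsmul ℝ ℝ : ℝ →L[ℝ] F →L[ℝ] F).coeFn_holder (r := 1)
      (indicatorConstLp 2 MeasurableSet.univ (measure_ne_top (volume.restrict (Ioo 0 T)) _) (1 : ℝ))
      (L.compLpL 2 (volume.restrict (Ioo 0 T)) (restrictL2 E T g)),
    L.coeFn_compLpL (p := 2) (restrictL2 E T g), coeFn_restrictL2 (T := T) g,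
    indicatorConstLp_coeFn (p := 2) (hs := MeasurableSet.univ)
      (hμs := measure_ne_top (volume.restrict (Ioo 0 T)) _) (c := (1 : ℝ))] with t h1 h2 h3 h4
  refine h1.trans ?_
  rw [h2, h3, h4]
  simp

end

variable {d : ℕ} {Ω : Set (EuclideanSpace ℝ (Fin d))} {𝒰 : Type*} [NormedAddCommGroup 𝒰]
  [InnerProductSpace ℝ 𝒰]

theorem setIntegral_test_smul {E : Type*} [NormedAddCommGroup E] [NormedSpace ℝ E] {T : ℝ}
    {φ : ℝ → ℝ} (hφ : tsupport φ ⊆ Ioo 0 T) {g h : ℝ → E}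
    (hgh : h =ᵐ[volume.restrict (Ioo 0 T)] g) :
    ∫ t in Ioo 0 T, φ t • h t = ∫ t in Ioi 0, φ t • g t := by
  rw [setIntegral_eq_of_subset_of_forall_sdiff_eq_zero measurableSet_Ioi
    (Ioo_subset_Ioi_self : Ioo 0 T ⊆ Ioi 0) fun t ht => by
      rw [image_eq_zero_of_notMem_tsupport fun h => ht.2 (hφ h), zero_smul]]
  refine integral_congr_ae ?_
  filter_upwards [hgh] with t ht
  rw [ht]

/-- Restriction of elements of `W_∞` to `(0, T)`. -/
def W.restrictL (Ω : Set (EuclideanSpace ℝ (Fin d))) (T : ℝ) : WInf Ω →L[ℝ] W Ω (Ioo 0 T) :=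
  (((WithLp.prodContinuousLinearEquiv 2 ℝ (Lp (V Ω) 2 (volume.restrict (Ioo 0 T)))
    (Lp (VDual Ω) 2 (volume.restrict (Ioo 0 T)))).symm : _ →L[ℝ] PairSpace (V Ω) (VDual Ω) _).comp
      (((restrictL2 (V Ω) T).comp (W.stateL Ω (Ioi 0))).prod
        ((restrictL2 (VDual Ω) T).comp (W.timeDerivL Ω (Ioi 0))))).codRestrict
    (timeSobolev (gelfand Ω) (Ioo 0 T)) fun y φ hφ => by
      have hφ' : IsTest (Ioi 0) φ := ⟨hφ.1, hφ.2.1, hφ.2.2.trans Ioo_subset_Ioi_self⟩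
      refine (setIntegral_test_smul ((tsupport_deriv_subset (𝕜 := ℝ)).trans hφ.2.2) ?_).trans
        ((y.weakDeriv hφ').trans (congrArg _ (setIntegral_test_smul hφ.2.2 ?_).symm))
      · filter_upwards [coeFn_restrictL2 (T := T) (W.state y)] with t ht
        exact congrArg _ ht
      · exact coeFn_restrictL2 (W.timeDeriv y)

theorem coeFn_state_restrictL {T : ℝ} (y : WInf Ω) :
    W.state (W.restrictL Ω T y) =ᵐ[volume.restrict (Ioo 0 T)] W.state y :=
  coeFn_restrictL2 (W.state y)

theorem substitution_restrictL {H : Type*} [NormedAddCommGroup H] [InnerProductSpace ℝ H]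
    {f : ℝ → ℝ} {F : WInf Ω → L2VDual Ω} (hF : IsSubstitution f F) {j : H →L[ℝ] V Ω} {T : ℝ}
    {G : W Ω (Ioo 0 T) → Lp (StrongDual ℝ H) 1 (volume.restrict (Ioo 0 T))}
    (hG : IsSubstitutionOn f j T G) (y : WInf Ω) :
    G (W.restrictL Ω T y) =
      restrictL1 ((ContinuousLinearMap.compL ℝ H (V Ω) ℝ).flip j) T (F y) := by
  refine Lp.ext ?_
  filter_upwards [hG (W.restrictL Ω T y), coeFn_state_restrictL y,
    ae_mono (restrict_Ioo_le T) (hF y),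
    coeFn_restrictL1 ((ContinuousLinearMap.compL ℝ H (V Ω) ℝ).flip j) (F y)] with t h1 h2 h3 h4
  obtain ⟨g, hg1, hg2⟩ := h1
  rw [h2] at hg1
  rw [hg2, h4, hg1.unique h3]
  rfl

/-- Weak sequential closedness of the graph of the substitution operator. -/
theorem substitution_of_weakLim {H : Type*} [NormedAddCommGroup H] [InnerProductSpace ℝ H]
    {f : ℝ → ℝ} {F : WInf Ω → L2VDual Ω} (hF : IsSubstitution f F) {j : H →L[ℝ] V Ω}
    (hj : DenseRange j)
    (hweak : ∀ T : ℝ, 0 < T →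
      ∃ G : W Ω (Ioo 0 T) → Lp (StrongDual ℝ H) 1 (volume.restrict (Ioo 0 T)),
        IsSubstitutionOn f j T G ∧ WeakToWeakContinuous G)
    {y : ℕ → WInf Ω} {y₀ : WInf Ω} (hy : WeakLim y y₀) {g : L2VDual Ω}
    (hg : WeakLim (fun n => F (y n)) g) : F y₀ = g := by
  have key : ∀ T : ℝ, 0 < T → ∀ᵐ t ∂volume.restrict (Ioo 0 T), F y₀ t = g t := by
    intro T hT
    obtain ⟨G, hG1, hG2⟩ := hweak T hT
    -- On `(0, T)` the same sequence has two weak limits in `L¹(0,T; H*)`: one by (A4), one by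
    -- continuity of the linear restriction map. They coincide.
    have h1 := hG2 _ _ (hy.map (W.restrictL Ω T))
    simp only [substitution_restrictL hF hG1] at h1
    have h2 := h1.unique (hg.map _)
    have h3 := coeFn_restrictL1 (T := T) ((ContinuousLinearMap.compL ℝ H (V Ω) ℝ).flip j) (F y₀)
    rw [h2] at h3
    filter_upwards [h3, coeFn_restrictL1 (T := T)
      ((ContinuousLinearMap.compL ℝ H (V Ω) ℝ).flip j) g] with t e1 e2
    have e3 := e1.symm.trans e2
    -- Equality in `H*` lifts to `V*` because the image of `H` is dense in `V`.
    refine ContinuousLinearMap.ext fun v => ?_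
    exact congrFun (hj.equalizer (F y₀ t).continuous (g t).continuous
      (funext fun h => congrArg (fun ℓ : StrongDual ℝ H => ℓ h) e3)) v
  refine Lp.ext ?_
  have hU : Ioi (0 : ℝ) = ⋃ n : ℕ, Ioo 0 ((n : ℝ) + 1) := by
    ext t
    simp only [mem_Ioi, mem_iUnion, mem_Ioo]
    refine ⟨fun ht => ?_, fun ⟨n, h⟩ => h.1⟩
    obtain ⟨n, hn⟩ := exists_nat_gt t
    exact ⟨n, ht, by linarith⟩
  have hall := (ae_restrict_iUnion_iff (μ := volume) (fun n : ℕ => Ioo 0 ((n : ℝ) + 1))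
    (fun t => F y₀ t = g t)).2 fun n => key _ (by positivity)
  rwa [← hU] at hall

theorem convex_Uad (η : ℝ) : Convex ℝ (Uad 𝒰 η) := by
  intro u hu v hv a b ha hb hab
  change ∀ᵐ t ∂volume.restrict (Ioi (0 : ℝ)), ‖(a • u + b • v : Ctrl 𝒰) t‖ ≤ η
  filter_upwards [hu, hv, Lp.coeFn_add (a • u) (b • v), Lp.coeFn_smul a u, Lp.coeFn_smul b v]
    with t h1 h2 h3 h4 h5
  rw [h3, Pi.add_apply, h4, h5]
  exact mem_closedBall_zero_iff.1 (convex_closedBall (0 : 𝒰) η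
    (mem_closedBall_zero_iff.2 h1) (mem_closedBall_zero_iff.2 h2) ha hb hab)

theorem isClosed_Uad {X : Type*} [NormedAddCommGroup X] (η : ℝ) : IsClosed (Uad X η) := by
  refine IsSeqClosed.isClosed fun u u₀ hu hlim => ?_
  obtain ⟨φ, -, hφ⟩ := (tendstoInMeasure_of_tendsto_Lp hlim).exists_seq_tendsto_ae
  change ∀ᵐ t ∂volume.restrict (Ioi (0 : ℝ)), ‖u₀ t‖ ≤ η
  filter_upwards [hφ, ae_all_iff.2 hu] with t h1 h2
  exact le_of_tendsto h1.norm (Eventually.of_forall fun n => h2 _)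

/-- Bounded sequences in `W_∞` have weakly convergent subsequences. -/
theorem W.exists_weakLim_subseq {y : ℕ → WInf Ω} {R : ℝ} (hy : ∀ n, ‖y n‖ ≤ R) :
    ∃ (y₀ : WInf Ω) (φ : ℕ → ℕ), StrictMono φ ∧ WeakLim (fun n => y (φ n)) y₀ := by
  -- Replacing the derivative by its Riesz representative embeds `W_∞` isometrically into a Hilbert
  -- space.
  let R := (riesz (V Ω)).compLpL 2 (volume.restrict (Ioi (0 : ℝ)))
  let e := (WithLp.prodContinuousLinearEquiv 2 ℝ (Lp (V Ω) 2 (volume.restrict (Ioi (0 : ℝ))))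
    (Lp (V Ω) 2 (volume.restrict (Ioi (0 : ℝ))))).symm
  let Λ := (e : _ →L[ℝ] WithLp 2 (Lp (V Ω) 2 (volume.restrict (Ioi (0 : ℝ))) ×
    Lp (V Ω) 2 (volume.restrict (Ioi (0 : ℝ))))).comp
      ((W.stateL Ω (Ioi 0)).prod (R.comp (W.timeDerivL Ω (Ioi 0))))
  have hΛ : ∀ y, ‖Λ y‖ ^ 2 = ‖y‖ ^ 2 := fun y => by
    have h := WithLp.prod_norm_sq_eq_of_L2 (Λ y)
    rw [W.norm_sq, h]
    congr 2
    exact norm_compLpL_riesz _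
  have hanti : AntilipschitzWith 1 Λ := Λ.antilipschitz_of_bound fun y => by
    rw [NNReal.coe_one, one_mul]
    exact le_of_sq_le_sq (hΛ y).ge (norm_nonneg _)
  exact exists_weakLim_subseq_of_antilipschitz Λ hanti hy

end

section

/-! ### Existence of optimal pairs -/

variable {d : ℕ} {Ω : Set (EuclideanSpace ℝ (Fin d))} {𝒰 : Type*} [NormedAddCommGroup 𝒰]
  [InnerProductSpace ℝ 𝒰]

theorem cost_le_of_weakLim {α : ℝ} (hα : 0 ≤ α) {y : ℕ → WInf Ω} {u : ℕ → Ctrl 𝒰} {y₀ : WInf Ω}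
    {u₀ : Ctrl 𝒰} (hy : WeakLim y y₀) (hu : WeakLim u u₀) {m : ℝ}
    (hm : Tendsto (fun n => cost α (y n) (u n)) atTop (𝓝 m)) : cost α y₀ u₀ ≤ m := by
  have h := ((hy.map (inclL2 Ω)).tendsto_two_inner_sub_sq.const_mul (1 / 2)).add
    (hu.tendsto_two_inner_sub_sq.const_mul (α / 2))
  rw [← cost_eq] at h
  refine le_of_tendsto_of_tendsto' h hm fun n => ?_
  rw [cost_eq]
  exact add_le_add (mul_le_mul_of_nonneg_left (two_inner_sub_sq_le _ _) (by norm_num))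
    (mul_le_mul_of_nonneg_left (two_inner_sub_sq_le _ _) (by positivity))

theorem norm_sq_le_of_cost_le {X : Type*} [NormedAddCommGroup X] {α c : ℝ} (hα : 0 < α)
    {y : WInf Ω} {u : Ctrl X}
    (h : cost α y u ≤ c) : ‖inclL2 Ω y‖ ^ 2 ≤ 2 * c ∧ ‖u‖ ^ 2 ≤ 2 / α * c := by
  rw [cost_eq] at h
  have h1 : 0 ≤ α / 2 * ‖u‖ ^ 2 := by positivity
  refine ⟨by linarith, ?_⟩
  have h2 : ‖u‖ ^ 2 = 2 / α * (α / 2 * ‖u‖ ^ 2) := by field_simp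
  rw [h2]
  exact mul_le_mul_of_nonneg_left (by linarith [sq_nonneg ‖inclL2 Ω y‖]) (by positivity)

/-- The state bound is asked only below a cost level `c` exceeding the infimum, and the minimizing
sequence is chosen below that level. -/
theorem exists_optimal [CompleteSpace 𝒰] {H : Type*} [NormedAddCommGroup H]
    [InnerProductSpace ℝ H] {α η : ℝ} (hα : 0 < α) {𝒜 : V Ω →L[ℝ] VDual Ω} {B : 𝒰 →L[ℝ] Y Ω}
    {f : ℝ → ℝ} {F : WInf Ω → L2VDual Ω} (hF : IsSubstitution f F) {j : H →L[ℝ] V Ω}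
    (hj : DenseRange j)
    (hweak : ∀ T : ℝ, 0 < T →
      ∃ G : W Ω (Ioo 0 T) → Lp (StrongDual ℝ H) 1 (volume.restrict (Ioo 0 T)),
        IsSubstitutionOn f j T G ∧ WeakToWeakContinuous G)
    {y₀ : Y Ω} {c R : ℝ} (hne : ∃ y u, IsFeasible η 𝒜 F B y₀ y u ∧ cost α y u < c)
    (hb : ∀ y u, IsFeasible η 𝒜 F B y₀ y u → cost α y u < c → ‖y‖ ≤ R) :
    ∃ y u, IsOptimal α η 𝒜 F B y₀ y u := by
  let S : Set ℝ := {x | ∃ y u, IsFeasible η 𝒜 F B y₀ y u ∧ cost α y u = x}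
  have hS0 : BddBelow S := ⟨0, by
    rintro - ⟨y, u, -, rfl⟩
    rw [cost_eq]
    positivity⟩
  obtain ⟨z, w, hzw, hzc⟩ := hne
  have hSne : S.Nonempty := ⟨_, z, w, hzw, rfl⟩
  have hmc : sInf S < c := (csInf_le hS0 ⟨z, w, hzw, rfl⟩).trans_lt hzc
  have hex : ∀ n : ℕ, ∃ y u, IsFeasible η 𝒜 F B y₀ y u ∧ cost α y u < c ∧
      cost α y u < sInf S + 1 / ((n : ℝ) + 1) := fun n => by
    have hpos : 0 < 1 / ((n : ℝ) + 1) := by positivity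
    obtain ⟨-, ⟨y, u, h1, rfl⟩, h2⟩ := exists_lt_of_csInf_lt hSne
      (lt_min hmc (lt_add_of_pos_right (sInf S) hpos))
    exact ⟨y, u, h1, lt_min_iff.1 h2⟩
  choose y u hfeas hcost hinf using hex
  obtain ⟨yₗ, φ, hφ, hy⟩ := W.exists_weakLim_subseq fun n => hb _ _ (hfeas n) (hcost n)
  obtain ⟨uₗ, ψ, hψ, hu⟩ := exists_weakLim_subseq (x := fun n => u (φ n)) (R := √(2 / α * c))
    fun n => Real.le_sqrt_of_sq_le (norm_sq_le_of_cost_le hα (hcost _).le).2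
  have hy := hy.comp hψ
  have hfe := fun n => isFeasible_iff.1 (hfeas (φ (ψ n)))
  have hlim : Tendsto (fun n => cost α (y (φ (ψ n))) (u (φ (ψ n)))) atTop (𝓝 (sInf S)) := by
    have h1 : Tendsto (fun n : ℕ => sInf S + 1 / ((n : ℝ) + 1)) atTop (𝓝 (sInf S)) := by
      simpa using tendsto_const_nhds.add (tendsto_one_div_add_atTop_nhds_zero_nat (𝕜 := ℝ))
    have h2 : Tendsto (fun n => cost α (y n) (u n)) atTop (𝓝 (sInf S)) :=
      tendsto_of_tendsto_of_tendsto_of_le_of_le tendsto_const_nhds h1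
        (fun n => csInf_le hS0 ⟨_, _, hfeas n, rfl⟩) fun n => (hinf n).le
    exact h2.comp (hφ.comp hψ).tendsto_atTop
  refine ⟨yₗ, uₗ, isFeasible_iff.2 ⟨?_, ?_, ?_⟩, fun z w hzw => ?_⟩
  · exact hu.mem_of_isClosed (convex_Uad η) (isClosed_Uad η) fun n => (hfe n).1
  -- The equation expresses `F(y_n)` through weakly continuous linear terms, so it converges weakly;
  -- weak closedness of the graph of `F` identifies the limit.
  · have h1 := (hy.map (evolution 𝒜)).sub (hu.map (ctrlL2 B))
    have h2 : (fun n => evolution 𝒜 (y (φ (ψ n))) - ctrlL2 B (u (φ (ψ n)))) =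
        fun n => F (y (φ (ψ n))) := funext fun n => by
      rw [(hfe n).2.1, add_sub_cancel_right]
    rw [h2] at h1
    rw [substitution_of_weakLim hF hj hweak hy h1, sub_add_cancel]
  · have h1 := hy.map (trace Ω)
    simp only [(hfe _).2.2] at h1
    exact h1.unique (weakLim_const y₀)
  · exact (cost_le_of_weakLim hα.le hy hu hlim).trans (csInf_le hS0 ⟨z, w, hzw, rfl⟩)

end

/-! ### Assembly: choice of the constants -/

section

theorem exists_optimal_of_small {d : ℕ} {Ω : Set (EuclideanSpace ℝ (Fin d))} (hΩ : IsOpen Ω)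
    {𝒰 : Type*} [NormedAddCommGroup 𝒰] [InnerProductSpace ℝ 𝒰] [CompleteSpace 𝒰]
    {H : Type*} [NormedAddCommGroup H] [InnerProductSpace ℝ H]
    {α η : ℝ} (hα : 0 < α) (hη : 0 < η) {A : Y Ω →ₗ.[ℝ] Y Ω} {𝒜 : V Ω →L[ℝ] VDual Ω}
    {B : 𝒰 →L[ℝ] Y Ω} (hext : IsExtension A 𝒜) (hgarding : Garding 𝒜) (hstab : Stabilizable A B)
    {f : ℝ → ℝ} {F : WInf Ω → L2VDual Ω} (hsubst : IsSubstitution f F) (hF : ContDiff ℝ 2 F)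
    (hF0 : F 0 = 0) (hF'0 : fderiv ℝ F 0 = 0) {j : H →L[ℝ] V Ω} (hj : DenseRange j)
    (hweak : ∀ T : ℝ, 0 < T →
      ∃ G : W Ω (Ioo 0 T) → Lp (StrongDual ℝ H) 1 (volume.restrict (Ioo 0 T)),
        IsSubstitutionOn f j T G ∧ WeakToWeakContinuous G) :
    ∃ δ₁ : ℝ, 0 < δ₁ ∧ ∃ M : ℝ, 0 < M ∧ ∀ y₀ : Y Ω, ‖y₀‖ < δ₁ →
      (∃ (y : WInf Ω) (u : Ctrl 𝒰), IsOptimal α η 𝒜 F B y₀ y u) ∧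
        ∀ (y : WInf Ω) (u : Ctrl 𝒰), IsOptimal α η 𝒜 F B y₀ y u → max ‖y‖ ‖u‖ ≤ M * ‖y₀‖ := by
  obtain ⟨δ, C, hδ, hC, hex⟩ :=
    exists_feasible_of_small hΩ hη hα hext hgarding hstab hF hF0 hF'0
  have hFd : HasFDerivAt F (0 : WInf Ω →L[ℝ] L2VDual Ω) 0 := by
    have h := (hF.differentiable (by norm_num) 0).hasFDerivAt
    rwa [hF'0] at h
  obtain ⟨r, K, hr, hK, hap⟩ := exists_apriori_bound hΩ B hgarding hsubst hFd hF0 η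
  -- A cost at most `c` bounds `‖y‖²_{L²(Y)} + ‖u‖²` by `L c`; `N ‖y₀‖²` then bounds the total data
  -- size at the cost of the feedback pair.
  obtain ⟨L, hL⟩ : ∃ L, L = 2 + 2 / α := ⟨_, rfl⟩
  have hLp : 0 < L := by rw [hL]; positivity
  obtain ⟨N, hN⟩ : ∃ N, N = 1 + L * C := ⟨_, rfl⟩
  have hNp : 0 < N := by rw [hN]; positivity
  have htotal : ∀ {y₀ : Y Ω} {y : WInf Ω} {u : Ctrl 𝒰} {c : ℝ}, cost α y u ≤ c →
      ‖y₀‖ ^ 2 + ‖inclL2 Ω y‖ ^ 2 + ‖u‖ ^ 2 ≤ ‖y₀‖ ^ 2 + L * c := fun h => by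
    obtain ⟨h1, h2⟩ := norm_sq_le_of_cost_le hα h
    rw [hL]
    linarith
  -- The data of the feedback pair stay below `r / 2`; the other half of `r` leaves room for a cost
  -- level strictly above that pair. In `√((K + 1) N)` the summand `K` serves the state and `1` the
  -- control.
  refine ⟨min δ √(r / (2 * N)), by positivity, √((K + 1) * N), by positivity, fun y₀ hy₀ => ?_⟩
  have hy₀r : N * ‖y₀‖ ^ 2 < r / 2 := by
    have h := (Real.lt_sqrt (norm_nonneg _)).1 (lt_min_iff.1 hy₀).2
    rw [lt_div_iff₀ (by positivity)] at h
    linarith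
  obtain ⟨z, w, hzw, hzc⟩ := hex y₀ (lt_min_iff.1 hy₀).1
  have hsplit : ‖y₀‖ ^ 2 + L * (C * ‖y₀‖ ^ 2) = N * ‖y₀‖ ^ 2 := by rw [hN]; ring
  constructor
  · have hε : 0 < r / (2 * L) := by positivity
    refine exists_optimal hα hsubst hj hweak (c := C * ‖y₀‖ ^ 2 + r / (2 * L)) (R := √(K * r))
      ⟨z, w, hzw, by linarith⟩ fun y u hf hc => ?_
    have h1 := htotal (y₀ := y₀) hc.le
    have h2 : L * (r / (2 * L)) = r / 2 := by field_simp
    have h3 : ‖y₀‖ ^ 2 + ‖inclL2 Ω y‖ ^ 2 + ‖u‖ ^ 2 < r := by linarith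
    exact Real.le_sqrt_of_sq_le ((hap y₀ y u hf h3).trans (mul_le_mul_of_nonneg_left h3.le hK.le))
  · intro y u hopt
    have h1 := htotal (y₀ := y₀) ((hopt.2 z w hzw).trans hzc)
    rw [hsplit] at h1
    have h2 := hap y₀ y u hopt.1 (by linarith)
    have h3 : K * (‖y₀‖ ^ 2 + ‖inclL2 Ω y‖ ^ 2 + ‖u‖ ^ 2) ≤ K * (N * ‖y₀‖ ^ 2) :=
      mul_le_mul_of_nonneg_left h1 hK.le
    have h4 : 0 ≤ K * (N * ‖y₀‖ ^ 2) := by positivity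
    have h5 : 0 ≤ N * ‖y₀‖ ^ 2 := by positivity
    have h6 : (√((K + 1) * N) * ‖y₀‖) ^ 2 = K * (N * ‖y₀‖ ^ 2) + N * ‖y₀‖ ^ 2 := by
      rw [mul_pow, Real.sq_sqrt (by positivity)]; ring
    refine max_le (le_of_sq_le_sq ?_ (by positivity)) (le_of_sq_le_sq ?_ (by positivity))
    · linarith
    · linarith [sq_nonneg ‖y₀‖, sq_nonneg ‖inclL2 Ω y‖]

end

end ParabolicControl

end

theorem lemma4p4 {d : ℕ} (Ω : Set (EuclideanSpace ℝ (Fin d)))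
    (hΩ_open : IsOpen Ω) (hΩ_conn : IsConnected Ω) (hΩ_bdd : Bornology.IsBounded Ω)
    {𝒰 : Type*} [NormedAddCommGroup 𝒰] [InnerProductSpace ℝ 𝒰] [CompleteSpace 𝒰]
    {H : Type*} [NormedAddCommGroup H] [InnerProductSpace ℝ H] [CompleteSpace H]
    (α η : ℝ) (hα : 0 < α) (hη : 0 < η)
    -- the operator `A`, its extension `𝒜 ∈ ℒ(V, V*)`, and the control operator
    (A : ParabolicControl.Y Ω →ₗ.[ℝ] ParabolicControl.Y Ω)
    (𝒜 : ParabolicControl.V Ω →L[ℝ] ParabolicControl.VDual Ω)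
    (B : 𝒰 →L[ℝ] ParabolicControl.Y Ω)
    (hA : ParabolicControl.GeneratesAnalyticSemigroup A)
    (hext : ParabolicControl.IsExtension A 𝒜)
    (hgarding : ParabolicControl.Garding 𝒜)
    (hstab : ParabolicControl.Stabilizable A B)
    -- the nonlinearity
    (f : ℝ → ℝ) (F : ParabolicControl.WInf Ω → ParabolicControl.L2VDual Ω)
    (hsubst : ParabolicControl.IsSubstitution f F)
    (hF : ParabolicControl.IsC2BoundedHess F) (hF0 : F 0 = 0) (hF'0 : fderiv ℝ F 0 = 0)
    (j : H →L[ℝ] ParabolicControl.V Ω) (hj : Function.Injective j) (hj_dense : DenseRange j)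
    (hweak : ∀ T : ℝ, 0 < T →
      ∃ G : ParabolicControl.W Ω (Ioo 0 T) → Lp (StrongDual ℝ H) 1 (volume.restrict (Ioo 0 T)),
        ParabolicControl.IsSubstitutionOn f j T G ∧ ParabolicControl.WeakToWeakContinuous G) :
    ∃ δ₁ : ℝ, 0 < δ₁ ∧ ∃ M : ℝ, 0 < M ∧
      ∀ y₀ : ParabolicControl.Y Ω, ‖y₀‖ < δ₁ →
        (∃ (y : ParabolicControl.WInf Ω) (u : ParabolicControl.Ctrl 𝒰),
          ParabolicControl.IsOptimal α η 𝒜 F B y₀ y u) ∧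
        ∀ (y : ParabolicControl.WInf Ω) (u : ParabolicControl.Ctrl 𝒰),
          ParabolicControl.IsOptimal α η 𝒜 F B y₀ y u → max ‖y‖ ‖u‖ ≤ M * ‖y₀‖ := by
  exact ParabolicControl.exists_optimal_of_small hΩ_open hα hη hext hgarding hstab hsubst hF.1 hF0
    hF'0 hj_dense hweak
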